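/- Let $N\in\{2,3\}$, let $\Omega\subset\mathbb{R}^N$ be a bounded convex polyhedral domain, $\tau>0$ and $1<p<\infty$. For $n\in\mathbb{N}$ let $\mathcal{T}_n$ be a conforming subdivision of $\overline\Omega$ into finitely many closed triangles ($N=2$) or tetrahedra ($N=3$), with cell diameters at most $h_n$, where $h_n\to 0$. Let $\mathcal{F}_n$ be the set of its facets, $n_{T,F}$ the outer unit normal of a cell $T$ at its facet $F$, and $|T|$, $|F|$ the volume of $T$ and the surface measure of $F$. Let $\mathrm{DG}^0_n$ be the space of functions that are constant on each cell of $\mathcal{T}_n$. For $v\in[\mathrm{DG}^0_n]^N$, the jump $[\![v]\!]_F$ is the difference of the values of $v$ on the two cells sharing $F$ if $F$ is an interior facet (the sign is irrelevant here), and the value of $v$ on the adjacent cell if $F\subset\partial\Omega$; put $$|v|_{J,1}=\sum_{F\in\mathcal{F}_n}\|[\![v]\!]_F\|_{L^1(F)} .$$ For $v,g\in[\mathrm{DG}^0_n]^N$ the lifted gradient $\mathcal{G}^{g}_n v\in[\mathrm{DG}^0_n]^{N\times N}$ of $v$ with discrete boundary datum $g$ is given on each cell $T$ by $$\mathcal{G}^{g}_n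 v|_T=\sum_{F\subset\partial T}\frac{|F|}{|T|}\,(v_F-v_T)\otimes n_{T,F},$$ where $v_T$ is the value of $v$ on $T$, and $v_F$ is the average of the values of $v$ on the two cells sharing $F$ if $F$ is an interior facet, and the trace of $g$ on $F$ if $F\subset\partial\Omega$. Let $d_0\in C^1(\overline\Omega;\mathbb{R}^N)$ and let $d_n\in[\mathrm{DG}^0_n]^N$ satisfy $\|d_n-d_0\|_{L^\infty(\partial\Omega)}\le C h_n$ with a constant $C$ independent of $n$. Let $v_n:[0,\tau]\to[\mathrm{DG}^0_n]^N$ be such that $$v_n\rightharpoonup v \ \text{ weakly in } L^p(0,\tau;L^p(\Omega;\mathbb{R}^N)),\qquad \sup_n|v_n|_{J,1}\in L^1(0,\tau),$$ $$\mathcal{G}^{d_n}_n v_n\rightharpoonup W\ \text{ weakly in } L^p(0,\tau;L^p(\Omega;\mathbb{R}^{N\times N})).$$ Then $W=\nabla v$ a.e. in $(0,\tau)\times\Omega$ and $\operatorname{tr}(v)=d_0|_{\partial\Omega}$ a.e. in $(0,\tau)\times\partial\Omega$; that is, for a.e. $t\in(0,\tau)$ one has $v(t)\in W^{1,p}(\Omega;\mathbb{R}^N)$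 with weak gradient $W(t)$ and with Sobolev trace $d_0|_{\partial\Omega}$. -/

import Mathlib

open MeasureTheory Filter Topology Set
open scoped ENNReal ContDiff MeasureTheory

noncomputable section

namespace DGLift

/-- `ℝᴺ` with the Euclidean norm. -/
abbrev Eucl (N : ℕ) : Type := EuclideanSpace ℝ (Fin N)

/-! ### Convex polyhedral domains and simplicial meshes -/

/-- A bounded convex polyhedral domain: a nonempty open convex set whose closure is a polytope,
i.e. the convex hull of finitely many points (in particular it is bounded). -/
structure IsConvexPolyhedralDomain {N : ℕ} (Ω : Set (Eucl N)) : Prop where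
  isOpen : IsOpen Ω
  nonempty : Ω.Nonempty
  convex : Convex ℝ Ω
  polyhedral : ∃ S : Finset (Eucl N), closure Ω = convexHull ℝ (S : Set (Eucl N))

/-- A (conforming) subdivision of `Ω ⊆ ℝᴺ` into closed `N`-simplices: a finite geometric simplicial
complex with underlying space `closure Ω` in which every face belongs to an `N`-simplex.
Simplices are represented by their sets of vertices. -/
structure Mesh {N : ℕ} (Ω : Set (Eucl N)) where
  complex : Geometry.SimplicialComplex ℝ (Eucl N)
  finite_faces : complex.faces.Finite
  pure : ∀ s ∈ complex.faces, ∃ t ∈ complex.faces, s ⊆ t ∧ t.card = N + 1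
  space_eq : complex.space = closure Ω

namespace Mesh

variable {N : ℕ} {Ω : Set (Eucl N)} (M : Mesh Ω)

open Classical in
/-- The cells of the mesh (triangles if `N = 2`, tetrahedra if `N = 3`), given by vertex sets. -/
def cells : Finset (Finset (Eucl N)) := M.finite_faces.toFinset.filter fun s => s.card = N + 1

open Classical in
/-- The facets of the mesh (edges if `N = 2`, triangles if `N = 3`), given by vertex sets. -/
def facets : Finset (Finset (Eucl N)) := M.finite_faces.toFinset.filter fun s => s.card = N

/-- The type of cells. -/
abbrev Cell : Type := {T : Finset (Eucl N) // T ∈ M.cells}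

open Classical in
/-- The facets of the cell `T`. -/
def facetsOf (T : M.Cell) : Finset (Finset (Eucl N)) := M.facets.filter fun F => F ⊆ T.1

open Classical in
/-- The cells sharing the facet `F` (two for an interior facet, one for a boundary facet). -/
def cellsAt (F : Finset (Eucl N)) : Finset M.Cell := Finset.univ.filter fun T => F ⊆ T.1

/-- `F` is a boundary facet, i.e. it is contained in `∂Ω`; otherwise it is an interior facet. -/
def IsBoundary (Ω : Set (Eucl N)) (F : Finset (Eucl N)) : Prop :=
  convexHull ℝ (F : Set (Eucl N)) ⊆ frontier Ω

/-- The volume `|T|` of a cell. -/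
def cellVol (T : M.Cell) : ℝ := volume.real (convexHull ℝ (T.1 : Set (Eucl N)))

/-- The `(N - 1)`-dimensional surface measure `|F|` of a facet. -/
def facetArea (F : Finset (Eucl N)) : ℝ :=
  (μHE[N - 1] : Measure (Eucl N)).real (convexHull ℝ (F : Set (Eucl N)))

/-- The outer unit normal `n_{T,F}` of the simplex with vertex set `T` at its facet `F`: the
normalised component, orthogonal to (the hyperplane spanned by) `F`, of the vector from the
barycenter of `T` to the barycenter of `F`. -/
def outerNormal (T F : Finset (Eucl N)) : Eucl N :=
  let w : Eucl N := (vectorSpan ℝ (F : Set (Eucl N)))ᗮ.starProjection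
    (F.centroid ℝ id - T.centroid ℝ id)
  ‖w‖⁻¹ • w

open Classical in
/-- A fixed unit normal `n_F` of the facet `F`: the outer normal of one of the cells at `F`, chosen
once and for all. (On a boundary facet this is the outer normal of `Ω`.) -/
def facetNormal (F : Finset (Eucl N)) : Eucl N :=
  if h : (M.cellsAt F).Nonempty then outerNormal h.choose.1 F else 0

end Mesh

/-! ### Piecewise constant functions, jumps, and the discrete (lifted) gradient -/

/-- `DG⁰`: piecewise constant functions with values in `V`, given by their values on the cells. -/
abbrev DG0 {N : ℕ} {Ω : Set (Eucl N)} (M : Mesh Ω) (V : Type) : Type := M.Cell → V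

namespace DG0

variable {N : ℕ} {Ω : Set (Eucl N)} {M : Mesh Ω}

/-- The function on `ℝᴺ` represented by an element of `DG⁰`; it is constant in the interior of each
cell, and zero on the null set of points in no such interior. -/
def toFun {V : Type} [AddCommMonoid V] (v : DG0 M V) (x : Eucl N) : V :=
  ∑ T : M.Cell, (interior (convexHull ℝ (T.1 : Set (Eucl N)))).indicator (fun _ => v T) x

/-- The jump `⟦v⟧_F`. Since `n_{T,F} ⬝ n_F = ± 1` this is the difference `v|_{T₁} - v|_{T₂}` on an
interior facet shared by `T₁, T₂` with `n_F` pointing from `T₁` to `T₂`, and the value of `v` on the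
only cell at `F` if `F` is a boundary facet. -/
def jump (v : DG0 M (Eucl N)) (F : Finset (Eucl N)) : Eucl N :=
  ∑ T ∈ M.cellsAt F, inner ℝ (Mesh.outerNormal T.1 F) (M.facetNormal F) • v T

/-- The jump seminorm with exponent `1`, `|v|_{J,1} = ∑_F ‖⟦v⟧_F‖_{L¹(F)}`, where the sum is over
all interior and boundary facets. -/
def jumpSeminorm (v : DG0 M (Eucl N)) : ℝ :=
  ∑ F ∈ M.facets, Mesh.facetArea F * ‖jump v F‖

open Classical in
/-- The facet value `v_F` entering the discrete gradient on the cell `T`: the average of the values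
on the two adjacent cells if `F` is an interior facet, and the trace on `F` of the
boundary datum `g` if `F` is a boundary facet of `T`. -/
def facetValue (v g : DG0 M (Eucl N)) (T : M.Cell) (F : Finset (Eucl N)) : Eucl N :=
  if Mesh.IsBoundary Ω F then g T else (1 / 2 : ℝ) • ∑ T' ∈ M.cellsAt F, v T'

/-- The tensor product `a ⊗ b = a bᵀ`, as a linear map. -/
def tensor (a b : Eucl N) : Eucl N →L[ℝ] Eucl N := (innerSL ℝ b).smulRight a

/-- The lifted (discrete) gradient of `v` with discrete Dirichlet datum `g`,
`G|_T = ∑_{F ⊂ ∂T} |F| / |T| (v_F - v_T) ⊗ n_{T,F}`. -/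
def liftedGradient (v g : DG0 M (Eucl N)) : DG0 M (Eucl N →L[ℝ] Eucl N) := fun T =>
  ∑ F ∈ M.facetsOf T, (Mesh.facetArea F / M.cellVol T) •
    tensor (facetValue v g T F - v T) (Mesh.outerNormal T.1 F)

end DG0

/-! ### Weak convergence in `Lᵖ`, Sobolev functions and traces -/

/-- `f n ⇀ g` weakly in `Lᵖ(μ; V)`: all functions are in `Lᵖ`, and `ℓ (f n) → ℓ g` for each
continuous linear functional `ℓ` on `Lᵖ(μ; V)`. -/
def WeaklyConvergesLp {α V : Type} [MeasurableSpace α] [NormedAddCommGroup V] [NormedSpace ℝ V]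
    (p : ℝ≥0∞) [Fact (1 ≤ p)] (μ : Measure α) (f : ℕ → α → V) (g : α → V) : Prop :=
  ∃ (hf : ∀ n, MemLp (f n) p μ) (hg : MemLp g p μ),
    ∀ ℓ : Lp V p μ →L[ℝ] ℝ, Tendsto (fun n => ℓ ((hf n).toLp (f n))) atTop (𝓝 (ℓ (hg.toLp g)))

/-- `u ∈ W^{1,p}(Ω; ℝᴺ)` with weak gradient `G`, i.e. `u, G ∈ Lᵖ(Ω)` and
`∫_Ω u ∂ₑφ = - ∫_Ω (G e) φ` for all `φ ∈ C_c^∞(Ω)` and all directions `e`. -/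
structure HasSobolevGradient {N : ℕ} (p : ℝ≥0∞) (Ω : Set (Eucl N)) (u : Eucl N → Eucl N)
    (G : Eucl N → Eucl N →L[ℝ] Eucl N) : Prop where
  memLp : MemLp u p (volume.restrict Ω)
  memLp_grad : MemLp G p (volume.restrict Ω)
  integral_eq : ∀ φ : Eucl N → ℝ, ContDiff ℝ ∞ φ → HasCompactSupport φ → tsupport φ ⊆ Ω →
    ∀ e : Eucl N, ∫ x in Ω, fderiv ℝ φ x e • u x = - ∫ x in Ω, φ x • G x e

/-- `u ∈ W^{1,p}(Ω; ℝᴺ)` has trace `g` on `∂Ω`: there are `u_k ∈ C¹(closure Ω)` with `u_k → u` in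
`W^{1,p}(Ω)` and `u_k|_∂Ω → g` in `Lᵖ(∂Ω)` (with respect to the surface measure). This is the trace
operator as the continuous extension of the restriction `u ↦ u|_∂Ω`. -/
def HasTrace {N : ℕ} (p : ℝ≥0∞) (Ω : Set (Eucl N)) (u g : Eucl N → Eucl N) : Prop :=
  ∃ (G : Eucl N → Eucl N →L[ℝ] Eucl N) (w : ℕ → Eucl N → Eucl N),
    HasSobolevGradient p Ω u G ∧
    (∀ k, ContDiffOn ℝ 1 (w k) (closure Ω)) ∧
    Tendsto (fun k => eLpNorm (w k - u) p (volume.restrict Ω)) atTop (𝓝 0) ∧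
    Tendsto (fun k => eLpNorm (fderiv ℝ (w k) - G) p (volume.restrict Ω)) atTop (𝓝 0) ∧
    Tendsto (fun k => eLpNorm (w k - g) p
      ((μHE[N - 1] : Measure (Eucl N)).restrict (frontier Ω))) atTop (𝓝 0)

/-- The measure on the space-time cylinder `(0,τ) × Ω`, so that `Lᵖ(0,τ; Lᵖ(Ω))` is `Lᵖ` of it. -/
def cylinder {N : ℕ} (τ : ℝ) (Ω : Set (Eucl N)) : Measure (ℝ × Eucl N) :=
  (volume.restrict (Ioo 0 τ)).prod (volume.restrict Ω)

end DGLift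

end

noncomputable section

namespace DGLift

/-! ### Averages over simplices -/

/-! Test the lifted gradient with a smooth compactly supported `φ` that need not vanish on `∂Ω`, and
measure by `residual` how far it is from satisfying the integration by parts formula with boundary
values `d₀`. The divergence theorem on each cell (`IsSimplex.integral_fderiv`) turns the residual
into a sum over facets. On an interior facet the averaged facet value and the opposite normals leave
only the jump of `v`, multiplied by differences between cell and facet averages of `φ`, which are
`O(h)`. On a boundary facet the remainder is `O(h)` times the trace of `v`, which is the jump there,
plus a bounded quantity, because the discrete datum is `O(h)`-close to `d₀`. The total area of the
boundary facets is bounded independently of the mesh (`Mesh.sum_facetArea_boundary_le`), so the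
residual is at most a constant times `h (|v|_{J,1} + 1)` (`norm_residual_le`).

The integrable supremum of the jump seminorms makes the residuals tend to zero in `L¹(0,τ)`, while
weak convergence identifies their limit on every measurable set of times. Separability of the space
of test functionals then gives one null set of times for all `φ` (`ae_hasZeroTraceGradient`): for
a.e. `t`, the extension of `v(t) - d₀` by zero has as weak gradient the extension of `W(t) - ∇d₀` by
zero.

This single property carries both conclusions. Test functions supported in `Ω` give `W = ∇v`. For
the trace, the zero extension is mollified and composed with a dilation of factor slightly above one
about an interior point; by convexity the result vanishes on `∂Ω`, and it converges in `W^{1,p}(Ω)`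
(`HasZeroTraceGradient.exists_approx`). Adding `d₀` yields `C¹` approximations of `v` that equal
`d₀` on the boundary. -/

/-- The standard corner simplex `{x | 0 ≤ x, ∑ x ≤ 1}`. -/
def stdCorner (m : ℕ) : Set (Fin m → ℝ) := {x | (∀ i, 0 ≤ x i) ∧ ∑ i, x i ≤ 1}

lemma isClosed_stdCorner (m : ℕ) : IsClosed (stdCorner m) := by
  have : stdCorner m = (⋂ i, {x : Fin m → ℝ | 0 ≤ x i}) ∩ {x | ∑ i, x i ≤ 1} := by
    ext x; simp [stdCorner]
  rw [this]
  exact (isClosed_iInter fun i => isClosed_le continuous_const (continuous_apply i)).inter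
    (isClosed_le (by fun_prop) continuous_const)

lemma stdCorner_le_one {m : ℕ} {x : Fin m → ℝ} (hx : x ∈ stdCorner m) (i : Fin m) : x i ≤ 1 :=
  (Finset.single_le_sum (fun j _ => hx.1 j) (Finset.mem_univ i)).trans hx.2

lemma isCompact_stdCorner (m : ℕ) : IsCompact (stdCorner m) := by
  refine (isCompact_Icc (a := (0 : Fin m → ℝ)) (b := 1)).of_isClosed_subset
    (isClosed_stdCorner m) fun x hx => ⟨fun i => hx.1 i, fun i => stdCorner_le_one hx i⟩

lemma convex_stdCorner (m : ℕ) : Convex ℝ (stdCorner m) := by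
  intro x hx y hy a b ha hb hab
  refine ⟨fun i => ?_, ?_⟩
  · have := hx.1 i
    have := hy.1 i
    simp only [Pi.add_apply, Pi.smul_apply, smul_eq_mul]
    positivity
  · simp only [Pi.add_apply, Pi.smul_apply, smul_eq_mul, Finset.sum_add_distrib, ← Finset.mul_sum]
    nlinarith [hx.2, hy.2]

variable {E : Type*} [NormedAddCommGroup E] [InnerProductSpace ℝ E]

/-- The affine parametrisation of the simplex with vertices `p` by the standard corner simplex. -/
def simplexMap {m : ℕ} (p : Fin (m + 1) → E) (x : Fin m → ℝ) : E :=
  p 0 + ∑ k, x k • (p k.succ - p 0)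

lemma simplexMap_eq_sum {m : ℕ} (p : Fin (m + 1) → E) (x : Fin m → ℝ) :
    simplexMap p x = (1 - ∑ k, x k) • p 0 + ∑ k, x k • p k.succ := by
  simp only [simplexMap, smul_sub, Finset.sum_sub_distrib, sub_smul, one_smul, ← Finset.sum_smul]
  abel

lemma continuous_simplexMap {m : ℕ} (p : Fin (m + 1) → E) : Continuous (simplexMap p) := by
  unfold simplexMap; fun_prop

lemma image_stdCorner {m : ℕ} (p : Fin (m + 1) → E) :
    simplexMap p '' stdCorner m = convexHull ℝ (range p) := by
  apply Subset.antisymm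
  · rintro _ ⟨x, hx, rfl⟩
    rw [simplexMap_eq_sum]
    have := (convex_convexHull ℝ (range p)).sum_mem (t := Finset.univ)
      (w := Fin.cons (1 - ∑ k, x k) x) (z := p) ?_ ?_ ?_
    · simpa [Fin.sum_univ_succ] using this
    · intro i _
      refine Fin.cases ?_ (fun k => ?_) i
      · simpa using hx.2
      · simpa using hx.1 k
    · simp [Fin.sum_univ_succ]
    · intro i _
      exact subset_convexHull _ _ (mem_range_self i)
  · refine convexHull_min ?_ ?_
    · rintro _ ⟨i, rfl⟩
      refine Fin.cases ⟨0, ⟨by simp, by simp⟩, by simp [simplexMap]⟩ (fun k => ?_) i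
      refine ⟨Pi.single k 1, ⟨fun j => ?_, by simp⟩, ?_⟩
      · by_cases h : j = k
        · subst h; simp
        · simp [h]
      · rw [simplexMap, Finset.sum_eq_single k] <;> simp +contextual
    · rintro _ ⟨x, hx, rfl⟩ _ ⟨y, hy, rfl⟩ a b ha hb hab
      refine ⟨a • x + b • y, convex_stdCorner m hx hy ha hb hab, ?_⟩
      simp only [simplexMap, Pi.add_apply, Pi.smul_apply, smul_eq_mul, add_smul, mul_smul,
        Finset.sum_add_distrib, ← Finset.smul_sum]
      match_scalars <;> linarith

lemma linearIndependent_edges {m : ℕ} {p : Fin (m + 1) → E} (hp : AffineIndependent ℝ p) :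
    LinearIndependent ℝ (fun k : Fin m => p k.succ - p 0) := by
  have := (affineIndependent_iff_linearIndependent_vsub ℝ p 0).1 hp
  exact this.comp (fun k : Fin m => ⟨k.succ, Fin.succ_ne_zero k⟩)
    (fun a b h => by simpa using h)

lemma injective_simplexMap {m : ℕ} {p : Fin (m + 1) → E} (hp : AffineIndependent ℝ p) :
    Function.Injective (simplexMap p) := by
  intro x y h
  have hli := linearIndependent_edges hp
  have h2 : ∑ k, (x k - y k) • (p k.succ - p 0) = 0 := by
    simp only [simplexMap, add_right_inj] at h
    simp only [sub_smul, Finset.sum_sub_distrib]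
    rw [h, sub_self]
  funext k
  have := Fintype.linearIndependent_iff.1 hli _ h2 k
  linarith

lemma measurableEmbedding_simplexMap [MeasurableSpace E] [BorelSpace E] {m : ℕ} {p : Fin (m + 1) → E}
    (hp : AffineIndependent ℝ p) :
    MeasurableEmbedding (simplexMap p) :=
  (continuous_simplexMap p).measurableEmbedding (injective_simplexMap hp)

section

variable [FiniteDimensional ℝ E] [MeasurableSpace E] [BorelSpace E]

/-- Uniqueness of Haar measure on the direction space `V` of the simplex: Hausdorff measure on `V`
and the image of Lebesgue measure are both translation invariant, and `x ↦ p 0 + x` is an isometry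
onto the affine span. The value of `c` is never needed, since only averages are compared. -/
lemma exists_restrict_range_simplexMap {m : ℕ} {p : Fin (m + 1) → E} (hp : AffineIndependent ℝ p) :
    ∃ c : NNReal, c ≠ 0 ∧ (μHE[m] : Measure E).restrict (range (simplexMap p)) =
      c • (volume.map (simplexMap p)) := by
  classical
  have hli := linearIndependent_edges hp
  let V := Submodule.span ℝ (range fun k : Fin m => p k.succ - p 0)
  let b : Module.Basis (Fin m) ℝ V := Module.Basis.span hli
  have hfr : Module.finrank ℝ V = m := by
    rw [Module.finrank_eq_card_basis b]; simp
  let A : (Fin m → ℝ) ≃L[ℝ] V := b.equivFun.symm.toContinuousLinearEquiv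
  have : (μHE[m] : Measure V).IsAddHaarMeasure := by
    have := isAddHaarMeasure_euclideanHausdorffMeasure (E := V)
    rwa [hfr] at this
  have : ((volume : Measure (Fin m → ℝ)).map A).IsAddHaarMeasure := A.isAddHaarMeasure_map volume
  let ι : V → E := fun x => p 0 + x
  have hι : Isometry ι := by
    intro x y
    simp only [ι, edist_add_left]
    rfl
  have hcomp : ι ∘ A = simplexMap p := by
    funext x
    simp only [Function.comp, ι, simplexMap, A]
    congr 1
    have hb (k : Fin m) : ((b k : V) : E) = p k.succ - p 0 :=
      congrArg Subtype.val (Module.Basis.span_apply hli k)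
    simp [Module.Basis.equivFun_symm_apply, hb]
  have hrange : range (simplexMap p) = range ι := by
    rw [← hcomp, A.surjective.range_comp]
  refine ⟨Measure.addHaarScalarFactor (μHE[m] : Measure V) (volume.map A),
    (Measure.addHaarScalarFactor_pos_of_isAddHaarMeasure _ _).ne', ?_⟩
  rw [hrange, ← hι.map_euclideanHausdorffMeasure, ← hcomp,
    ← Measure.map_map hι.continuous.measurable A.continuous.measurable, ← Measure.map_smul,
    ← Measure.isAddLeftInvariant_eq_smul]

lemma exists_scale_simplex {m : ℕ} {p : Fin (m + 1) → E} (hp : AffineIndependent ℝ p) :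
    ∃ c : NNReal, c ≠ 0 ∧ (μHE[m] : Measure E).restrict (convexHull ℝ (range p)) =
      c • ((volume.restrict (stdCorner m)).map (simplexMap p)) := by
  obtain ⟨c, hc, h⟩ := exists_restrict_range_simplexMap hp
  refine ⟨c, hc, ?_⟩
  have hm := measurableEmbedding_simplexMap hp
  have hS : MeasurableSet (simplexMap p '' stdCorner m) :=
    hm.measurableSet_image.2 (isClosed_stdCorner m).measurableSet
  have h1 : (μHE[m] : Measure E).restrict (simplexMap p '' stdCorner m) =
      ((μHE[m] : Measure E).restrict (range (simplexMap p))).restrict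
        (simplexMap p '' stdCorner m) := by
    rw [Measure.restrict_restrict hS, inter_eq_left.2 (image_subset_range _ _)]
  rw [← image_stdCorner, h1, h, Measure.restrict_smul, hm.restrict_map,
    preimage_image_eq _ (injective_simplexMap hp)]

/-- The unknown scaling factor cancels in an average. No integrability of `f` is required, because
the parametrisation is a measurable embedding. -/
lemma average_simplex {m : ℕ} {p : Fin (m + 1) → E} (hp : AffineIndependent ℝ p)
    {G : Type*} [NormedAddCommGroup G] [NormedSpace ℝ G] (f : E → G) :
    ⨍ x in convexHull ℝ (range p), f x ∂(μHE[m] : Measure E) =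
      ⨍ x in stdCorner m, f (simplexMap p x) := by
  obtain ⟨c, hc, h⟩ := exists_scale_simplex hp
  have hm := measurableEmbedding_simplexMap hp
  rw [average_eq, average_eq, h, integral_smul_nnreal_measure, hm.integral_map,
    measureReal_nnreal_smul_apply, map_measureReal_apply hm.measurable MeasurableSet.univ,
    preimage_univ, NNReal.smul_def, smul_smul]
  congr 1
  have : (c : ℝ) ≠ 0 := by exact_mod_cast hc
  field_simp

end

/-! ### The fundamental theorem of calculus along an edge of a simplex -/

lemma cons_mem_stdCorner {m : ℕ} {s : ℝ} {y : Fin m → ℝ} :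
    (Fin.cons s y : Fin (m + 1) → ℝ) ∈ stdCorner (m + 1) ↔
      y ∈ stdCorner m ∧ s ∈ Icc 0 (1 - ∑ i, y i) := by
  simp only [stdCorner, mem_ofPred_eq, Fin.forall_fin_succ, Fin.cons_zero, Fin.cons_succ,
    Fin.sum_univ_succ, mem_Icc]
  constructor
  · rintro ⟨⟨h1, h2⟩, h3⟩
    exact ⟨⟨h2, by linarith⟩, h1, by linarith⟩
  · rintro ⟨⟨h1, h2⟩, h3, h4⟩
    exact ⟨⟨h3, h1⟩, by linarith⟩

/-- Fubini with the first coordinate innermost; the inner integral is an interval integral so that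
the fundamental theorem of calculus applies to it. -/
lemma setIntegral_stdCorner_succ {m : ℕ} {G : Type*} [NormedAddCommGroup G] [NormedSpace ℝ G]
    {f : (Fin (m + 1) → ℝ) → G} (hf : IntegrableOn f (stdCorner (m + 1))) :
    ∫ x in stdCorner (m + 1), f x =
      ∫ y in stdCorner m, ∫ s in (0 : ℝ)..(1 - ∑ i, y i), f (Fin.cons s y) := by
  have hm1 := (isClosed_stdCorner (m + 1)).measurableSet
  have hm := (isClosed_stdCorner m).measurableSet
  have hmp := (volume_preserving_piFinSuccAbove (fun _ : Fin (m + 1) => ℝ) 0).symm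
  have hsymm : ∀ z : ℝ × (Fin m → ℝ),
      (MeasurableEquiv.piFinSuccAbove (fun _ : Fin (m + 1) => ℝ) 0).symm z = Fin.cons z.1 z.2 := by
    intro z
    simp [MeasurableEquiv.piFinSuccAbove]
    rfl
  rw [← integral_indicator hm1, ← hmp.integral_comp', ← integral_indicator hm]
  have hint : Integrable (fun z : ℝ × (Fin m → ℝ) => (stdCorner (m + 1)).indicator f
      ((MeasurableEquiv.piFinSuccAbove (fun _ : Fin (m + 1) => ℝ) 0).symm z)) volume :=
    (hmp.integrable_comp_emb (MeasurableEquiv.measurableEmbedding _)).2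
      ((integrable_indicator_iff hm1).2 hf)
  rw [Measure.volume_eq_prod] at hint ⊢
  rw [integral_prod_symm _ hint]
  congr 1
  funext y
  simp only [hsymm]
  by_cases hy : y ∈ stdCorner m
  · rw [indicator_of_mem hy, intervalIntegral.integral_of_le (by linarith [hy.2]),
      ← integral_Icc_eq_integral_Ioc, ← integral_indicator measurableSet_Icc]
    congr 1
    funext s
    by_cases hs : s ∈ Icc 0 (1 - ∑ i, y i)
    · rw [indicator_of_mem hs, indicator_of_mem (cons_mem_stdCorner.2 ⟨hy, hs⟩)]
    · rw [indicator_of_notMem hs, indicator_of_notMem fun h => hs (cons_mem_stdCorner.1 h).2]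
  · rw [indicator_of_notMem hy]
    have : ∀ s : ℝ, (stdCorner (m + 1)).indicator f (Fin.cons s y) = 0 := fun s =>
      indicator_of_notMem (fun h => hy (cons_mem_stdCorner.1 h).1) _
    simp [this]

variable {E : Type*} [NormedAddCommGroup E] [InnerProductSpace ℝ E]

/-- The first coordinate moves a point parallel to the edge from `p 0` to `p 1`. The segment starts
on the facet opposite `p 1` and, by `simplexMap_cons_top`, ends on the facet opposite `p 0`. -/
lemma simplexMap_cons {m : ℕ} (p : Fin (m + 2) → E) (s : ℝ) (y : Fin m → ℝ) :
    simplexMap p (Fin.cons s y) = simplexMap (p ∘ Fin.succAbove 1) y + s • (p 1 - p 0) := by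
  simp only [simplexMap, Fin.sum_univ_succ, Fin.cons_zero, Fin.cons_succ, Function.comp]
  have h0 : (1 : Fin (m + 2)).succAbove 0 = 0 := by simp
  have h1 : ∀ k : Fin m, (1 : Fin (m + 2)).succAbove k.succ = k.succ.succ := fun k => by
    rw [← Fin.succ_zero_eq_one, Fin.succ_succAbove_succ]; simp
  simp only [h0, h1, Fin.succ_zero_eq_one]
  abel

lemma simplexMap_cons_top {m : ℕ} (p : Fin (m + 2) → E) (y : Fin m → ℝ) :
    simplexMap p (Fin.cons (1 - ∑ i, y i) y) = simplexMap (p ∘ Fin.succAbove 0) y := by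
  simp only [simplexMap, Fin.sum_univ_succ, Fin.cons_zero, Fin.cons_succ, Function.comp,
    Fin.zero_succAbove, Fin.succ_zero_eq_one, smul_sub, sub_smul, one_smul,
    Finset.sum_sub_distrib, ← Finset.sum_smul]
  module

/-- In full dimension the parametrisation is an affine isomorphism, hence an open map. -/
lemma simplexMap_mem_interior [FiniteDimensional ℝ E] {m : ℕ} {p : Fin (m + 1) → E}
    (hp : AffineIndependent ℝ p) (hE : Module.finrank ℝ E = m) {x : Fin m → ℝ}
    (hx : ∀ i, 0 < x i) (hx1 : ∑ i, x i < 1) :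
    simplexMap p x ∈ interior (convexHull ℝ (range p)) := by
  let A : (Fin m → ℝ) →ₗ[ℝ] E := Fintype.linearCombination ℝ fun k => p k.succ - p 0
  have hA : ∀ x, simplexMap p x = p 0 + A x := fun x => by
    simp [A, simplexMap, Fintype.linearCombination_apply]
  have hinj : Function.Injective A := by
    intro x y h
    apply injective_simplexMap hp
    rw [hA, hA, h]
  have hsurj : Function.Surjective A :=
    (LinearMap.injective_iff_surjective_of_finrank_eq_finrank (by simp [hE])).1 hinj
  have hopen : IsOpenMap (simplexMap p) := by
    have : simplexMap p = (Homeomorph.addLeft (p 0)) ∘ A := by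
      funext x; simp [hA]
    rw [this]
    exact (Homeomorph.isOpenMap _).comp (A.isOpenMap_of_finiteDimensional hsurj)
  let U : Set (Fin m → ℝ) := (⋂ i, {x : Fin m → ℝ | 0 < x i}) ∩ {x | ∑ i, x i < 1}
  have hU : IsOpen U :=
    (isOpen_iInter_of_finite fun i => isOpen_lt continuous_const (continuous_apply i)).inter
      (isOpen_lt (by fun_prop) continuous_const)
  refine mem_interior.2 ⟨simplexMap p '' U, ?_, hopen U hU, mem_image_of_mem _ ⟨?_, hx1⟩⟩
  · rw [← image_stdCorner]
    exact image_mono fun y hy => ⟨fun i => (mem_iInter.1 hy.1 i).le, hy.2.le⟩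
  · exact mem_iInter.2 hx

/-- The one-dimensional fundamental theorem of calculus on the segments parallel to an edge,
integrated over the base. Differentiability is needed only in the open simplex, which matters later
because `d₀` is merely `C¹` up to the boundary. -/
lemma setIntegral_fderiv_edge [FiniteDimensional ℝ E] {m : ℕ} {p : Fin (m + 2) → E}
    (hp : AffineIndependent ℝ p) (hE : Module.finrank ℝ E = m + 1)
    {G : Type*} [NormedAddCommGroup G] [NormedSpace ℝ G] [CompleteSpace G]
    {f : E → G} {f' : E → E →L[ℝ] G} (hf : ContinuousOn f (convexHull ℝ (range p)))
    (hf' : ContinuousOn f' (convexHull ℝ (range p)))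
    (hd : ∀ x ∈ interior (convexHull ℝ (range p)), HasFDerivAt f (f' x) x) :
    ∫ x in stdCorner (m + 1), f' (simplexMap p x) (p 1 - p 0) =
      (∫ y in stdCorner m, f (simplexMap (p ∘ Fin.succAbove 0) y)) -
        ∫ y in stdCorner m, f (simplexMap (p ∘ Fin.succAbove 1) y) := by
  have hmaps : MapsTo (simplexMap p) (stdCorner (m + 1)) (convexHull ℝ (range p)) := by
    rw [← image_stdCorner]; exact mapsTo_image _ _
  have hmapsi : ∀ i : Fin (m + 2), MapsTo (simplexMap (p ∘ Fin.succAbove i)) (stdCorner m)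
      (convexHull ℝ (range p)) := by
    intro i x hx
    have : simplexMap (p ∘ Fin.succAbove i) x ∈ convexHull ℝ (range (p ∘ Fin.succAbove i)) := by
      rw [← image_stdCorner]; exact mem_image_of_mem _ hx
    exact convexHull_mono (range_comp_subset_range _ _) this
  have hcont : ContinuousOn (fun x => f' (simplexMap p x) (p 1 - p 0)) (stdCorner (m + 1)) :=
    (hf'.comp (continuous_simplexMap p).continuousOn hmaps).clm_apply continuousOn_const
  have hconti : ∀ i : Fin (m + 2),
      IntegrableOn (fun y => f (simplexMap (p ∘ Fin.succAbove i) y)) (stdCorner m) := fun i =>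
    (hf.comp (continuous_simplexMap _).continuousOn (hmapsi i)).integrableOn_compact
      (isCompact_stdCorner m)
  rw [setIntegral_stdCorner_succ (hcont.integrableOn_compact (isCompact_stdCorner _)),
    ← integral_sub (hconti 0) (hconti 1)]
  refine setIntegral_congr_ae (isClosed_stdCorner m).measurableSet ?_
  -- Discarding the null set where some coordinate of `y` vanishes keeps the open segment over `y`
  -- inside the open simplex.
  have hae : ∀ᵐ y : Fin m → ℝ, ∀ i, y i ≠ 0 :=
    ae_all_iff.2 fun i => Measure.ae_eval_ne (μ := fun _ : Fin m => (volume : Measure ℝ)) i 0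
  filter_upwards [hae] with y hy0 hy
  have hle : (0 : ℝ) ≤ 1 - ∑ i, y i := by linarith [hy.2]
  have hmaps2 : MapsTo (fun s : ℝ => (Fin.cons s y : Fin (m + 1) → ℝ)) (Icc 0 (1 - ∑ i, y i))
      (stdCorner (m + 1)) := fun s hs => cons_mem_stdCorner.2 ⟨hy, hs⟩
  have hcc : Continuous (fun s : ℝ => (Fin.cons s y : Fin (m + 1) → ℝ)) :=
    continuous_pi fun i => Fin.cases (by simpa using continuous_id')
      (fun k => by simpa using continuous_const) i
  have key := intervalIntegral.integral_eq_sub_of_hasDerivAt_of_le hle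
    (f := fun s => f (simplexMap p (Fin.cons s y)))
    (f' := fun s => f' (simplexMap p (Fin.cons s y)) (p 1 - p 0)) ?_ ?_ ?_
  · rw [key, simplexMap_cons_top]
    congr 2
    rw [simplexMap_cons]; simp
  · exact hf.comp ((continuous_simplexMap p).comp hcc).continuousOn fun s hs => hmaps (hmaps2 hs)
  · intro s hs
    have hin : simplexMap p (Fin.cons s y) ∈ interior (convexHull ℝ (range p)) := by
      refine simplexMap_mem_interior hp hE (Fin.forall_fin_succ.2 ⟨?_, fun k => ?_⟩) ?_
      · simpa using hs.1
      · simpa using lt_of_le_of_ne (hy.1 k) (hy0 k).symm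
      · simp only [Fin.sum_univ_succ, Fin.cons_zero, Fin.cons_succ]; linarith [hs.2]
    have h1 : HasDerivAt (fun s : ℝ => simplexMap p (Fin.cons s y)) (p 1 - p 0) s := by
      simp only [simplexMap_cons]
      simpa using ((hasDerivAt_id s).smul_const (p 1 - p 0)).const_add
        (simplexMap (p ∘ Fin.succAbove 1) y)
    exact (hd _ hin).comp_hasDerivAt s h1
  · rw [intervalIntegrable_iff_integrableOn_Icc_of_le hle]
    exact (hcont.comp hcc.continuousOn hmaps2).integrableOn_compact isCompact_Icc

/-! ### Barycentric coordinates and the divergence theorem on a simplex -/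

/-- `T` is the vertex set of a full-dimensional simplex in `ℝᴺ`. -/
structure IsSimplex {N : ℕ} (T : Finset (Eucl N)) : Prop where
  indep : AffineIndependent ℝ (Subtype.val : T → Eucl N)
  card_eq : T.card = N + 1

namespace IsSimplex

variable {N : ℕ} {T : Finset (Eucl N)} (hT : IsSimplex T)

/-- The vertices as an affine basis. -/
def basis : AffineBasis T ℝ (Eucl N) :=
  ⟨Subtype.val, hT.indep, by
    rw [hT.indep.affineSpan_eq_top_iff_card_eq_finrank_add_one]; simp [hT.card_eq]⟩

/-- The barycentric coordinate at a vertex. -/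
def coord (a : T) : Eucl N →ᵃ[ℝ] ℝ := hT.basis.coord a

include hT in
lemma nonempty : T.Nonempty := Finset.card_pos.1 (by rw [hT.card_eq]; omega)

lemma range_basis : range hT.basis = (T : Set (Eucl N)) := Subtype.range_coe

@[simp] lemma coord_self (a : T) : hT.coord a a = 1 := hT.basis.coord_apply_eq a

lemma coord_ne {a b : T} (h : a ≠ b) : hT.coord a b = 0 := hT.basis.coord_apply_ne h

lemma coord_of_mem_erase {a : T} {b : Eucl N} (hb : b ∈ T.erase a.1) : hT.coord a b = 0 := by
  have h := Finset.mem_erase.1 hb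
  exact hT.coord_ne (b := ⟨b, h.2⟩) fun h' => h.1 (by rw [h'])

lemma sum_coord (x : Eucl N) : ∑ a, hT.coord a x = 1 := hT.basis.sum_coord_apply_eq_one x

lemma convexHull_eq : convexHull ℝ (T : Set (Eucl N)) = {x | ∀ a, 0 ≤ hT.coord a x} := by
  rw [← hT.range_basis]; exact hT.basis.convexHull_eq_nonneg_coord

lemma interior_eq : interior (convexHull ℝ (T : Set (Eucl N))) = {x | ∀ a, 0 < hT.coord a x} := by
  rw [← hT.range_basis]; exact hT.basis.interior_convexHull

lemma continuous_coord (a : T) : Continuous (hT.coord a) :=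
  (hT.coord a).continuous_of_finiteDimensional

/-- Mostly applied to the vertices shared by two cells: in a conforming mesh the cells meet only in
the hull of those vertices, so a barycentric coordinate at any other vertex vanishes there. -/
lemma coord_eq_zero_of_mem_convexHull {a : T} {S : Set (Eucl N)} (hS : S ⊆ T) (ha : a.1 ∉ S)
    {x : Eucl N} (hx : x ∈ convexHull ℝ S) : hT.coord a x = 0 := by
  have hconv : Convex ℝ {x | hT.coord a x = 0} :=
    (convex_singleton (0 : ℝ)).affine_preimage (hT.coord a)
  refine convexHull_min (fun b hb => ?_) hconv hx
  exact hT.coord_of_mem_erase (Finset.mem_erase.2 ⟨fun h => ha (h ▸ hb), hS hb⟩)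

/-- The gradient of a barycentric coordinate. -/
def grad (a : T) : Eucl N :=
  (InnerProductSpace.toDual ℝ (Eucl N)).symm (LinearMap.toContinuousLinearMap (hT.coord a).linear)

lemma inner_grad (a : T) (e : Eucl N) : inner ℝ (hT.grad a) e = (hT.coord a).linear e := by
  simp [grad]

lemma inner_grad_sub (a : T) (x y : Eucl N) :
    inner ℝ (hT.grad a) (x - y) = hT.coord a x - hT.coord a y := by
  rw [inner_grad, ← vsub_eq_sub, AffineMap.linearMap_vsub, vsub_eq_sub]

lemma coord_add (a : T) (x y : Eucl N) :
    hT.coord a (x + y) = hT.coord a x + inner ℝ (hT.grad a) y := by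
  have := hT.inner_grad_sub a (x + y) x
  rw [add_sub_cancel_left] at this
  linarith

lemma hasFDerivAt_coord (a : T) (x : Eucl N) :
    HasFDerivAt (hT.coord a) (innerSL ℝ (hT.grad a)) x := by
  have : (hT.coord a : Eucl N → ℝ) = fun y => innerSL ℝ (hT.grad a) y + hT.coord a 0 := by
    funext y
    have := hT.coord_add a 0 y
    rw [zero_add] at this
    rw [this, innerSL_apply_apply, add_comm]
  rw [this]
  exact (innerSL ℝ (hT.grad a)).hasFDerivAt.add_const _

/-- This is the derivative of `∑ λ_a = 1`; the next lemma is the derivative of `∑ λ_a(x) a = x`. -/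
lemma sum_grad : ∑ a, hT.grad a = 0 := by
  refine ext_inner_right ℝ fun e => ?_
  rw [sum_inner, inner_zero_left]
  have h1 := hT.sum_coord (0 + e)
  simp only [coord_add, Finset.sum_add_distrib] at h1
  linarith [hT.sum_coord 0]

lemma sum_inner_grad_smul (e : Eucl N) : ∑ a : T, inner ℝ (hT.grad a) e • (a : Eucl N) = e := by
  have h (x : Eucl N) : ∑ a : T, hT.coord a x • (a : Eucl N) = x :=
    hT.basis.linear_combination_coord_eq_self x
  have h1 := h (0 + e)
  simp only [coord_add, Finset.sum_add_distrib, add_smul] at h1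
  rw [h 0] at h1
  simpa using h1

lemma grad_ne_zero (hN : 0 < N) (a : T) : hT.grad a ≠ 0 := by
  have : 0 < (T.erase a.1).card := by rw [Finset.card_erase_of_mem a.2, hT.card_eq]; omega
  obtain ⟨b, hb⟩ := Finset.card_pos.1 this
  intro h
  have h1 := hT.inner_grad_sub a a b
  rw [h, inner_zero_left, coord_self, hT.coord_of_mem_erase hb] at h1
  norm_num at h1

include hT in
lemma interior_nonempty : (interior (convexHull ℝ (T : Set (Eucl N)))).Nonempty := by
  rw [← hT.range_basis]
  exact ⟨_, hT.basis.centroid_mem_interior_convexHull⟩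

end IsSimplex

lemma isCompact_convexHull_finset {N : ℕ} (T : Finset (Eucl N)) :
    IsCompact (convexHull ℝ (T : Set (Eucl N))) := T.finite_toSet.isCompact_convexHull (𝕜 := ℝ)

lemma IsSimplex.volume_pos {N : ℕ} {T : Finset (Eucl N)} (hT : IsSimplex T) :
    0 < volume.real (convexHull ℝ (T : Set (Eucl N))) := by
  refine ENNReal.toReal_pos ?_ (isCompact_convexHull_finset T).measure_lt_top.ne
  exact ((isOpen_interior.measure_pos volume hT.interior_nonempty).trans_le
    (measure_mono interior_subset)).ne'

lemma volume_stdCorner_pos (m : ℕ) : 0 < (volume : Measure (Fin m → ℝ)) (stdCorner m) := by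
  let U : Set (Fin m → ℝ) := (⋂ i, {x : Fin m → ℝ | 0 < x i}) ∩ {x | ∑ i, x i < 1}
  have hU : IsOpen U :=
    (isOpen_iInter_of_finite fun i => isOpen_lt continuous_const (continuous_apply i)).inter
      (isOpen_lt (by fun_prop) continuous_const)
  have hne : U.Nonempty := by
    refine ⟨fun _ => 1 / (m + 1), mem_iInter.2 fun i => ?_, ?_⟩
    · simp only [mem_ofPred_eq]; positivity
    · simp only [mem_ofPred_eq, Finset.sum_const, Finset.card_univ, Fintype.card_fin, nsmul_eq_mul]
      rw [mul_one_div, div_lt_one (by positivity)]; linarith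
  exact (hU.measure_pos volume hne).trans_le
    (measure_mono fun y hy => ⟨fun i => (mem_iInter.1 hy.1 i).le, hy.2.le⟩)

lemma volume_stdCorner_lt_top (m : ℕ) : (volume : Measure (Fin m → ℝ)) (stdCorner m) < ⊤ :=
  (isCompact_stdCorner m).measure_lt_top

/-! ### Enumerated vertices and averages over faces -/

lemma exists_enum {N : ℕ} {F : Finset (Eucl N)} {m : ℕ}
    (hF : AffineIndependent ℝ (Subtype.val : F → Eucl N)) (hc : F.card = m + 1) :
    ∃ p : Fin (m + 1) → Eucl N, AffineIndependent ℝ p ∧ range p = F := by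
  let e : Fin (m + 1) ≃ F := (finCongr hc.symm).trans F.equivFin.symm
  refine ⟨Subtype.val ∘ e, hF.comp_embedding e.toEmbedding, ?_⟩
  rw [e.surjective.range_comp, Subtype.range_coe]

/-- The average of a function over a simplex of dimension `m`. -/
def facetAvg {N : ℕ} (m : ℕ) {G : Type*} [NormedAddCommGroup G] [NormedSpace ℝ G]
    (F : Finset (Eucl N)) (f : Eucl N → G) : G :=
  ⨍ x in convexHull ℝ (F : Set (Eucl N)), f x ∂(μHE[m] : Measure (Eucl N))

lemma measure_facet_pos_lt_top {N : ℕ} {F : Finset (Eucl N)} {m : ℕ}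
    (hF : AffineIndependent ℝ (Subtype.val : F → Eucl N)) (hc : F.card = m + 1) :
    0 < (μHE[m] : Measure (Eucl N)) (convexHull ℝ (F : Set (Eucl N))) ∧
      (μHE[m] : Measure (Eucl N)) (convexHull ℝ (F : Set (Eucl N))) < ⊤ := by
  obtain ⟨p, hp, hr⟩ := exists_enum hF hc
  obtain ⟨c, hc0, h⟩ := exists_scale_simplex hp
  have hm := (measurableEmbedding_simplexMap hp).measurable
  have h1 := congrArg (fun μ : Measure (Eucl N) => μ univ) h
  simp only [Measure.restrict_apply_univ, Measure.smul_apply,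
    Measure.map_apply hm MeasurableSet.univ, preimage_univ, hr] at h1
  rw [h1, ENNReal.smul_def, smul_eq_mul]
  exact ⟨ENNReal.mul_pos (by exact_mod_cast hc0) (volume_stdCorner_pos m).ne',
    ENNReal.mul_lt_top ENNReal.coe_lt_top (volume_stdCorner_lt_top m)⟩

section Edge

variable {m : ℕ} {T : Finset (Eucl (m + 1))} {G : Type*} [NormedAddCommGroup G] [NormedSpace ℝ G]

lemma exists_enum_pair (hT : IsSimplex T) {i j : Eucl (m + 1)} (hi : i ∈ T) (hj : j ∈ T)
    (hij : i ≠ j) : ∃ p : Fin (m + 2) → Eucl (m + 1), AffineIndependent ℝ p ∧ range p = T ∧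
      range (p ∘ Fin.succAbove 0) = (T.erase i : Finset _) ∧
      range (p ∘ Fin.succAbove 1) = (T.erase j : Finset _) ∧ p 0 = i ∧ p 1 = j := by
  classical
  let e : Fin (m + 2) ≃ T := (finCongr hT.card_eq.symm).trans T.equivFin.symm
  let e1 : Fin (m + 2) ≃ T := e.trans (Equiv.swap (e 0) ⟨i, hi⟩)
  -- The first swap puts `i` in position 0. This one puts `j` in position 1 and leaves position 0
  -- alone because `i ≠ j`.
  let e2 : Fin (m + 2) ≃ T := e1.trans (Equiv.swap (e1 1) ⟨j, hj⟩)
  have h10 : e1 0 = ⟨i, hi⟩ := by simp [e1]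
  have h0 : e2 0 = ⟨i, hi⟩ := by
    simp only [e2, Equiv.trans_apply, h10]
    refine Equiv.swap_apply_of_ne_of_ne ?_ (by simpa using hij)
    rw [← h10]; exact e1.injective.ne (by simp)
  have h1 : e2 1 = ⟨j, hj⟩ := by simp [e2]
  have hr (k : Fin (m + 2)) : range ((Subtype.val ∘ e2) ∘ Fin.succAbove k) =
      (T.erase (e2 k).1 : Finset _) := by
    ext x
    rw [range_comp, Fin.range_succAbove, Finset.coe_erase]
    constructor
    · rintro ⟨l, hl, rfl⟩
      exact ⟨(e2 l).2, fun h => hl (e2.injective (Subtype.ext h))⟩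
    · rintro ⟨hx, hne⟩
      refine ⟨e2.symm ⟨x, hx⟩, fun h => hne ?_, by simp⟩
      rw [mem_singleton_iff] at h
      simp [← h]
  refine ⟨Subtype.val ∘ e2, hT.indep.comp_embedding e2.toEmbedding, ?_, ?_, ?_, ?_, ?_⟩
  · rw [e2.surjective.range_comp, Subtype.range_coe]
  · rw [hr 0, h0]
  · rw [hr 1, h1]
  · simp [h0]
  · simp [h1]

variable [CompleteSpace G] {f : Eucl (m + 1) → G} {f' : Eucl (m + 1) → Eucl (m + 1) →L[ℝ] G}

/-- In terms of averages the edge formula no longer depends on the simplex, apart from a ratio of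
reference volumes that `volume_stdCorner_ratio` evaluates. -/
lemma facetAvg_fderiv_edge_scale (hT : IsSimplex T)
    (hf : ContinuousOn f (convexHull ℝ (T : Set (Eucl (m + 1)))))
    (hf' : ContinuousOn f' (convexHull ℝ (T : Set (Eucl (m + 1)))))
    (hd : ∀ x ∈ interior (convexHull ℝ (T : Set (Eucl (m + 1)))), HasFDerivAt f (f' x) x)
    {i j : Eucl (m + 1)} (hi : i ∈ T) (hj : j ∈ T) (hij : i ≠ j) :
    facetAvg (m + 1) T (fun x => f' x (j - i)) =
      ((volume.real (stdCorner (m + 1)))⁻¹ * volume.real (stdCorner m)) •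
        (facetAvg m (T.erase i) f - facetAvg m (T.erase j) f) := by
  obtain ⟨p, hp, hr, hr0, hr1, rfl, rfl⟩ := exists_enum_pair hT hi hj hij
  have hpk (k : Fin (m + 2)) : AffineIndependent ℝ (p ∘ Fin.succAbove k) :=
    hp.comp_embedding (Fin.succAboveEmb k)
  rw [facetAvg, facetAvg, facetAvg, ← hr, ← hr0, ← hr1, average_simplex hp,
    average_simplex (hpk 0), average_simplex (hpk 1)]
  rw [← hr] at hf hf' hd
  have := setIntegral_fderiv_edge hp (by simp) hf hf' hd
  have hm : volume.real (stdCorner m) ≠ 0 :=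
    (ENNReal.toReal_pos (volume_stdCorner_pos m).ne' (volume_stdCorner_lt_top m).ne).ne'
  rw [setAverage_eq, setAverage_eq, setAverage_eq, this, ← smul_sub, smul_smul, mul_assoc,
    mul_inv_cancel₀ hm, mul_one]

lemma facetAvg_const {N m : ℕ} {F : Finset (Eucl N)}
    (hF : AffineIndependent ℝ (Subtype.val : F → Eucl N)) (hc : F.card = m + 1) (c : G) :
    facetAvg m F (fun _ => c) = c := by
  obtain ⟨h1, h2⟩ := measure_facet_pos_lt_top hF hc
  exact setAverage_const h1.ne' h2.ne c

omit [CompleteSpace G] in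
lemma facetAvg_congr {N m : ℕ} {F : Finset (Eucl N)} {f g : Eucl N → G}
    (h : ∀ x ∈ convexHull ℝ (F : Set (Eucl N)), f x = g x) : facetAvg m F f = facetAvg m F g :=
  setAverage_congr_fun (isCompact_convexHull_finset F).measurableSet (ae_of_all _ h)

omit [NormedSpace ℝ G] [CompleteSpace G] in
lemma integrableOn_facet {N m : ℕ} {F : Finset (Eucl N)}
    (hF : AffineIndependent ℝ (Subtype.val : F → Eucl N)) (hc : F.card = m + 1) {f : Eucl N → G}
    (hf : ContinuousOn f (convexHull ℝ (F : Set (Eucl N)))) :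
    IntegrableOn f (convexHull ℝ (F : Set (Eucl N))) (μHE[m] : Measure (Eucl N)) := by
  obtain ⟨h1, h2⟩ := measure_facet_pos_lt_top hF hc
  have hK := isCompact_convexHull_finset F
  obtain ⟨C, hC⟩ := hK.exists_bound_of_continuousOn hf
  exact IntegrableOn.of_bound h2 (hf.aestronglyMeasurable_of_isCompact hK hK.measurableSet) C
    ((ae_restrict_iff' hK.measurableSet).2 (ae_of_all _ hC))

lemma IsSimplex.indep_erase {N : ℕ} {T : Finset (Eucl N)} (hT : IsSimplex T) (a : Eucl N) :
    AffineIndependent ℝ (Subtype.val : ↥(T.erase a) → Eucl N) :=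
  hT.indep.comp_embedding ⟨fun x : ↥(T.erase a) => (⟨x.1, Finset.mem_of_mem_erase x.2⟩ : T),
    fun _ _ h => Subtype.ext (congrArg (fun z : T => z.1) h)⟩

lemma IsSimplex.card_erase {N : ℕ} {T : Finset (Eucl N)} (hT : IsSimplex T) (a : T) :
    (T.erase a.1).card = N := by
  rw [Finset.card_erase_of_mem a.2, hT.card_eq]; rfl

/-- No volume has to be computed: the edge formula is tested on barycentric coordinates. Along the
edge from `i` to `j` the coordinate at `j` has derivative 1 and vanishes on the facet opposite `j`,
so `1 = κ` times its average over the facet opposite `i`. On that facet the coordinates at the `m +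
1` vertices `j ≠ i` add up to 1, and summation gives `κ = m + 1`. -/
lemma volume_stdCorner_ratio (hT : IsSimplex T) :
    (volume.real (stdCorner (m + 1)))⁻¹ * volume.real (stdCorner m) = m + 1 := by
  set κ := (volume.real (stdCorner (m + 1)))⁻¹ * volume.real (stdCorner m)
  obtain ⟨i, hi⟩ := hT.nonempty
  set i' : T := ⟨i, hi⟩
  have hFi := hT.indep_erase i
  have hci := hT.card_erase i'
  have h (j : T) (hj : j ∈ Finset.univ.erase i') :
      1 = κ * facetAvg m (T.erase i) (hT.coord j) := by
    have hne : i ≠ j.1 := fun h => (Finset.mem_erase.1 hj).1 (Subtype.ext h.symm)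
    have := facetAvg_fderiv_edge_scale hT (f := hT.coord j)
      (f' := fun _ => innerSL ℝ (hT.grad j)) (hT.continuous_coord j).continuousOn
      continuousOn_const (fun x _ => hT.hasFDerivAt_coord j x) hi j.2 hne
    have h0 : facetAvg m (T.erase j.1) (hT.coord j) = 0 := by
      rw [facetAvg_congr (g := fun _ => (0 : ℝ)), facetAvg_const (hT.indep_erase j.1)
        (hT.card_erase j)]
      intro x hx
      exact hT.coord_eq_zero_of_mem_convexHull (by simp)
        (by simp) hx
    have h1 : inner ℝ (hT.grad j) (j.1 - i) = 1 := by
      rw [hT.inner_grad_sub, hT.coord_self,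
        hT.coord_of_mem_erase (Finset.mem_erase.2 ⟨hne, hi⟩), sub_zero]
    rw [h0, sub_zero, smul_eq_mul] at this
    rw [← this]
    simp only [innerSL_apply_apply, h1]
    exact (facetAvg_const hT.indep hT.card_eq 1).symm
  have hsum := Finset.sum_congr rfl h
  rw [← Finset.mul_sum] at hsum
  have h1 : ∑ j ∈ Finset.univ.erase i', facetAvg m (T.erase i) (hT.coord j) = 1 := by
    have e1 : ∑ j ∈ Finset.univ.erase i', facetAvg m (T.erase i) (hT.coord j) =
        facetAvg m (T.erase i) (fun x => ∑ j ∈ Finset.univ.erase i', hT.coord j x) := by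
      simp only [facetAvg, setAverage_eq]
      rw [← Finset.smul_sum, integral_finsetSum]
      intro j _
      exact integrableOn_facet hFi hci (hT.continuous_coord j).continuousOn
    rw [e1, facetAvg_congr (g := fun _ => (1 : ℝ)), facetAvg_const hFi hci]
    intro x hx
    have h0 : hT.coord i' x = 0 := hT.coord_eq_zero_of_mem_convexHull
      (by simp) (by simp [i']) hx
    have := hT.sum_coord x
    rw [← Finset.add_sum_erase _ _ (Finset.mem_univ i'), h0, zero_add] at this
    exact this
  rw [h1, mul_one, Finset.sum_const, Finset.card_erase_of_mem (Finset.mem_univ _),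
    Finset.card_univ, Fintype.card_coe, hT.card_eq] at hsum
  rw [← hsum]
  simp

end Edge

namespace IsSimplex

/-! ### Outer normals as normalised gradients of barycentric coordinates -/

section Normal

variable {N : ℕ} {T : Finset (Eucl N)} (hT : IsSimplex T)

lemma mem_convexHull_erase {a : T} {x : Eucl N} (hx : x ∈ convexHull ℝ (T : Set (Eucl N)))
    (ha : hT.coord a x = 0) : x ∈ convexHull ℝ (T.erase a.1 : Set (Eucl N)) := by
  classical
  have h : ∑ b : T, hT.coord b x • (b : Eucl N) = x := hT.basis.linear_combination_coord_eq_self x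
  have h1 := hT.sum_coord x
  rw [← Finset.add_sum_erase _ _ (Finset.mem_univ a), ha, zero_add] at h1
  rw [← Finset.add_sum_erase _ _ (Finset.mem_univ a), ha, zero_smul, zero_add] at h
  rw [← h]
  rw [hT.convexHull_eq] at hx
  refine (convex_convexHull ℝ _).sum_mem (fun b _ => hx b) h1 fun b hb => ?_
  refine subset_convexHull _ _ ?_
  simpa using fun h' => (Finset.mem_erase.1 hb).1 (Subtype.ext h')

lemma coord_facet {a : T} {x : Eucl N} (hx : x ∈ convexHull ℝ (T.erase a.1 : Set (Eucl N))) :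
    hT.coord a x = 0 :=
  hT.coord_eq_zero_of_mem_convexHull (by simp) (by simp) hx

lemma facet_subset (a : T) :
    convexHull ℝ (T.erase a.1 : Set (Eucl N)) ⊆ convexHull ℝ (T : Set (Eucl N)) :=
  convexHull_mono (by simp)

lemma coord_centroid (a : T) : hT.coord a (T.centroid ℝ id) = (N + 1 : ℝ)⁻¹ := by
  classical
  rw [Finset.centroid_def, Finset.map_affineCombination _ _ _
    (Finset.sum_centroidWeights_eq_one_of_nonempty ℝ T hT.nonempty),
    Finset.affineCombination_eq_linear_combination _ _ _
    (Finset.sum_centroidWeights_eq_one_of_nonempty ℝ T hT.nonempty),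
    Finset.sum_eq_single a.1]
  · simp [hT.card_eq]
  · intro b hb hba
    simp [hT.coord_of_mem_erase (Finset.mem_erase.2 ⟨hba, hb⟩)]
  · intro h; exact absurd a.2 h

/-- Since the gradients sum to zero, `x` is the combination of the vectors `b - b₀` with
coefficients `⟪∇λ_b, x⟫`, for a vertex `b₀` of the facet; the hypothesis removes the only vector
that is not tangent to the facet. -/
lemma mem_vectorSpan_of_inner_grad_eq_zero (hN : 0 < N) (a : T) {x : Eucl N}
    (hx : inner ℝ (hT.grad a) x = 0) : x ∈ vectorSpan ℝ (T.erase a.1 : Set (Eucl N)) := by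
  classical
  have hcard : 0 < (T.erase a.1).card := by rw [hT.card_erase]; exact hN
  obtain ⟨b₀, hb₀⟩ := Finset.card_pos.1 hcard
  have h0 : ∑ b : T, inner ℝ (hT.grad b) x = 0 := by
    rw [← sum_inner, hT.sum_grad, inner_zero_left]
  have h1 : x = ∑ b : T, inner ℝ (hT.grad b) x • ((b : Eucl N) - b₀) := by
    simp only [smul_sub, Finset.sum_sub_distrib, ← Finset.sum_smul, h0, hT.sum_inner_grad_smul]
    simp
  rw [h1]
  refine Submodule.sum_mem _ fun b _ => ?_
  by_cases hb : b = a
  · rw [hb, hx, zero_smul]; exact Submodule.zero_mem _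
  · refine Submodule.smul_mem _ _ (vsub_mem_vectorSpan ℝ ?_ (by exact_mod_cast hb₀))
    simpa using fun h' => hb (Subtype.ext h')

lemma grad_mem_orthogonal (a : T) :
    hT.grad a ∈ (vectorSpan ℝ (T.erase a.1 : Set (Eucl N)))ᗮ := by
  rw [vectorSpan_def, Submodule.mem_orthogonal']
  intro u hu
  refine Submodule.span_induction (fun u hu => ?_) (inner_zero_right _)
    (fun x y _ _ hx hy => ?_) (fun c x _ hx => ?_) hu
  · obtain ⟨x, hx, y, hy, rfl⟩ := hu
    simp only [vsub_eq_sub]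
    rw [hT.inner_grad_sub, hT.coord_of_mem_erase (by exact_mod_cast hx),
      hT.coord_of_mem_erase (by exact_mod_cast hy), sub_zero]
  · rw [inner_add_right, hx, hy, add_zero]
  · rw [inner_smul_right, hx, mul_zero]

/-- `λ_a` is `0` on the facet and `1/(N+1)` at the barycenter of `T`, so the vector between the
barycenters has a negative component along `∇λ_a`, the direction orthogonal to the facet. -/
lemma outerNormal_eq (hN : 0 < N) (a : T) :
    Mesh.outerNormal T (T.erase a.1) = -(‖hT.grad a‖⁻¹ • hT.grad a) := by
  have hg : 0 < ‖hT.grad a‖ := norm_pos_iff.2 (hT.grad_ne_zero hN a)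
  set u := (T.erase a.1).centroid ℝ id - T.centroid ℝ id with hu
  have hcard : 0 < (T.erase a.1).card := by rw [hT.card_erase]; exact hN
  have hinner : inner ℝ (hT.grad a) u = -(N + 1 : ℝ)⁻¹ := by
    rw [hu, hT.inner_grad_sub, hT.coord_centroid, hT.coord_facet, zero_sub]
    exact_mod_cast Finset.centroid_mem_convexHull _ (Finset.card_pos.1 hcard)
  -- The coefficient `⟪∇λ_a, u⟫ / ‖∇λ_a‖²` of the orthogonal projection of `u` onto the line of
  -- `∇λ_a`.
  set t : ℝ := -((N + 1 : ℝ)⁻¹ / ‖hT.grad a‖ ^ 2) with ht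
  have htneg : 0 < -t := by rw [ht, neg_neg]; positivity
  have hw : (vectorSpan ℝ ((T.erase a.1 : Finset _) : Set (Eucl N)))ᗮ.starProjection u =
      t • hT.grad a := by
    apply Submodule.eq_starProjection_of_mem_orthogonal
    · exact Submodule.smul_mem _ _ (hT.grad_mem_orthogonal a)
    · rw [Submodule.orthogonal_orthogonal]
      apply hT.mem_vectorSpan_of_inner_grad_eq_zero hN
      rw [inner_sub_right, hinner, inner_smul_right, real_inner_self_eq_norm_sq, ht]
      field_simp
      ring
  simp only [Mesh.outerNormal]
  rw [← hu, hw, norm_smul, Real.norm_eq_abs, abs_of_neg (by linarith), smul_smul, ← neg_smul]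
  congr 1
  have : t ≠ 0 := by linarith
  field_simp

end Normal

/-! ### Facet areas and the divergence theorem -/

section Area

variable {m : ℕ} {T : Finset (Eucl (m + 1))} (hT : IsSimplex T)

lemma slice_eq (a : T) {s : ℝ} (hs : 0 < s) (hs1 : s ≤ 1) :
    {z ∈ convexHull ℝ (T : Set (Eucl (m + 1))) | hT.coord a z = 1 - s} =
      AffineMap.homothety (a : Eucl (m + 1)) s ''
        convexHull ℝ (T.erase a.1 : Set (Eucl (m + 1))) := by
  have haT : (a : Eucl (m + 1)) ∈ convexHull ℝ (T : Set (Eucl (m + 1))) :=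
    subset_convexHull _ _ a.2
  ext z
  constructor
  · rintro ⟨hz, hz1⟩
    refine ⟨(a : Eucl (m + 1)) + s⁻¹ • (z - a), ?_, ?_⟩
    · have hc (b : T) : hT.coord b ((a : Eucl (m + 1)) + s⁻¹ • (z - a)) =
          hT.coord b a + s⁻¹ * (hT.coord b z - hT.coord b a) := by
        rw [coord_add, inner_smul_right, inner_grad_sub]
      have h0 : hT.coord a ((a : Eucl (m + 1)) + s⁻¹ • (z - a)) = 0 := by
        rw [hc, hz1, coord_self]; field_simp; ring
      refine hT.mem_convexHull_erase ?_ h0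
      rw [hT.convexHull_eq] at hz ⊢
      intro b
      by_cases hb : b = a
      · rw [hb, h0]
      · rw [hc, hT.coord_ne hb, zero_add, sub_zero]
        exact mul_nonneg (inv_nonneg.2 hs.le) (hz b)
    · rw [AffineMap.homothety_apply]
      simp [smul_smul, hs.ne']
  · rintro ⟨f, hf, rfl⟩
    have hfT := facet_subset a hf
    rw [AffineMap.homothety_apply, vsub_eq_sub, vadd_eq_add]
    refine ⟨?_, ?_⟩
    · have := (convex_convexHull ℝ (T : Set (Eucl (m + 1)))) haT hfT (sub_nonneg.2 hs1) hs.le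
        (by ring)
      convert this using 1
      module
    · rw [add_comm (s • _) _, coord_add, inner_smul_right, inner_grad_sub, coord_self, hT.coord_facet hf]
      ring

/-- The pyramid formula: the volume is base times height over the dimension `m + 1`, and the height
above the facet opposite `a` is `1/‖∇λ_a‖`. Cavalieri's principle proves it, since the slice at
level `λ_a = 1 - s` is the facet shrunk towards `a` by the factor `s` (`slice_eq`), with area `s ^
m` times that of the facet. -/
lemma facetArea_eq (a : T) : Mesh.facetArea (T.erase a.1) =
    (m + 1) * volume.real (convexHull ℝ (T : Set (Eucl (m + 1)))) * ‖hT.grad a‖ := by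
  have hg : 0 < ‖hT.grad a‖ := norm_pos_iff.2 (hT.grad_ne_zero (Nat.succ_pos m) a)
  -- Normalised so that a displacement by `s • v` from the apex lowers `λ_a` by exactly `s`; its
  -- length is therefore the height.
  set v : Eucl (m + 1) := -((‖hT.grad a‖ ^ 2)⁻¹ • hT.grad a) with hv
  have hvne : v ≠ 0 := by
    rw [hv, neg_ne_zero]
    exact smul_ne_zero (by positivity) (hT.grad_ne_zero (Nat.succ_pos m) a)
  have hvn : ‖v‖ = ‖hT.grad a‖⁻¹ := by
    rw [hv, norm_neg, norm_smul, norm_inv, norm_pow, norm_norm]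
    field_simp
  have hmeas : MeasurableSet (convexHull ℝ (T : Set (Eucl (m + 1)))) :=
    (isCompact_convexHull_finset T).measurableSet
  have hcav := EuclideanGeometry.euclideanHausdorffMeasure_eq_lintegral (a : Eucl (m + 1)) hvne
    hmeas
  simp only [finrank_euclideanSpace, Fintype.card_fin, add_tsub_cancel_right,
    EuclideanSpace.euclideanHausdorffMeasure_eq_volume] at hcav
  have hslice (s : ℝ) : convexHull ℝ (T : Set (Eucl (m + 1))) ∩
      (AffineSubspace.mk' (s • v +ᵥ (a : Eucl (m + 1))) (Submodule.span ℝ {v})ᗮ : Set _) =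
      {z ∈ convexHull ℝ (T : Set (Eucl (m + 1))) | hT.coord a z = 1 - s} := by
    ext z
    have hin : inner ℝ v (z - (s • v + a)) = (‖hT.grad a‖ ^ 2)⁻¹ * (1 - s - hT.coord a z) := by
      have h1 : inner ℝ (hT.grad a) (z - (s • v + a)) = hT.coord a z - 1 + s := by
        rw [hT.inner_grad_sub, add_comm (s • v) _, coord_add, coord_self, inner_smul_right, hv,
          inner_neg_right, inner_smul_right, real_inner_self_eq_norm_sq]
        field_simp
        ring
      rw [hv, inner_neg_left, real_inner_smul_left, ← hv, h1]
      ring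
    simp only [mem_inter_iff, SetLike.mem_coe, AffineSubspace.mem_mk', vsub_eq_sub, vadd_eq_add,
      Submodule.mem_orthogonal_singleton_iff_inner_right, hin, mem_ofPred_eq, mul_eq_zero]
    refine and_congr_right fun _ => ⟨fun h => ?_, fun h => Or.inr (by linarith)⟩
    rcases h with h | h
    · exact absurd h (by positivity)
    · linarith
  set A := (μHE[m] : Measure (Eucl (m + 1))) (convexHull ℝ (T.erase a.1 : Set (Eucl (m + 1))))
    with hA
  -- The apex slice `s = 0`, where the homothety degenerates, is left out; a single value of `s`
  -- does not affect the integral.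
  have hval : ∀ s : ℝ, s ≠ 0 → (μHE[m] : Measure (Eucl (m + 1)))
      {z ∈ convexHull ℝ (T : Set (Eucl (m + 1))) | hT.coord a z = 1 - s} =
      (Ioc (0 : ℝ) 1).indicator (fun s => ENNReal.ofReal (s ^ m) * A) s := by
    intro s hs0
    by_cases hs : s ∈ Ioc (0 : ℝ) 1
    · rw [indicator_of_mem hs, hT.slice_eq a hs.1 hs.2,
        euclideanHausdorffMeasure_homothety_image _ _ hs0, ← hA, ENNReal.smul_def, smul_eq_mul,
        ENNReal.ofReal_pow hs.1.le, ENNReal.coe_pow, ← enorm_eq_nnnorm,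
        Real.enorm_eq_ofReal hs.1.le]
    · rw [indicator_of_notMem hs]
      convert measure_empty (μ := (μHE[m] : Measure (Eucl (m + 1))))
      rw [eq_empty_iff_forall_notMem]
      rintro z ⟨hz, hz1⟩
      rw [hT.convexHull_eq] at hz
      have h0 := hz a
      have h1 : hT.coord a z ≤ 1 := by
        rw [← hT.sum_coord z]
        exact Finset.single_le_sum (fun b _ => hz b) (Finset.mem_univ a)
      exact hs ⟨lt_of_le_of_ne (by linarith) hs0.symm, by linarith⟩
  have hne0 : ∀ᵐ s : ℝ, s ≠ 0 := by simp [ae_iff]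
  simp_rw [hslice] at hcav
  rw [lintegral_congr_ae (hne0.mono hval), lintegral_indicator measurableSet_Ioc,
    lintegral_mul_const _ (by fun_prop)] at hcav
  have hint : ∫⁻ s in Ioc (0 : ℝ) 1, ENNReal.ofReal (s ^ m) = ENNReal.ofReal ((m + 1 : ℝ)⁻¹) := by
    rw [← ofReal_integral_eq_lintegral_ofReal]
    · rw [← intervalIntegral.integral_of_le zero_le_one, integral_pow]
      simp
    · exact (continuous_pow m).integrableOn_Icc.mono_set Ioc_subset_Icc_self
    · exact (ae_restrict_iff' measurableSet_Ioc).2 (ae_of_all _ fun s hs => pow_nonneg hs.1.le _)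
  rw [hint] at hcav
  have hcr := congrArg ENNReal.toReal hcav
  simp only [ENNReal.toReal_mul, toReal_enorm, hvn] at hcr
  rw [ENNReal.toReal_ofReal (by positivity)] at hcr
  have hfa : Mesh.facetArea (T.erase a.1) = A.toReal := by
    simp only [Mesh.facetArea, Measure.real, hA, Finset.coe_erase]
    rfl
  rw [hfa, Measure.real, hcr]
  field_simp

/-- The norm of `∇λ_a` cancels between area and normal, so that `|F| n = -(m + 1) |T| ∇λ_a` is
linear in the gradient. -/
lemma facetArea_mul_inner (a : T) (e : Eucl (m + 1)) :
    Mesh.facetArea (T.erase a.1) * inner ℝ (Mesh.outerNormal T (T.erase a.1)) e =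
      -((m + 1) * volume.real (convexHull ℝ (T : Set (Eucl (m + 1)))) *
        inner ℝ (hT.grad a) e) := by
  have hg : 0 < ‖hT.grad a‖ := norm_pos_iff.2 (hT.grad_ne_zero (Nat.succ_pos m) a)
  rw [hT.facetArea_eq, hT.outerNormal_eq (Nat.succ_pos m), inner_neg_left, real_inner_smul_left]
  field_simp

variable {G : Type*} [NormedAddCommGroup G] [NormedSpace ℝ G] [CompleteSpace G]
  {f : Eucl (m + 1) → G} {f' : Eucl (m + 1) → Eucl (m + 1) →L[ℝ] G}

omit [CompleteSpace G] in
lemma facetAvg_cell (g : Eucl (m + 1) → G) : facetAvg (m + 1) T g =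
    (volume.real (convexHull ℝ (T : Set (Eucl (m + 1)))))⁻¹ •
      ∫ x in convexHull ℝ (T : Set (Eucl (m + 1))), g x := by
  rw [facetAvg, EuclideanSpace.euclideanHausdorffMeasure_eq_volume, setAverage_eq]

include hT in
/-- The divergence theorem on a simplex. -/
theorem integral_fderiv (hf : ContinuousOn f (convexHull ℝ (T : Set (Eucl (m + 1)))))
    (hf' : ContinuousOn f' (convexHull ℝ (T : Set (Eucl (m + 1)))))
    (hd : ∀ x ∈ interior (convexHull ℝ (T : Set (Eucl (m + 1)))), HasFDerivAt f (f' x) x)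
    (e : Eucl (m + 1)) :
    ∫ x in convexHull ℝ (T : Set (Eucl (m + 1))), f' x e =
      ∑ a : T, (Mesh.facetArea (T.erase a.1) *
        inner ℝ (Mesh.outerNormal T (T.erase a.1)) e) • facetAvg m (T.erase a.1) f := by
  have hK := isCompact_convexHull_finset T
  obtain ⟨i, hi⟩ := hT.nonempty
  have h0 : ∑ b : T, inner ℝ (hT.grad b) e = 0 := by
    rw [← sum_inner, hT.sum_grad, inner_zero_left]
  -- Decomposes `e` along the edges issuing from `i`; the base point may be subtracted because the
  -- coefficients sum to zero.
  have he : e = ∑ b : T, inner ℝ (hT.grad b) e • ((b : Eucl (m + 1)) - i) := by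
    simp only [smul_sub, Finset.sum_sub_distrib, ← Finset.sum_smul, h0, hT.sum_inner_grad_smul]
    simp
  have hvol := hT.volume_pos
  set V := volume.real (convexHull ℝ (T : Set (Eucl (m + 1)))) with hV
  have hedge (b : T) : ∫ x in convexHull ℝ (T : Set (Eucl (m + 1))), f' x ((b : Eucl (m + 1)) - i) =
      (V * (m + 1)) • (facetAvg m (T.erase i) f - facetAvg m (T.erase b.1) f) := by
    by_cases hb : i = b.1
    · simp [hb]
    · have := facetAvg_fderiv_edge_scale hT hf hf' hd hi b.2 hb
      rw [volume_stdCorner_ratio hT, facetAvg_cell, ← hV] at this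
      rw [mul_smul, ← this, smul_smul, mul_inv_cancel₀ hvol.ne', one_smul]
  have hL : ∫ x in convexHull ℝ (T : Set (Eucl (m + 1))), f' x e =
      ∑ b : T, inner ℝ (hT.grad b) e •
        ∫ x in convexHull ℝ (T : Set (Eucl (m + 1))), f' x ((b : Eucl (m + 1)) - i) := by
    simp only [← integral_smul]
    rw [← integral_finsetSum]
    · congr 1
      funext x
      conv_lhs => rw [he]
      simp only [map_sum, map_smul]
    · intro b _
      exact (((hf'.clm_apply continuousOn_const).integrableOn_compact hK).smul _)
  rw [hL]
  -- Each edge formula contributes the same average over the facet opposite `i`; weighted by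
  -- coefficients that sum to zero, these drop out.
  have hsplit : ∀ b : T, inner ℝ (hT.grad b) e •
        ∫ x in convexHull ℝ (T : Set (Eucl (m + 1))), f' x ((b : Eucl (m + 1)) - i) =
      inner ℝ (hT.grad b) e • ((V * (m + 1)) • facetAvg m (T.erase i) f) +
      (Mesh.facetArea (T.erase b.1) *
        inner ℝ (Mesh.outerNormal T (T.erase b.1)) e) • facetAvg m (T.erase b.1) f := by
    intro b
    rw [hedge, hT.facetArea_mul_inner, ← hV]
    module
  rw [Finset.sum_congr rfl fun b _ => hsplit b, Finset.sum_add_distrib, ← Finset.sum_smul, h0,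
    zero_smul, zero_add]

end Area

end IsSimplex

/-! ### Local geometry of a mesh at a facet -/

namespace IsSimplex

variable {N : ℕ} {T : Finset (Eucl N)} (hT : IsSimplex T)

lemma coord_centroid_of_subset {S : Finset (Eucl N)} (hS : S ⊆ T) {c : T} (hc : c.1 ∈ S) :
    hT.coord c (S.centroid ℝ id) = (S.card : ℝ)⁻¹ := by
  have hne : S.Nonempty := ⟨_, hc⟩
  rw [Finset.centroid_def, Finset.map_affineCombination _ _ _
    (Finset.sum_centroidWeights_eq_one_of_nonempty ℝ S hne),
    Finset.affineCombination_eq_linear_combination _ _ _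
    (Finset.sum_centroidWeights_eq_one_of_nonempty ℝ S hne),
    Finset.sum_eq_single c.1]
  · simp
  · intro b hb hbc
    simp [hT.coord_of_mem_erase (Finset.mem_erase.2 ⟨hbc, hS hb⟩)]
  · intro h; exact absurd hc h

lemma affineMap_apply (g : Eucl N →ᵃ[ℝ] ℝ) (x : Eucl N) :
    g x = ∑ b : T, hT.coord b x * g b := by
  have h := hT.basis.affineCombination_coord_eq_self x
  have h1 := congrArg g h
  rw [Finset.map_affineCombination _ _ _ (hT.basis.sum_coord_apply_eq_one x),
    Finset.affineCombination_eq_linear_combination _ _ _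
      (hT.basis.sum_coord_apply_eq_one x)] at h1
  rw [← h1]
  rfl

/-- Both coordinates are affine and vanish on the common facet, hence are proportional. The sign of
the factor tells on which side of the facet the vertex `b` lies. -/
lemma coord_eq_mul {T' : Finset (Eucl N)} (hT' : IsSimplex T') {a : T} {b : T'}
    (hF : T.erase a.1 = T'.erase b.1) (x : Eucl N) :
    hT.coord a x = hT.coord a b * hT'.coord b x := by
  rw [hT'.affineMap_apply (hT.coord a) x, Finset.sum_eq_single b]
  · ring
  · intro c _ hcb
    have : c.1 ∈ T.erase a.1 := by
      rw [hF]; exact Finset.mem_erase.2 ⟨fun h => hcb (Subtype.ext h), c.2⟩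
    rw [hT.coord_of_mem_erase this, mul_zero]
  · intro h; exact absurd (Finset.mem_univ b) h

lemma coord_opposite_ne_zero {T' : Finset (Eucl N)} (hT' : IsSimplex T') {a : T} {b : T'}
    (hF : T.erase a.1 = T'.erase b.1) : hT.coord a b ≠ 0 := by
  intro h
  have := hT.coord_eq_mul hT' hF a
  rw [hT.coord_self, h, zero_mul] at this
  exact one_ne_zero this

lemma exists_erase_eq {F : Finset (Eucl N)} (hT : IsSimplex T) (hF : F ⊆ T) (hc : F.card = N) :
    ∃ a : T, T.erase a.1 = F := by
  have h1 : (T \ F).card = 1 := by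
    rw [Finset.card_sdiff_of_subset hF, hT.card_eq, hc]; omega
  obtain ⟨a, ha⟩ := Finset.card_eq_one.1 h1
  have haT : a ∈ T \ F := by rw [ha]; simp
  refine ⟨⟨a, (Finset.mem_sdiff.1 haT).1⟩, ?_⟩
  rw [Finset.erase_eq, ← ha, Finset.sdiff_sdiff_eq_self hF]

end IsSimplex

namespace Mesh

variable {N : ℕ} {Ω : Set (Eucl N)} (M : Mesh Ω)

lemma mem_cells {T : Finset (Eucl N)} :
    T ∈ M.cells ↔ T ∈ M.complex.faces ∧ T.card = N + 1 := by
  simp [cells]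

lemma mem_facets {F : Finset (Eucl N)} :
    F ∈ M.facets ↔ F ∈ M.complex.faces ∧ F.card = N := by
  simp [facets]

lemma mem_facetsOf {T : M.Cell} {F : Finset (Eucl N)} :
    F ∈ M.facetsOf T ↔ F ∈ M.facets ∧ F ⊆ T.1 := by
  simp [facetsOf]

lemma mem_cellsAt {T : M.Cell} {F : Finset (Eucl N)} : T ∈ M.cellsAt F ↔ F ⊆ T.1 := by
  simp [cellsAt]

lemma face_of_cell (T : M.Cell) : T.1 ∈ M.complex.faces := (M.mem_cells.1 T.2).1

lemma isSimplex (T : M.Cell) : IsSimplex T.1 :=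
  ⟨M.complex.indep (M.face_of_cell T), (M.mem_cells.1 T.2).2⟩

lemma convexHull_cell_subset (T : M.Cell) :
    convexHull ℝ (T.1 : Set (Eucl N)) ⊆ closure Ω := by
  rw [← M.space_eq]
  exact M.complex.convexHull_subset_space (M.face_of_cell T)

lemma exists_cell_of_face {s : Finset (Eucl N)} (hs : s ∈ M.complex.faces) :
    ∃ T : M.Cell, s ⊆ T.1 := by
  obtain ⟨t, ht, hst, hc⟩ := M.pure s hs
  exact ⟨⟨t, M.mem_cells.2 ⟨ht, hc⟩⟩, hst⟩

lemma exists_cell_of_mem {x : Eucl N} (hx : x ∈ closure Ω) :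
    ∃ T : M.Cell, x ∈ convexHull ℝ (T.1 : Set (Eucl N)) := by
  rw [← M.space_eq, M.complex.mem_space_iff] at hx
  obtain ⟨s, hs, hx⟩ := hx
  obtain ⟨T, hT⟩ := M.exists_cell_of_face hs
  exact ⟨T, convexHull_mono (by exact_mod_cast hT) hx⟩

lemma mem_facets_erase (hN : 0 < N) (T : M.Cell) (a : T.1) : T.1.erase a.1 ∈ M.facets := by
  have hc := (M.isSimplex T).card_erase a
  refine M.mem_facets.2 ⟨M.complex.down_closed (M.face_of_cell T) (Finset.erase_subset _ _) ?_, hc⟩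
  exact Finset.card_pos.1 (by omega)

lemma sum_facetsOf (hN : 0 < N) (T : M.Cell) {G : Type*} [AddCommMonoid G]
    (q : Finset (Eucl N) → G) : ∑ F ∈ M.facetsOf T, q F = ∑ a : T.1, q (T.1.erase a.1) := by
  symm
  refine Finset.sum_bij (fun a _ => T.1.erase a.1) ?_ ?_ ?_ (fun _ _ => rfl)
  · intro a _
    exact M.mem_facetsOf.2 ⟨M.mem_facets_erase hN T a, Finset.erase_subset _ _⟩
  · intro a _ b _ h
    exact Subtype.ext ((Finset.erase_inj T.1 a.2).1 h)
  · intro F hF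
    obtain ⟨hF1, hF2⟩ := M.mem_facetsOf.1 hF
    obtain ⟨a, ha⟩ := (M.isSimplex T).exists_erase_eq hF2 (M.mem_facets.1 hF1).2
    exact ⟨a, Finset.mem_univ _, ha⟩

lemma sum_cells_facetsOf {G : Type*} [AddCommMonoid G] (Q : M.Cell → Finset (Eucl N) → G) :
    ∑ T, ∑ F ∈ M.facetsOf T, Q T F = ∑ F ∈ M.facets, ∑ T ∈ M.cellsAt F, Q T F := by
  apply Finset.sum_comm'
  intro T F
  simp [M.mem_facetsOf, M.mem_cellsAt, and_comm]

/-- Two cells at one facet lie on opposite sides of it. Otherwise the points slightly off the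
barycenter of the facet towards `a` would belong to both cells, hence by conformity to the hull of
the shared vertices, where `λ_a` vanishes because `a` is not shared. -/
lemma coord_neg_of_ne {T T' : M.Cell} (hne : T ≠ T') {a : T.1} {b : T'.1}
    (hF : T.1.erase a.1 = T'.1.erase b.1) (hN : 0 < N) : (M.isSimplex T).coord a b < 0 := by
  have hT := M.isSimplex T
  have hT' := M.isSimplex T'
  by_contra hcon
  have hμ : 0 < hT.coord a b :=
    lt_of_le_of_ne (not_lt.1 hcon) (hT.coord_opposite_ne_zero hT' hF).symm
  set x := (T.1.erase a.1).centroid ℝ id with hx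
  have hcard : 0 < (T.1.erase a.1).card := by rw [hT.card_erase]; exact hN
  have hxF : x ∈ convexHull ℝ (T.1.erase a.1 : Set (Eucl N)) :=
    Finset.centroid_mem_convexHull _ (Finset.card_pos.1 hcard)
  have hxa : hT.coord a x = 0 := hT.coord_facet hxF
  have hx1 : ∀ c : T.1, c ≠ a → 0 < hT.coord c x := fun c hc => by
    rw [hx, hT.coord_centroid_of_subset (Finset.erase_subset _ _)
      (Finset.mem_erase.2 ⟨fun h => hc (Subtype.ext h), c.2⟩)]
    positivity
  have hx2 : ∀ c : T'.1, c ≠ b → 0 < hT'.coord c x := fun c hc => by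
    rw [hx, hT'.coord_centroid_of_subset (by rw [hF]; exact Finset.erase_subset _ _)
      (by rw [hF]; exact Finset.mem_erase.2 ⟨fun h => hc (Subtype.ext h), c.2⟩)]
    positivity
  let z : ℝ → Eucl N := fun ε => x + ε • ((a : Eucl N) - x)
  have hz : Tendsto z (𝓝[>] 0) (𝓝 x) := by
    have : Continuous z := by fun_prop
    have h0 := this.tendsto 0
    simp only [z, zero_smul, add_zero] at h0
    exact h0.mono_left nhdsWithin_le_nhds
  have hev : ∀ᶠ ε in 𝓝[>] (0 : ℝ), ∀ c : T'.1, c ≠ b → 0 < hT'.coord c (z ε) := by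
    rw [eventually_all]
    intro c
    by_cases hc : c = b
    · simp [hc]
    · filter_upwards [(((hT'.continuous_coord c).tendsto x).comp hz).eventually
        (lt_mem_nhds (hx2 c hc))] with ε hε _
      exact hε
  obtain ⟨ε, ⟨hε, hε0⟩, hε1⟩ := ((hev.and self_mem_nhdsWithin).and
    (mem_nhdsWithin_of_mem_nhds (Iio_mem_nhds one_pos))).exists
  replace hε0 : 0 < ε := hε0
  replace hε1 : ε < 1 := hε1
  have hcz (c : T.1) : hT.coord c (z ε) = hT.coord c x + ε * (hT.coord c a - hT.coord c x) := by
    rw [hT.coord_add, inner_smul_right, hT.inner_grad_sub]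
  have hza : hT.coord a (z ε) = ε := by rw [hcz, hxa, hT.coord_self]; ring
  have hzT : z ε ∈ convexHull ℝ (T.1 : Set (Eucl N)) := by
    rw [hT.convexHull_eq]
    intro c
    by_cases hc : c = a
    · rw [hc, hza]; exact hε0.le
    · rw [hcz, hT.coord_ne hc]
      have := hx1 c hc
      nlinarith
  have hzT' : z ε ∈ convexHull ℝ (T'.1 : Set (Eucl N)) := by
    rw [hT'.convexHull_eq]
    intro c
    by_cases hc : c = b
    · have h1 := hT.coord_eq_mul hT' hF (z ε)
      rw [hza] at h1
      rw [hc]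
      exact (pos_of_mul_pos_right (by rw [← h1]; exact hε0) hμ.le).le
    · exact (hε c hc).le
  have hin := M.complex.inter_subset_convexHull (M.face_of_cell T) (M.face_of_cell T') ⟨hzT, hzT'⟩
  have haT' : a.1 ∉ T'.1 := by
    intro h
    apply hne
    have hsub : T.1 ⊆ T'.1 := by
      rw [← Finset.insert_erase a.2, hF]
      exact Finset.insert_subset h (Finset.erase_subset _ _)
    exact Subtype.ext (Finset.eq_of_subset_of_card_le hsub (by rw [hT.card_eq, hT'.card_eq]))
  have h0 := hT.coord_eq_zero_of_mem_convexHull (a := a) inter_subset_left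
    (fun h => haT' h.2) hin
  rw [hza] at h0
  exact hε0.ne' h0

/-- The hyperplane of a boundary facet supports `Ω`. If `y ∈ Ω` were strictly beyond it, the ray
from `y` through the barycenter `x` of the facet would continue into the cell, so `x` would lie
strictly between an interior point and a point of the closure, hence in the interior of `Ω`. -/
lemma coord_nonneg_of_isBoundary (hΩo : IsOpen Ω) (hΩc : Convex ℝ Ω) (hN : 0 < N) {T : M.Cell}
    {a : T.1} (hb : IsBoundary Ω (T.1.erase a.1)) {y : Eucl N} (hy : y ∈ Ω) :
    0 ≤ (M.isSimplex T).coord a y := by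
  have hT := M.isSimplex T
  by_contra hcon
  have hneg : hT.coord a y < 0 := not_le.1 hcon
  set x := (T.1.erase a.1).centroid ℝ id with hx
  have hcard : 0 < (T.1.erase a.1).card := by rw [hT.card_erase]; exact hN
  have hxF : x ∈ convexHull ℝ (T.1.erase a.1 : Set (Eucl N)) :=
    Finset.centroid_mem_convexHull _ (Finset.card_pos.1 hcard)
  have hxa : hT.coord a x = 0 := hT.coord_facet hxF
  have hx1 : ∀ c : T.1, c ≠ a → 0 < hT.coord c x := fun c hc => by
    rw [hx, hT.coord_centroid_of_subset (Finset.erase_subset _ _)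
      (Finset.mem_erase.2 ⟨fun h => hc (Subtype.ext h), c.2⟩)]
    positivity
  let q : ℝ → Eucl N := fun s => x + s • (x - y)
  have hq : Tendsto q (𝓝[>] 0) (𝓝 x) := by
    have : Continuous q := by fun_prop
    have h0 := this.tendsto 0
    simp only [q, zero_smul, add_zero] at h0
    exact h0.mono_left nhdsWithin_le_nhds
  have hev : ∀ᶠ s in 𝓝[>] (0 : ℝ), ∀ c : T.1, c ≠ a → 0 < hT.coord c (q s) := by
    rw [eventually_all]
    intro c
    by_cases hc : c = a
    · simp [hc]
    · filter_upwards [(((hT.continuous_coord c).tendsto x).comp hq).eventually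
        (lt_mem_nhds (hx1 c hc))] with ε hε _
      exact hε
  obtain ⟨s, hs, hs0⟩ := (hev.and self_mem_nhdsWithin).exists
  replace hs0 : 0 < s := hs0
  have hqT : q s ∈ closure Ω := by
    apply M.convexHull_cell_subset T
    rw [hT.convexHull_eq]
    intro c
    by_cases hc : c = a
    · rw [hc, hT.coord_add, inner_smul_right, hT.inner_grad_sub, hxa]
      nlinarith
    · exact (hs c hc).le
  have hxΩ : x ∈ interior Ω := by
    refine hΩc.openSegment_interior_closure_subset_interior (hΩo.interior_eq.symm ▸ hy) hqT ?_
    -- These weights express `x` through `y` and `q s`, because `q s - x = s • (x - y)`.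
    refine ⟨s / (1 + s), 1 / (1 + s), by positivity, by positivity, by field_simp; ring, ?_⟩
    simp only [q]
    have h1 : (1 + s) ≠ 0 := by positivity
    have : (1 / (1 + s)) • (x + s • (x - y)) =
      ((1 / (1 + s)) * (1 + s)) • x - (s / (1 + s)) • y := by module
    rw [this, one_div, inv_mul_cancel₀ h1]
    module
  exact (hb hxF).2 hxΩ

lemma cellsAt_nonempty {F : Finset (Eucl N)} (hF : F ∈ M.facets) : (M.cellsAt F).Nonempty := by
  obtain ⟨T, hT⟩ := M.exists_cell_of_face (M.mem_facets.1 hF).1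
  exact ⟨T, M.mem_cellsAt.2 hT⟩

lemma exists_erase_eq {F : Finset (Eucl N)} (hF : F ∈ M.facets) {T : M.Cell}
    (hT : T ∈ M.cellsAt F) : ∃ a : T.1, T.1.erase a.1 = F :=
  (M.isSimplex T).exists_erase_eq (M.mem_cellsAt.1 hT) (M.mem_facets.1 hF).2

lemma interior_cell_subset (hΩo : IsOpen Ω) (hΩc : Convex ℝ Ω) (hne : Ω.Nonempty) (T : M.Cell) :
    interior (convexHull ℝ (T.1 : Set (Eucl N))) ⊆ Ω := by
  have := interior_mono (M.convexHull_cell_subset T)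
  rwa [hΩc.interior_closure_eq_interior_of_nonempty_interior (by rwa [hΩo.interior_eq]),
    hΩo.interior_eq] at this

/-- A second cell would lie strictly beyond the supporting hyperplane, although its barycenter is in
`Ω`. -/
lemma cellsAt_of_isBoundary (hΩo : IsOpen Ω) (hΩc : Convex ℝ Ω) (hne : Ω.Nonempty) (hN : 0 < N)
    {F : Finset (Eucl N)} (hF : F ∈ M.facets) (hb : IsBoundary Ω F) :
    ∃ T : M.Cell, M.cellsAt F = {T} := by
  obtain ⟨T, hT⟩ := M.cellsAt_nonempty hF
  refine ⟨T, Finset.eq_singleton_iff_unique_mem.2 ⟨hT, fun T' hT' => ?_⟩⟩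
  by_contra hTT
  obtain ⟨a, ha⟩ := M.exists_erase_eq hF hT
  obtain ⟨b, hb'⟩ := M.exists_erase_eq hF hT'
  have hneg := M.coord_neg_of_ne (Ne.symm hTT) (a := a) (b := b) (by rw [ha, hb']) hN
  have hy : T'.1.centroid ℝ id ∈ Ω := by
    apply M.interior_cell_subset hΩo hΩc hne T'
    rw [(M.isSimplex T').interior_eq]
    intro c
    rw [(M.isSimplex T').coord_centroid]
    positivity
  have h1 := M.coord_nonneg_of_isBoundary hΩo hΩc hN (T := T) (a := a) (by rwa [ha]) hy
  rw [(M.isSimplex T).coord_eq_mul (M.isSimplex T') (b := b) (by rw [ha, hb']),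
    (M.isSimplex T').coord_centroid] at h1
  have : (0 : ℝ) < (N + 1 : ℝ)⁻¹ := by positivity
  nlinarith

/-- A facet not contained in `∂Ω` has a point `x` of `Ω` in its relative interior. Points just
beyond `x`, away from `a`, are still covered by cells, and a cell containing such points arbitrarily
close to `x` contains `x`. By conformity it then has every vertex of the facet. -/
lemma exists_cell_opposite (hΩo : IsOpen Ω) (hN : 0 < N)
    {T : M.Cell} {a : T.1} (hb : ¬ IsBoundary Ω (T.1.erase a.1)) :
    ∃ T' : M.Cell, T' ≠ T ∧ T' ∈ M.cellsAt (T.1.erase a.1) := by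
  have hT := M.isSimplex T
  obtain ⟨y, hyF, hyf⟩ := not_subset.1 hb
  have hyc : y ∈ closure Ω := M.convexHull_cell_subset T (IsSimplex.facet_subset a hyF)
  have hyΩ : y ∈ Ω := by
    by_contra h
    exact hyf ⟨hyc, by rwa [hΩo.interior_eq]⟩
  set c₀ := (T.1.erase a.1).centroid ℝ id with hc₀
  have hcard : 0 < (T.1.erase a.1).card := by rw [hT.card_erase]; exact hN
  have hcF : c₀ ∈ convexHull ℝ (T.1.erase a.1 : Set (Eucl N)) :=
    Finset.centroid_mem_convexHull _ (Finset.card_pos.1 hcard)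
  -- a point of the relative interior of the facet in `Ω`
  obtain ⟨x, hxΩ, hxF, hx1⟩ : ∃ x ∈ Ω, x ∈ convexHull ℝ (T.1.erase a.1 : Set (Eucl N)) ∧
      ∀ c : T.1, c ≠ a → 0 < hT.coord c x := by
    let z : ℝ → Eucl N := fun ε => y + ε • (c₀ - y)
    have hz : Tendsto z (𝓝[>] 0) (𝓝 y) := by
      have : Continuous z := by fun_prop
      have h0 := this.tendsto 0
      simp only [z, zero_smul, add_zero] at h0
      exact h0.mono_left nhdsWithin_le_nhds
    obtain ⟨ε, ⟨hε, hε0⟩, hε1⟩ := (((hz.eventually (hΩo.mem_nhds hyΩ)).and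
      self_mem_nhdsWithin).and (mem_nhdsWithin_of_mem_nhds (Iio_mem_nhds one_pos))).exists
    replace hε0 : 0 < ε := hε0
    replace hε1 : ε < 1 := hε1
    refine ⟨z ε, hε, ?_, fun c hc => ?_⟩
    · exact (convex_convexHull ℝ _).add_smul_sub_mem hyF hcF ⟨hε0.le, hε1.le⟩
    · rw [hT.coord_add, inner_smul_right, hT.inner_grad_sub, hc₀,
        hT.coord_centroid_of_subset (Finset.erase_subset _ _)
          (Finset.mem_erase.2 ⟨fun h => hc (Subtype.ext h), c.2⟩)]
      have h1 : 0 ≤ hT.coord c y := by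
        have := IsSimplex.facet_subset a hyF
        rw [hT.convexHull_eq] at this
        exact this c
      have h2 : (0 : ℝ) < ((T.1.erase a.1).card : ℝ)⁻¹ := by positivity
      nlinarith [mul_pos hε0 h2]
  have hxa : hT.coord a x = 0 := hT.coord_facet hxF
  let z : ℝ → Eucl N := fun ε => x + ε • (x - a)
  have hz : Tendsto z (𝓝[>] 0) (𝓝 x) := by
    have : Continuous z := by fun_prop
    have h0 := this.tendsto 0
    simp only [z, zero_smul, add_zero] at h0
    exact h0.mono_left nhdsWithin_le_nhds
  have hza (ε : ℝ) : hT.coord a (z ε) = -ε := by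
    rw [hT.coord_add, inner_smul_right, hT.inner_grad_sub, hxa, hT.coord_self]; ring
  have hev : ∀ᶠ ε in 𝓝[>] (0 : ℝ), ∃ T' : M.Cell, z ε ∈ convexHull ℝ (T'.1 : Set (Eucl N)) :=
    (hz.eventually (hΩo.mem_nhds hxΩ)).mono fun ε hε => M.exists_cell_of_mem (subset_closure hε)
  -- Pigeonhole over the finitely many cells.
  obtain ⟨T', hT'⟩ : ∃ T' : M.Cell, ∃ᶠ ε in 𝓝[>] (0 : ℝ),
      z ε ∈ convexHull ℝ (T'.1 : Set (Eucl N)) := by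
    by_contra hcon
    push Not at hcon
    have := eventually_all.2 hcon
    obtain ⟨ε, ⟨T', h1⟩, h2⟩ := (hev.and this).exists
    exact h2 T' h1
  have hxT' : x ∈ convexHull ℝ (T'.1 : Set (Eucl N)) :=
    (isCompact_convexHull_finset T'.1).isClosed.mem_of_frequently_of_tendsto hT' hz
  refine ⟨T', ?_, ?_⟩
  · rintro rfl
    obtain ⟨ε, h1, h2⟩ := (hT'.and_eventually self_mem_nhdsWithin).exists
    rw [hT.convexHull_eq] at h1
    have h3 := h1 a
    rw [hza] at h3
    replace h2 : 0 < ε := h2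
    linarith
  · rw [M.mem_cellsAt]
    have hin := M.complex.inter_subset_convexHull (M.face_of_cell T) (M.face_of_cell T')
      ⟨IsSimplex.facet_subset a hxF, hxT'⟩
    intro c hc
    by_contra hcT'
    obtain ⟨hca, hcT⟩ := Finset.mem_erase.1 hc
    have h0 := hT.coord_eq_zero_of_mem_convexHull (a := ⟨c, hcT⟩) inter_subset_left
      (fun h => hcT' h.2) hin
    exact (hx1 ⟨c, hcT⟩ fun h => hca (congrArg Subtype.val h)).ne' h0

lemma outerNormal_neg_of_ne (hN : 0 < N) {F : Finset (Eucl N)} (hF : F ∈ M.facets)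
    {T T' : M.Cell} (hne : T ≠ T') (hT : T ∈ M.cellsAt F) (hT' : T' ∈ M.cellsAt F) :
    outerNormal T'.1 F = - outerNormal T.1 F := by
  obtain ⟨a, ha⟩ := M.exists_erase_eq hF hT
  obtain ⟨b, hb⟩ := M.exists_erase_eq hF hT'
  have hneg := M.coord_neg_of_ne hne (a := a) (b := b) (by rw [ha, hb]) hN
  have hg : (M.isSimplex T).grad a =
      (M.isSimplex T).coord a b • (M.isSimplex T').grad b := by
    refine ext_inner_right ℝ fun e => ?_
    have h (x : Eucl N) := (M.isSimplex T).coord_eq_mul (M.isSimplex T') (a := a) (b := b)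
      (by rw [ha, hb]) x
    have h1 := h (0 + e)
    rw [IsSimplex.coord_add, IsSimplex.coord_add, h 0] at h1
    rw [real_inner_smul_left]
    linarith
  have h1 := (M.isSimplex T).outerNormal_eq hN a
  have h2 := (M.isSimplex T').outerNormal_eq hN b
  rw [ha] at h1
  rw [hb] at h2
  have hg' : 0 < ‖(M.isSimplex T').grad b‖ :=
    norm_pos_iff.2 ((M.isSimplex T').grad_ne_zero hN b)
  rw [h1, h2, hg, norm_smul, Real.norm_eq_abs, abs_of_neg hneg, smul_smul, neg_neg, ← neg_smul]
  congr 1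
  have := hneg.ne
  field_simp

/-- There are no more than two cells: the normal of a third would be opposite to both `n` and `-n`,
forcing `n = 0`. -/
lemma cellsAt_of_not_isBoundary (hΩo : IsOpen Ω) (hN : 0 < N) {F : Finset (Eucl N)} (hF : F ∈ M.facets) (hb : ¬ IsBoundary Ω F) :
    ∃ T T' : M.Cell, T ≠ T' ∧ (∀ S, S ∈ M.cellsAt F ↔ S = T ∨ S = T') ∧
      outerNormal T'.1 F = - outerNormal T.1 F := by
  obtain ⟨T, hT⟩ := M.cellsAt_nonempty hF
  obtain ⟨a, ha⟩ := M.exists_erase_eq hF hT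
  obtain ⟨T', hTT', hT'⟩ := M.exists_cell_opposite hΩo hN (T := T) (a := a) (by rwa [ha])
  rw [ha] at hT'
  refine ⟨T, T', hTT'.symm, fun S => ⟨fun hS => ?_, ?_⟩,
    M.outerNormal_neg_of_ne hN hF hTT'.symm hT hT'⟩
  · by_contra hcon
    push Not at hcon
    have h1 := M.outerNormal_neg_of_ne hN hF hTT'.symm hT hT'
    have h2 := M.outerNormal_neg_of_ne hN hF hcon.1.symm hT hS
    have h3 := M.outerNormal_neg_of_ne hN hF hcon.2.symm hT' hS
    rw [h2, h1, neg_neg] at h3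
    have h0 : outerNormal T.1 F = 0 := by
      have h5 : (2 : ℝ) • outerNormal T.1 F = 0 := by
        rw [two_smul]
        nth_rewrite 1 [← h3]
        exact neg_add_cancel _
      exact (smul_eq_zero.1 h5).resolve_left two_ne_zero
    have h4 := (M.isSimplex T).outerNormal_eq hN a
    rw [ha, h0] at h4
    have hg : 0 < ‖(M.isSimplex T).grad a‖ := norm_pos_iff.2 ((M.isSimplex T).grad_ne_zero hN a)
    have := congrArg norm h4
    rw [norm_neg, norm_smul, norm_inv, norm_norm, inv_mul_cancel₀ hg.ne', norm_zero] at this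
    exact zero_ne_one this
  · rintro (rfl | rfl) <;> assumption

end Mesh

/-! ### Jumps and integrals cell by cell -/

namespace Mesh

variable {N : ℕ} {Ω : Set (Eucl N)} (M : Mesh Ω)

lemma norm_jump_of_cellsAt_singleton (hN : 0 < N)
    {F : Finset (Eucl N)} (hF : F ∈ M.facets) (v : DG0 M (Eucl N))
    {T : M.Cell} (hT : M.cellsAt F = {T}) : ‖DG0.jump v F‖ = ‖v T‖ := by
  have hTm : T ∈ M.cellsAt F := by simp [hT]
  have hch : (M.cellsAt_nonempty hF).choose = T :=
    Finset.mem_singleton.1 ((Finset.ext_iff.1 hT _).1 (M.cellsAt_nonempty hF).choose_spec)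
  obtain ⟨a, ha⟩ := M.exists_erase_eq hF hTm
  have hn : ‖outerNormal T.1 F‖ = 1 := by
    rw [← ha, (M.isSimplex T).outerNormal_eq hN, norm_neg, norm_smul, norm_inv, norm_norm,
      inv_mul_cancel₀ (norm_ne_zero_iff.2 ((M.isSimplex T).grad_ne_zero hN a))]
  rw [DG0.jump, hT, Finset.sum_singleton, facetNormal, dif_pos (M.cellsAt_nonempty hF), hch,
    real_inner_self_eq_norm_sq, hn]
  simp

lemma norm_outerNormal (hN : 0 < N) {F : Finset (Eucl N)} (hF : F ∈ M.facets) {T : M.Cell}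
    (hT : T ∈ M.cellsAt F) : ‖outerNormal T.1 F‖ = 1 := by
  obtain ⟨a, ha⟩ := M.exists_erase_eq hF hT
  rw [← ha, (M.isSimplex T).outerNormal_eq hN, norm_neg, norm_smul, norm_inv, norm_norm,
      inv_mul_cancel₀ (norm_ne_zero_iff.2 ((M.isSimplex T).grad_ne_zero hN a))]

lemma sum_cellsAt_pair {F : Finset (Eucl N)} {T T' : M.Cell} (hne : T ≠ T')
    (h : ∀ S, S ∈ M.cellsAt F ↔ S = T ∨ S = T') {G : Type*} [AddCommMonoid G] (q : M.Cell → G) :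
    ∑ S ∈ M.cellsAt F, q S = q T + q T' := by
  classical
  have : M.cellsAt F = {T, T'} := by ext S; simp [h]
  rw [this, Finset.sum_pair hne]

/-- Whichever of the two cells was chosen to define the facet normal, only the sign of the jump is
affected. -/
lemma norm_jump_of_cellsAt_pair (hN : 0 < N) {F : Finset (Eucl N)} (hF : F ∈ M.facets)
    (v : DG0 M (Eucl N)) {T T' : M.Cell} (hne : T ≠ T')
    (h : ∀ S, S ∈ M.cellsAt F ↔ S = T ∨ S = T')
    (hn : outerNormal T'.1 F = - outerNormal T.1 F) : ‖DG0.jump v F‖ = ‖v T' - v T‖ := by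
  have h1 := M.norm_outerNormal hN hF ((h T).2 (Or.inl rfl))
  rw [DG0.jump, M.sum_cellsAt_pair hne h, facetNormal, dif_pos (M.cellsAt_nonempty hF)]
  rcases (h _).1 (M.cellsAt_nonempty hF).choose_spec with h2 | h2 <;>
    rw [h2, hn] <;> simp only [inner_neg_left, inner_neg_right, real_inner_self_eq_norm_sq, h1]
  · rw [norm_sub_rev]; congr 1; module
  · congr 1; module

/-- Cells may replace their interiors because the frontier of a convex set is a null set. The
varying functional `Λ` covers both the tested function and the tested gradient. -/
lemma sum_integral_toFun (hΩo : IsOpen Ω) (hΩc : Convex ℝ Ω) (hne : Ω.Nonempty) {V G : Type}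
    [NormedAddCommGroup V] [NormedSpace ℝ V] [NormedAddCommGroup G] [NormedSpace ℝ G]
    {Λ : Eucl N → V →L[ℝ] G} (hΛ : Continuous Λ) (v : DG0 M V) :
    ∫ x in Ω, Λ x (v.toFun x) = ∑ T, ∫ x in convexHull ℝ (T.1 : Set (Eucl N)), Λ x (v T) := by
  have h1 (x : Eucl N) : Λ x (v.toFun x) =
      ∑ T : M.Cell, (interior (convexHull ℝ (T.1 : Set (Eucl N)))).indicator
        (fun x => Λ x (v T)) x := by
    rw [DG0.toFun, map_sum]
    refine Finset.sum_congr rfl fun T _ => ?_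
    by_cases hx : x ∈ interior (convexHull ℝ (T.1 : Set (Eucl N)))
    · rw [indicator_of_mem hx, indicator_of_mem hx]
    · rw [indicator_of_notMem hx, indicator_of_notMem hx, map_zero]
  simp only [h1]
  have hint (T : M.Cell) : IntegrableOn (fun x => Λ x (v T))
      (convexHull ℝ (T.1 : Set (Eucl N))) :=
    (hΛ.clm_apply continuous_const).continuousOn.integrableOn_compact
      (isCompact_convexHull_finset T.1)
  rw [integral_finsetSum]
  · refine Finset.sum_congr rfl fun T _ => ?_
    rw [setIntegral_indicator isOpen_interior.measurableSet,
      inter_eq_right.2 (M.interior_cell_subset hΩo hΩc hne T)]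
    exact setIntegral_congr_set (interior_ae_eq_of_null_frontier
      ((convex_convexHull ℝ _).addHaar_frontier volume))
  · intro T _
    refine Integrable.integrableOn ?_
    rw [integrable_indicator_iff isOpen_interior.measurableSet]
    exact (hint T).mono_set interior_subset

lemma disjoint_interior {T T' : M.Cell} (hne : T ≠ T') :
    Disjoint (interior (convexHull ℝ (T.1 : Set (Eucl N))))
      (interior (convexHull ℝ (T'.1 : Set (Eucl N)))) := by
  rw [Set.disjoint_left]
  intro x hx hx'
  have hin := M.complex.inter_subset_convexHull (M.face_of_cell T) (M.face_of_cell T')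
      ⟨interior_subset hx, interior_subset hx'⟩
  obtain ⟨a, ha, ha'⟩ : ∃ a ∈ T.1, a ∉ T'.1 := by
    by_contra hcon
    push Not at hcon
    exact hne (Subtype.ext (Finset.eq_of_subset_of_card_le hcon
      (by rw [(M.isSimplex T).card_eq, (M.isSimplex T').card_eq])))
  have h0 := (M.isSimplex T).coord_eq_zero_of_mem_convexHull (a := ⟨a, ha⟩) inter_subset_left
    (fun h => ha' h.2) hin
  rw [(M.isSimplex T).interior_eq] at hx
  exact (hx ⟨a, ha⟩).ne' h0

lemma setIntegral_eq_sum_cells (hΩo : IsOpen Ω) (hΩc : Convex ℝ Ω) (hne : Ω.Nonempty)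
    {G : Type*} [NormedAddCommGroup G] [NormedSpace ℝ G] {f : Eucl N → G}
    (hf : ContinuousOn f (closure Ω)) :
    ∫ x in Ω, f x = ∑ T : M.Cell, ∫ x in convexHull ℝ (T.1 : Set (Eucl N)), f x := by
  have hint (T : M.Cell) : IntegrableOn f (convexHull ℝ (T.1 : Set (Eucl N))) :=
    (hf.mono (M.convexHull_cell_subset T)).integrableOn_compact (isCompact_convexHull_finset T.1)
  have h1 (T : M.Cell) : ∫ x in convexHull ℝ (T.1 : Set (Eucl N)), f x =
      ∫ x in interior (convexHull ℝ (T.1 : Set (Eucl N))), f x :=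
    (setIntegral_congr_set (interior_ae_eq_of_null_frontier
      ((convex_convexHull ℝ _).addHaar_frontier volume))).symm
  simp only [h1]
  rw [← integral_iUnion_fintype (fun T => isOpen_interior.measurableSet)
    (fun T T' hne => M.disjoint_interior hne) (fun T => (hint T).mono_set interior_subset)]
  refine setIntegral_congr_set ?_
  have hnull : ∀ᵐ x : Eucl N, ∀ T : M.Cell, x ∉ frontier (convexHull ℝ (T.1 : Set (Eucl N))) :=
    ae_all_iff.2 fun T => compl_mem_ae_iff.2 ((convex_convexHull ℝ _).addHaar_frontier volume)
  filter_upwards [hnull] with x hx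
  refine propext ⟨fun h => ?_, fun h => ?_⟩
  · obtain ⟨T, hT⟩ := M.exists_cell_of_mem (subset_closure h)
    refine mem_iUnion.2 ⟨T, ?_⟩
    by_contra hcon
    exact hx T ⟨subset_closure hT, hcon⟩
  · obtain ⟨T, hT⟩ := mem_iUnion.1 h
    exact M.interior_cell_subset hΩo hΩc hne T hT

end Mesh

lemma facetArea_nonneg {N : ℕ} (F : Finset (Eucl N)) : 0 ≤ Mesh.facetArea F :=
  ENNReal.toReal_nonneg

lemma norm_facetAvg_sub_le {N m : ℕ} {F : Finset (Eucl N)}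
    (hF : AffineIndependent ℝ (Subtype.val : F → Eucl N)) (hc : F.card = m + 1)
    {G : Type*} [NormedAddCommGroup G] [NormedSpace ℝ G] [CompleteSpace G] {f : Eucl N → G}
    (hf : ContinuousOn f (convexHull ℝ (F : Set (Eucl N)))) {c : G} {K : ℝ}
    (h : ∀ x ∈ convexHull ℝ (F : Set (Eucl N)), ‖f x - c‖ ≤ K) : ‖facetAvg m F f - c‖ ≤ K := by
  obtain ⟨h1, h2⟩ := measure_facet_pos_lt_top hF hc
  have := (convex_closedBall c K).set_average_mem Metric.isClosed_closedBall h1.ne' h2.ne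
    (f := f) ?_ (integrableOn_facet hF hc hf)
  · rwa [mem_closedBall_iff_norm] at this
  · refine (ae_restrict_iff' (isCompact_convexHull_finset F).measurableSet).2 (ae_of_all _ ?_)
    intro x hx
    rw [mem_closedBall_iff_norm]
    exact h x hx

section Boundary

variable {m : ℕ} {Ω : Set (Eucl (m + 1))} (M : Mesh Ω)

open Classical in
/-- The total surface measure of the boundary facets is bounded in terms of `Ω` only. -/
lemma Mesh.sum_facetArea_boundary_le (hΩo : IsOpen Ω) (hΩc : Convex ℝ Ω)
    {x₀ : Eucl (m + 1)}
    {r : ℝ} (hr : 0 < r) (hball : Metric.closedBall x₀ r ⊆ Ω) :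
    ∑ F ∈ M.facets with Mesh.IsBoundary Ω F, Mesh.facetArea F ≤
      (m + 1) * volume.real Ω / r := by
  have hne : Ω.Nonempty := ⟨x₀, hball (Metric.mem_closedBall_self hr.le)⟩
  have hN := Nat.succ_pos m
  -- `Q T F` is the outward flux of the field `x - x₀` through `F`. Over the facets of a cell it
  -- sums to `(m + 1) |T|`, it cancels on interior facets, and on a boundary facet it is at least `r
  -- |F|`.
  let Q : M.Cell → Finset (Eucl (m + 1)) → ℝ := fun T F =>
    -(Mesh.facetArea F * inner ℝ (Mesh.outerNormal T.1 F) (x₀ - F.centroid ℝ id))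
  have hQ (T : M.Cell) (a : T.1) : Q T (T.1.erase a.1) =
      (m + 1) * volume.real (convexHull ℝ (T.1 : Set (Eucl (m + 1)))) *
        (M.isSimplex T).coord a x₀ := by
    have hcard : 0 < (T.1.erase a.1).card := by rw [(M.isSimplex T).card_erase]; exact hN
    simp only [Q]
    rw [(M.isSimplex T).facetArea_mul_inner, neg_neg, (M.isSimplex T).inner_grad_sub,
      (M.isSimplex T).coord_facet (Finset.centroid_mem_convexHull _ (Finset.card_pos.1 hcard)),
      sub_zero]
  have htot : ∑ T, ∑ F ∈ M.facetsOf T, Q T F = (m + 1) * volume.real Ω := by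
    have hvol := M.setIntegral_eq_sum_cells hΩo hΩc hne (f := fun _ => (1 : ℝ)) continuousOn_const
    simp only [setIntegral_const, smul_eq_mul, mul_one] at hvol
    rw [hvol, Finset.mul_sum]
    refine Finset.sum_congr rfl fun T _ => ?_
    rw [M.sum_facetsOf hN]
    simp only [hQ]
    rw [← Finset.mul_sum, (M.isSimplex T).sum_coord, mul_one]
  rw [le_div_iff₀ hr, ← htot, M.sum_cells_facetsOf, Finset.sum_mul, Finset.sum_filter]
  refine Finset.sum_le_sum fun F hF => ?_
  split_ifs with hb
  · obtain ⟨T, hT⟩ := M.cellsAt_of_isBoundary hΩo hΩc hne hN hF hb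
    obtain ⟨a, ha⟩ := M.exists_erase_eq hF (T := T) (by simp [hT])
    subst ha
    rw [hT, Finset.sum_singleton, hQ, (M.isSimplex T).facetArea_eq]
    have hg : 0 < ‖(M.isSimplex T).grad a‖ := norm_pos_iff.2 ((M.isSimplex T).grad_ne_zero hN a)
    -- The point of the ball nearest to the hyperplane of the facet. Since `λ_a ≥ 0` still holds
    -- there, the hyperplane has distance at least `r` from `x₀`.
    have hy : x₀ + -(r * ‖(M.isSimplex T).grad a‖⁻¹) • (M.isSimplex T).grad a ∈ Ω := by
      apply hball
      rw [mem_closedBall_iff_norm, add_sub_cancel_left, norm_smul, norm_neg, norm_mul, norm_inv,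
        norm_norm, mul_assoc, inv_mul_cancel₀ hg.ne', mul_one, Real.norm_of_nonneg hr.le]
    have h1 := M.coord_nonneg_of_isBoundary hΩo hΩc hN hb hy
    rw [IsSimplex.coord_add, inner_smul_right, real_inner_self_eq_norm_sq] at h1
    have h2 : ‖(M.isSimplex T).grad a‖ * r ≤ (M.isSimplex T).coord a x₀ := by
      have : -(r * ‖(M.isSimplex T).grad a‖⁻¹) * ‖(M.isSimplex T).grad a‖ ^ 2 =
        -(‖(M.isSimplex T).grad a‖ * r) := by field_simp
      linarith
    have hv := (M.isSimplex T).volume_pos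
    rw [mul_assoc]
    gcongr
  · obtain ⟨T, T', hTT, hmem, hn⟩ := M.cellsAt_of_not_isBoundary hΩo hN hF hb
    rw [M.sum_cellsAt_pair hTT hmem]
    simp only [Q, hn, inner_neg_left]
    apply le_of_eq
    ring

end Boundary

/-! ### Consistency of the lifted gradient -/

/-- The residual of the weak gradient identity with boundary datum `d₀` (with derivative `D`),
tested with `φ` in the direction `e`. -/
def residual {N : ℕ} {Ω : Set (Eucl N)} {M : Mesh Ω} (v d : DG0 M (Eucl N)) (φ : Eucl N → ℝ)
    (d₀ : Eucl N → Eucl N) (D : Eucl N → Eucl N →L[ℝ] Eucl N) (e : Eucl N) : Eucl N :=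
  (∫ x in Ω, φ x • (v.liftedGradient d).toFun x e) + (∫ x in Ω, fderiv ℝ φ x e • v.toFun x) -
    ∫ x in Ω, (φ x • D x e + fderiv ℝ φ x e • d₀ x)

section

variable {m : ℕ} {Ω : Set (Eucl (m + 1))} {M : Mesh Ω} (v d : DG0 M (Eucl (m + 1)))
  {φ : Eucl (m + 1) → ℝ} {d₀ : Eucl (m + 1) → Eucl (m + 1)}
  {D : Eucl (m + 1) → Eucl (m + 1) →L[ℝ] Eucl (m + 1)}

/-- The contribution of a cell and one of its facets to the residual. -/
def facetTerm (φ : Eucl (m + 1) → ℝ) (d₀ : Eucl (m + 1) → Eucl (m + 1)) (e : Eucl (m + 1))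
    (T : M.Cell) (F : Finset (Eucl (m + 1))) : Eucl (m + 1) :=
  (Mesh.facetArea F * inner ℝ (Mesh.outerNormal T.1 F) e) •
    (facetAvg (m + 1) T.1 φ • (DG0.facetValue v d T F - v T) + facetAvg m F φ • v T -
      facetAvg m F (fun x => φ x • d₀ x))

/-- The cell divergence theorem is applied to `φ` and to `φ • d₀`, and the factor `1/|T|` of the
lifted gradient turns the integral of `φ` over a cell into an average. The datum has to be
differentiable only inside `Ω`, which contains the cell interiors. -/
lemma residual_eq_sum (hΩo : IsOpen Ω) (hΩc : Convex ℝ Ω) (hne : Ω.Nonempty)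
    (hφ : ContDiff ℝ 1 φ) (hd₀ : ContinuousOn d₀ (closure Ω)) (hD : ContinuousOn D (closure Ω))
    (hd₀D : ∀ x ∈ Ω, HasFDerivAt d₀ (D x) x) (e : Eucl (m + 1)) :
    residual v d φ d₀ D e =
      ∑ F ∈ M.facets, ∑ T ∈ M.cellsAt F, facetTerm v d φ d₀ e T F := by
  have hφ' : Continuous (fderiv ℝ φ) := hφ.continuous_fderiv one_ne_zero
  have hφd (x) : HasFDerivAt φ (fderiv ℝ φ x) x :=
    (hφ.differentiable one_ne_zero x).hasFDerivAt
  let Λ₁ : Eucl (m + 1) → (Eucl (m + 1) →L[ℝ] Eucl (m + 1)) →L[ℝ] Eucl (m + 1) := fun x =>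
    φ x • ContinuousLinearMap.apply ℝ (Eucl (m + 1)) e
  let Λ₂ : Eucl (m + 1) → Eucl (m + 1) →L[ℝ] Eucl (m + 1) := fun x =>
    fderiv ℝ φ x e • ContinuousLinearMap.id ℝ (Eucl (m + 1))
  have hΛ₁ : Continuous Λ₁ := hφ.continuous.smul continuous_const
  have hΛ₂ : Continuous Λ₂ := (hφ'.clm_apply continuous_const).smul continuous_const
  have e1 := M.sum_integral_toFun hΩo hΩc hne hΛ₁ (v.liftedGradient d)
  have e2 := M.sum_integral_toFun hΩo hΩc hne hΛ₂ v
  simp only [Λ₁, Λ₂, _root_.smul_apply, ContinuousLinearMap.apply_apply,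
    ContinuousLinearMap.id_apply] at e1 e2
  have hf' : ContinuousOn (fun x => φ x • D x + (fderiv ℝ φ x).smulRight (d₀ x)) (closure Ω) := by
    refine (hφ.continuous.continuousOn.smul hD).add ?_
    exact ((ContinuousLinearMap.smulRightL ℝ (Eucl (m + 1)) (Eucl (m + 1))).continuous.comp
      hφ').continuousOn.clm_apply hd₀
  have e3 := M.setIntegral_eq_sum_cells hΩo hΩc hne
    (f := fun x => φ x • D x e + fderiv ℝ φ x e • d₀ x)
    (by simpa using hf'.clm_apply (continuousOn_const (c := e)))
  rw [residual, e1, e2, e3, ← Finset.sum_add_distrib, ← Finset.sum_sub_distrib,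
    ← M.sum_cells_facetsOf]
  refine Finset.sum_congr rfl fun T _ => ?_
  have hT := M.isSimplex T
  have hsub := M.convexHull_cell_subset T
  have d1 := hT.integral_fderiv hφ.continuous.continuousOn hφ'.continuousOn
    (fun x _ => hφd x) e
  have d2 := hT.integral_fderiv (hφ.continuous.continuousOn.smul (hd₀.mono hsub)) (hf'.mono hsub)
    (fun x hx => (hφd x).smul (hd₀D x (M.interior_cell_subset hΩo hΩc hne T hx))) e
  simp only [_root_.add_apply, _root_.smul_apply,
    ContinuousLinearMap.smulRight_apply] at d2
  rw [integral_smul_const, integral_smul_const, d1, d2, M.sum_facetsOf (Nat.succ_pos m)]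
  have hG : (v.liftedGradient d) T e = ∑ a : T.1, (Mesh.facetArea (T.1.erase a.1) /
      volume.real (convexHull ℝ (T.1 : Set (Eucl (m + 1))))) •
      (inner ℝ (Mesh.outerNormal T.1 (T.1.erase a.1)) e •
        (DG0.facetValue v d T (T.1.erase a.1) - v T)) := by
    rw [DG0.liftedGradient, M.sum_facetsOf (Nat.succ_pos m), _root_.sum_apply]
    simp [DG0.tensor, Mesh.cellVol]
  rw [hG, Finset.smul_sum, Finset.sum_smul, ← Finset.sum_add_distrib, ← Finset.sum_sub_distrib]
  refine Finset.sum_congr rfl fun a _ => ?_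
  have hv := hT.volume_pos
  have hint : ∫ x in convexHull ℝ (T.1 : Set (Eucl (m + 1))), φ x =
      volume.real (convexHull ℝ (T.1 : Set (Eucl (m + 1)))) * facetAvg (m + 1) T.1 φ := by
    rw [IsSimplex.facetAvg_cell, smul_eq_mul, mul_inv_cancel_left₀ hv.ne']
  have hsc (V α A n : ℝ) (hV : 0 < V) (w : Eucl (m + 1)) :
      (V * α) • (A / V) • n • w = (A * n) • α • w := by
    rw [smul_smul, smul_smul, smul_smul]
    congr 1
    field_simp
  rw [hint, hsc _ _ _ _ hv, facetTerm, smul_assoc, ← smul_add, ← smul_sub]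
  rfl

variable {L B h D₀ C : ℝ}

lemma abs_cellAvg_sub_facetAvg_le (hφ : Continuous φ)
    (hL : ∀ x ∈ closure Ω, ∀ y ∈ closure Ω, |φ x - φ y| ≤ L * ‖x - y‖) (hL0 : 0 ≤ L)
    {T : M.Cell} (hT : Metric.diam (convexHull ℝ (T.1 : Set (Eucl (m + 1)))) ≤ h)
    {F : Finset (Eucl (m + 1))} (hF : F ∈ M.facets) (hFT : T ∈ M.cellsAt F) :
    |facetAvg (m + 1) T.1 φ - facetAvg m F φ| ≤ L * h := by
  have hsub := M.convexHull_cell_subset T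
  have hFsub : convexHull ℝ (F : Set (Eucl (m + 1))) ⊆ convexHull ℝ (T.1 : Set (Eucl (m + 1))) :=
    convexHull_mono (by exact_mod_cast M.mem_cellsAt.1 hFT)
  have hb := (isCompact_convexHull_finset T.1).isBounded
  have key : ∀ x ∈ convexHull ℝ (T.1 : Set (Eucl (m + 1))),
      ∀ y ∈ convexHull ℝ (T.1 : Set (Eucl (m + 1))), |φ x - φ y| ≤ L * h := fun x hx y hy => by
    refine (hL x (hsub hx) y (hsub hy)).trans (mul_le_mul_of_nonneg_left ?_ hL0)
    rw [← dist_eq_norm]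
    exact (Metric.dist_le_diam_of_mem hb hx hy).trans hT
  rw [abs_sub_comm, ← Real.norm_eq_abs]
  refine norm_facetAvg_sub_le (M.complex.indep (M.mem_facets.1 hF).1) (M.mem_facets.1 hF).2
    hφ.continuousOn fun y hy => ?_
  rw [← norm_neg, neg_sub]
  refine norm_facetAvg_sub_le (M.isSimplex T).indep (M.isSimplex T).card_eq
    hφ.continuousOn fun x hx => ?_
  exact key x hx y (hFsub hy)

lemma abs_facetArea_mul_inner_le {T : M.Cell} {F : Finset (Eucl (m + 1))} (hF : F ∈ M.facets)
    (hFT : T ∈ M.cellsAt F) (e : Eucl (m + 1)) :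
    |Mesh.facetArea F * inner ℝ (Mesh.outerNormal T.1 F) e| ≤ Mesh.facetArea F * ‖e‖ := by
  rw [abs_mul, abs_of_nonneg (facetArea_nonneg F)]
  refine mul_le_mul_of_nonneg_left ?_ (facetArea_nonneg F)
  have := abs_real_inner_le_norm (Mesh.outerNormal T.1 F) e
  rwa [M.norm_outerNormal (Nat.succ_pos m) hF hFT, one_mul] at this

/-- With the averaged facet value, `v_F - v_T` is half the jump up to sign. Opposite normals cancel
the contribution of `d₀`, leaving the jump times the mean of the two differences between cell and
facet averages of `φ`. -/
lemma norm_sum_facetTerm_interior_le (hΩo : IsOpen Ω) (hφ : Continuous φ)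
    (hL : ∀ x ∈ closure Ω, ∀ y ∈ closure Ω, |φ x - φ y| ≤ L * ‖x - y‖) (hL0 : 0 ≤ L)
    (hM : ∀ T : M.Cell, Metric.diam (convexHull ℝ (T.1 : Set (Eucl (m + 1)))) ≤ h)
    {F : Finset (Eucl (m + 1))} (hF : F ∈ M.facets) (hb : ¬ Mesh.IsBoundary Ω F)
    (e : Eucl (m + 1)) :
    ‖∑ T ∈ M.cellsAt F, facetTerm v d φ d₀ e T F‖ ≤
      ‖e‖ * h * (L * (Mesh.facetArea F * ‖DG0.jump v F‖)) := by
  have hN := Nat.succ_pos m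
  obtain ⟨T, T', hTT, hmem, hn⟩ := M.cellsAt_of_not_isBoundary hΩo hN hF hb
  have hTF : T ∈ M.cellsAt F := (hmem T).2 (Or.inl rfl)
  have hTF' : T' ∈ M.cellsAt F := (hmem T').2 (Or.inr rfl)
  have h1 := abs_cellAvg_sub_facetAvg_le hφ hL hL0 (hM T) hF hTF
  have h2 := abs_cellAvg_sub_facetAvg_le hφ hL hL0 (hM T') hF hTF'
  have h3 := abs_facetArea_mul_inner_le hF hTF e
  rw [M.sum_cellsAt_pair hTT hmem, M.norm_jump_of_cellsAt_pair hN hF v hTT hmem hn]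
  simp only [facetTerm, DG0.facetValue, if_neg hb, M.sum_cellsAt_pair hTT hmem, hn, inner_neg_left]
  set κ := Mesh.facetArea F * inner ℝ (Mesh.outerNormal T.1 F) e
  set α := facetAvg (m + 1) T.1 φ
  set α' := facetAvg (m + 1) T'.1 φ
  set β := facetAvg m F φ
  set γ := facetAvg m F fun x => φ x • d₀ x
  have : κ • (α • ((1 / 2 : ℝ) • (v T + v T') - v T) + β • v T - γ) +
      (Mesh.facetArea F * -inner ℝ (Mesh.outerNormal T.1 F) e) •
        (α' • ((1 / 2 : ℝ) • (v T + v T') - v T') + β • v T' - γ) =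
      (κ * (((α - β) + (α' - β)) / 2)) • (v T' - v T) := by
    rw [mul_neg]
    module
  rw [this, norm_smul, norm_mul]
  have h4 : ‖((α - β) + (α' - β)) / 2‖ ≤ L * h := by
    rw [norm_div, Real.norm_eq_abs, Real.norm_two]
    have := abs_add_le (α - β) (α' - β)
    linarith
  calc ‖κ‖ * ‖((α - β) + (α' - β)) / 2‖ * ‖v T' - v T‖
      ≤ (Mesh.facetArea F * ‖e‖) * (L * h) * ‖v T' - v T‖ := by
        gcongr
        · exact mul_nonneg (facetArea_nonneg F) (norm_nonneg _)
        · exact h3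
    _ = _ := by ring

/-- The term splits as `(α - β)(d_T - v_T) - (γ - β d_T)`: the first factor is at most `L h`, and
the last bracket averages `φ (d₀ - d_T)`, which is at most `B C h`. The size of `v_T` is that of the
jump on a boundary facet, so the seminorm absorbs it. -/
lemma norm_sum_facetTerm_boundary_le (hΩo : IsOpen Ω) (hΩc : Convex ℝ Ω) (hne : Ω.Nonempty)
    (hφ : Continuous φ) (hd₀ : ContinuousOn d₀ (closure Ω))
    (hL : ∀ x ∈ closure Ω, ∀ y ∈ closure Ω, |φ x - φ y| ≤ L * ‖x - y‖) (hL0 : 0 ≤ L)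
    (hB : ∀ x ∈ closure Ω, |φ x| ≤ B) (hB0 : 0 ≤ B) (hD₀ : ∀ x ∈ closure Ω, ‖d₀ x‖ ≤ D₀)
    (hM : ∀ T : M.Cell, Metric.diam (convexHull ℝ (T.1 : Set (Eucl (m + 1)))) ≤ h)
    (hd : ∀ F ∈ M.facets, Mesh.IsBoundary Ω F → ∀ T ∈ M.cellsAt F,
      ∀ x ∈ convexHull ℝ (F : Set (Eucl (m + 1))), ‖d T - d₀ x‖ ≤ C * h)
    {F : Finset (Eucl (m + 1))} (hF : F ∈ M.facets) (hb : Mesh.IsBoundary Ω F)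
    (e : Eucl (m + 1)) :
    ‖∑ T ∈ M.cellsAt F, facetTerm v d φ d₀ e T F‖ ≤
      ‖e‖ * h * (L * (Mesh.facetArea F * ‖DG0.jump v F‖) +
        (L * (D₀ + C * h) + B * C) * Mesh.facetArea F) := by
  have hN := Nat.succ_pos m
  obtain ⟨T, hT⟩ := M.cellsAt_of_isBoundary hΩo hΩc hne hN hF hb
  have hTF : T ∈ M.cellsAt F := by simp [hT]
  have h1 := abs_cellAvg_sub_facetAvg_le hφ hL hL0 (hM T) hF hTF
  have h3 := abs_facetArea_mul_inner_le hF hTF e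
  have hsub : convexHull ℝ (F : Set (Eucl (m + 1))) ⊆ closure Ω := fun x hx => (hb hx).1
  have hdT := hd F hF hb T hTF
  obtain ⟨x₁, hx₁⟩ : (convexHull ℝ (F : Set (Eucl (m + 1)))).Nonempty :=
    convexHull_nonempty_iff.2 (M.complex.nonempty_of_mem_faces (M.mem_facets.1 hF).1)
  have hdn : ‖d T‖ ≤ D₀ + C * h := by
    have : d T = d₀ x₁ + (d T - d₀ x₁) := by abel
    rw [this]
    exact (norm_add_le _ _).trans (add_le_add (hD₀ _ (hsub hx₁)) (hdT x₁ hx₁))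
  have hγ : ‖facetAvg m F (fun x => φ x • d₀ x) - facetAvg m F φ • d T‖ ≤ B * (C * h) := by
    have hI := M.complex.indep (M.mem_facets.1 hF).1
    have hc := (M.mem_facets.1 hF).2
    have hcont : ContinuousOn (fun x => φ x • d₀ x) (convexHull ℝ (F : Set (Eucl (m + 1)))) :=
      hφ.continuousOn.smul (hd₀.mono hsub)
    have hcont' : ContinuousOn (fun x => φ x • d T) (convexHull ℝ (F : Set (Eucl (m + 1)))) :=
      hφ.continuousOn.smul continuousOn_const
    have heq : facetAvg m F (fun x => φ x • d₀ x) - facetAvg m F φ • d T =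
        facetAvg m F (fun x => φ x • (d₀ x - d T)) := by
      simp only [facetAvg, setAverage_eq, smul_sub]
      rw [integral_sub (integrableOn_facet hI hc hcont)
        (integrableOn_facet hI hc hcont'), integral_smul_const,
        smul_sub, smul_smul, smul_eq_mul]
    rw [heq, ← sub_zero (facetAvg m F _)]
    refine norm_facetAvg_sub_le hI hc
      (hφ.continuousOn.smul ((hd₀.mono hsub).sub continuousOn_const)) fun x hx => ?_
    change ‖φ x • (d₀ x - d T) - 0‖ ≤ _
    rw [sub_zero, norm_smul, Real.norm_eq_abs, ← norm_neg (d₀ x - d T), neg_sub]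
    exact mul_le_mul (hB x (hsub hx)) (hdT x hx) (norm_nonneg _) hB0
  have hjump := M.norm_jump_of_cellsAt_singleton hN hF v hT
  rw [hT, Finset.sum_singleton, hjump]
  simp only [facetTerm, DG0.facetValue, if_pos hb]
  set κ := Mesh.facetArea F * inner ℝ (Mesh.outerNormal T.1 F) e
  set α := facetAvg (m + 1) T.1 φ
  set β := facetAvg m F φ
  set γ := facetAvg m F fun x => φ x • d₀ x
  have : α • (d T - v T) + β • v T - γ = (α - β) • (d T - v T) - (γ - β • d T) := by module
  have hLh : 0 ≤ L * h := (abs_nonneg _).trans h1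
  have h5 : ‖α • (d T - v T) + β • v T - γ‖ ≤ L * h * (D₀ + C * h + ‖v T‖) + B * (C * h) := by
    rw [this]
    refine (norm_sub_le _ _).trans (add_le_add ?_ hγ)
    rw [norm_smul]
    exact mul_le_mul h1 ((norm_sub_le _ _).trans (by gcongr)) (norm_nonneg _) hLh
  rw [norm_smul]
  calc ‖κ‖ * ‖α • (d T - v T) + β • v T - γ‖
      ≤ (Mesh.facetArea F * ‖e‖) * (L * h * (D₀ + C * h + ‖v T‖) + B * (C * h)) :=
        mul_le_mul h3 h5 (norm_nonneg _) (mul_nonneg (facetArea_nonneg F) (norm_nonneg _))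
    _ = _ := by ring

theorem norm_residual_le (hΩo : IsOpen Ω) (hΩc : Convex ℝ Ω) {x₀ : Eucl (m + 1)} {r : ℝ}
    (hr : 0 < r) (hball : Metric.closedBall x₀ r ⊆ Ω)
    (hφ : ContDiff ℝ 1 φ) (hd₀ : ContinuousOn d₀ (closure Ω)) (hD : ContinuousOn D (closure Ω))
    (hd₀D : ∀ x ∈ Ω, HasFDerivAt d₀ (D x) x)
    (hL : ∀ x ∈ closure Ω, ∀ y ∈ closure Ω, |φ x - φ y| ≤ L * ‖x - y‖) (hL0 : 0 ≤ L)
    (hB : ∀ x ∈ closure Ω, |φ x| ≤ B) (hB0 : 0 ≤ B) (hD₀ : ∀ x ∈ closure Ω, ‖d₀ x‖ ≤ D₀)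
    (hD₀0 : 0 ≤ D₀) (hh : 0 ≤ h) (hC : 0 ≤ C)
    (hM : ∀ T : M.Cell, Metric.diam (convexHull ℝ (T.1 : Set (Eucl (m + 1)))) ≤ h)
    (hd : ∀ F ∈ M.facets, Mesh.IsBoundary Ω F → ∀ T ∈ M.cellsAt F,
      ∀ x ∈ convexHull ℝ (F : Set (Eucl (m + 1))), ‖d T - d₀ x‖ ≤ C * h) (e : Eucl (m + 1)) :
    ‖residual v d φ d₀ D e‖ ≤ ‖e‖ * h * (L * v.jumpSeminorm +
      (L * (D₀ + C * h) + B * C) * ((m + 1) * volume.real Ω / r)) := by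
  classical
  have hne : Ω.Nonempty := ⟨x₀, hball (Metric.mem_closedBall_self hr.le)⟩
  have hbd := M.sum_facetArea_boundary_le hΩo hΩc hr hball
  rw [residual_eq_sum v d hΩo hΩc hne hφ hd₀ hD hd₀D]
  have hF : ∀ F ∈ M.facets, ‖∑ T ∈ M.cellsAt F, facetTerm v d φ d₀ e T F‖ ≤
      ‖e‖ * h * (L * (Mesh.facetArea F * ‖DG0.jump v F‖) +
        (L * (D₀ + C * h) + B * C) * if Mesh.IsBoundary Ω F then Mesh.facetArea F else 0) := by
    intro F hF
    split_ifs with hb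
    · exact norm_sum_facetTerm_boundary_le v d hΩo hΩc hne hφ.continuous hd₀ hL hL0 hB hB0 hD₀ hM hd
        hF hb e
    · rw [mul_zero, add_zero]
      exact norm_sum_facetTerm_interior_le v d hΩo hφ.continuous hL hL0 hM hF hb e
  refine (norm_sum_le _ _).trans ((Finset.sum_le_sum hF).trans ?_)
  rw [← Finset.mul_sum, Finset.sum_add_distrib, ← Finset.mul_sum, ← Finset.mul_sum,
    ← Finset.sum_filter, DG0.jumpSeminorm]
  gcongr

end

/-! ### Mollification and dilation -/

section Mollify

variable {N : ℕ} {V : Type*} [NormedAddCommGroup V] [NormedSpace ℝ V]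

/-- Mollification by a normalised bump function. -/
def mollify (ρ : ContDiffBump (0 : Eucl N)) (f : Eucl N → V) : Eucl N → V :=
  convolution (ρ.normed volume) f (ContinuousLinearMap.lsmul ℝ ℝ) volume

lemma mollify_apply (ρ : ContDiffBump (0 : Eucl N)) (f : Eucl N → V) (x : Eucl N) :
    mollify ρ f x = ∫ t, ρ.normed volume t • f (x - t) := rfl

lemma mollify_congr (ρ : ContDiffBump (0 : Eucl N)) {f g : Eucl N → V} (h : f =ᵐ[volume] g) :
    mollify ρ f = mollify ρ g :=
  convolution_congr (μ := volume) (ContinuousLinearMap.lsmul ℝ ℝ) (ae_eq_refl _) h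

lemma mollify_sub (ρ : ContDiffBump (0 : Eucl N)) {f g : Eucl N → V}
    (hf : LocallyIntegrable f volume) (hg : LocallyIntegrable g volume) :
    mollify ρ (f - g) = mollify ρ f - mollify ρ g := by
  funext x
  have h1 := (ρ.hasCompactSupport_normed (μ := volume)).convolutionExists_left
    (ContinuousLinearMap.lsmul ℝ ℝ) (μ := volume) ρ.continuous_normed hf x
  have h2 := (ρ.hasCompactSupport_normed (μ := volume)).convolutionExists_left
    (ContinuousLinearMap.lsmul ℝ ℝ) (μ := volume) ρ.continuous_normed hg x
  simp only [Pi.sub_apply, mollify_apply, smul_sub]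
  exact integral_sub h1 h2

/-- The kernel is the density of a probability measure `ν`, so power means with respect to `ν` are
monotone in the exponent; Tonelli and translation invariance finish the estimate. -/
lemma lintegral_mollify_rpow_le (ρ : ContDiffBump (0 : Eucl N)) {f : Eucl N → V}
    (hf : StronglyMeasurable f) {q : ℝ} (hq : 1 ≤ q) :
    ∫⁻ x, ‖mollify ρ f x‖ₑ ^ q ≤ ∫⁻ x, ‖f x‖ₑ ^ q := by
  have hρm : Measurable fun y => ENNReal.ofReal (ρ.normed volume y) :=
    ρ.continuous_normed.measurable.ennreal_ofReal
  let ν : Measure (Eucl N) := volume.withDensity fun y => ENNReal.ofReal (ρ.normed volume y)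
  have hν : IsProbabilityMeasure ν := by
    refine ⟨?_⟩
    rw [withDensity_apply _ MeasurableSet.univ, Measure.restrict_univ,
      ← ofReal_integral_eq_lintegral_ofReal ρ.integrable_normed (ae_of_all _ ρ.nonneg_normed),
      ρ.integral_normed, ENNReal.ofReal_one]
  have hq0 : 0 < q := by linarith
  have hfm (x : Eucl N) : StronglyMeasurable fun y => f (x - y) :=
    hf.comp_measurable (measurable_const.sub measurable_id)
  have h1 (x : Eucl N) : ‖mollify ρ f x‖ₑ ≤ ∫⁻ y, ‖f (x - y)‖ₑ ∂ν := by
    rw [mollify_apply]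
    refine (enorm_integral_le_lintegral_enorm _).trans (le_of_eq ?_)
    rw [lintegral_withDensity_eq_lintegral_mul _ hρm (hfm x).enorm]
    refine lintegral_congr fun y => ?_
    rw [enorm_smul, Pi.mul_apply, Real.enorm_eq_ofReal (ρ.nonneg_normed y)]
  have h2 (x : Eucl N) : ‖mollify ρ f x‖ₑ ^ q ≤ ∫⁻ y, ‖f (x - y)‖ₑ ^ q ∂ν := by
    have := eLpNorm'_le_eLpNorm'_of_exponent_le one_pos hq ν (hfm x).aestronglyMeasurable
    simp only [eLpNorm', ENNReal.rpow_one, div_one] at this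
    calc ‖mollify ρ f x‖ₑ ^ q ≤ ((∫⁻ y, ‖f (x - y)‖ₑ ^ q ∂ν) ^ (1 / q)) ^ q :=
          ENNReal.rpow_le_rpow ((h1 x).trans this) hq0.le
      _ = _ := by rw [← ENNReal.rpow_mul, one_div, inv_mul_cancel₀ hq0.ne', ENNReal.rpow_one]
  calc ∫⁻ x, ‖mollify ρ f x‖ₑ ^ q ≤ ∫⁻ x, ∫⁻ y, ‖f (x - y)‖ₑ ^ q ∂ν := lintegral_mono h2
    _ = ∫⁻ y, (∫⁻ x, ‖f (x - y)‖ₑ ^ q) ∂ν := by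
      refine lintegral_lintegral_swap ?_
      exact ((hf.comp_measurable (measurable_fst.sub measurable_snd)).enorm.pow_const q).aemeasurable
    _ = ∫⁻ x, ‖f x‖ₑ ^ q := by
      have (y : Eucl N) : ∫⁻ x, ‖f (x - y)‖ₑ ^ q = ∫⁻ x, ‖f x‖ₑ ^ q :=
        lintegral_sub_right_eq_self (fun x => ‖f x‖ₑ ^ q) y
      simp only [this]
      rw [lintegral_const, measure_univ, mul_one]

lemma eLpNorm_mollify_le (ρ : ContDiffBump (0 : Eucl N)) {f : Eucl N → V} {p : ℝ≥0∞}
    (hf : AEStronglyMeasurable f volume) (hp : 1 ≤ p) (hpt : p ≠ ⊤) :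
    eLpNorm (mollify ρ f) p volume ≤ eLpNorm f p volume := by
  have hp0 : p ≠ 0 := (one_pos.trans_le hp).ne'
  have hq : 1 ≤ p.toReal := by
    rw [← ENNReal.toReal_one]; exact ENNReal.toReal_mono hpt hp
  rw [mollify_congr ρ hf.ae_eq_mk, eLpNorm_congr_ae hf.ae_eq_mk,
    eLpNorm_eq_lintegral_rpow_enorm_toReal hp0 hpt, eLpNorm_eq_lintegral_rpow_enorm_toReal hp0 hpt]
  exact ENNReal.rpow_le_rpow (lintegral_mollify_rpow_le ρ hf.stronglyMeasurable_mk hq)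
    (by positivity)

lemma continuous_mollify (ρ : ContDiffBump (0 : Eucl N)) {f : Eucl N → V}
    (hf : LocallyIntegrable f volume) : Continuous (mollify ρ f) :=
  ρ.hasCompactSupport_normed.continuous_convolution_left _ ρ.continuous_normed hf

/-- The dilation by `l` about `x₀`. -/
def dilate (x₀ : Eucl N) (l : ℝ) (x : Eucl N) : Eucl N := x₀ + l • (x - x₀)

lemma continuous_dilate (x₀ : Eucl N) (l : ℝ) : Continuous (dilate x₀ l) := by
  unfold dilate; fun_prop

/-- The Jacobian factor is `l⁻ᴺ ≤ 1`, so composition with an expanding dilation does not increase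
`Lᵖ` norms. -/
lemma map_dilate_le (x₀ : Eucl N) {l : ℝ} (hl : 1 ≤ l) :
    (volume : Measure (Eucl N)).map (dilate x₀ l) ≤ volume := by
  have h : dilate x₀ l = (fun x => x₀ + x) ∘ (fun x => l • x) ∘ (fun x => x - x₀) := rfl
  have hl0 : (0 : ℝ) < l := by linarith
  rw [h, ← Measure.map_map (by fun_prop) (by fun_prop), ← Measure.map_map (by fun_prop)
    (by fun_prop), (measurePreserving_sub_right volume x₀).map_eq,
    Measure.map_addHaar_smul _ hl0.ne', Measure.map_smul,
    (measurePreserving_add_left volume x₀).map_eq]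
  refine Measure.le_iff.2 fun s _ => ?_
  rw [Measure.smul_apply, smul_eq_mul]
  refine mul_le_of_le_one_left zero_le (ENNReal.ofReal_le_one.2 ?_)
  rw [abs_of_nonneg (by positivity)]
  exact inv_le_one_of_one_le₀ (one_le_pow₀ hl)

lemma eLpNorm_comp_dilate_le {G : Type*} [NormedAddCommGroup G] (x₀ : Eucl N) {l : ℝ}
    (hl : 1 ≤ l) {f : Eucl N → G}
    (hf : Continuous f) (p : ℝ≥0∞) :
    eLpNorm (f ∘ dilate x₀ l) p volume ≤ eLpNorm f p volume := by
  rw [← eLpNorm_map_measure hf.aestronglyMeasurable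
    (continuous_dilate x₀ l).measurable.aemeasurable]
  exact eLpNorm_mono_measure _ (map_dilate_le x₀ hl)

/-- Mollified dilations of a continuous function with compact support converge in `Lᵖ`. -/
lemma tendsto_eLpNorm_mollify_of_continuous [CompleteSpace V] {ρ : ℕ → ContDiffBump (0 : Eucl N)} {l : ℕ → ℝ}
    (hρ : Tendsto (fun k => (ρ k).rOut) atTop (𝓝 0)) (hl : Tendsto l atTop (𝓝 1))
    (hl1 : ∀ k, 1 ≤ l k) (hρ1 : ∀ k, (ρ k).rOut ≤ 1)
    (x₀ : Eucl N) {g : Eucl N → V} (hg : Continuous g) (hgc : HasCompactSupport g)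
    {p : ℝ≥0∞} (hp : 1 ≤ p) (hpt : p ≠ ⊤) :
    Tendsto (fun k => eLpNorm (mollify (ρ k) g ∘ dilate x₀ (l k) - g) p volume) atTop (𝓝 0) := by
  have hp0 : p ≠ 0 := (one_pos.trans_le hp).ne'
  obtain ⟨R, hR0, hR⟩ : ∃ R > 0, ∀ x, g x ≠ 0 → ‖x - x₀‖ ≤ R := by
    obtain ⟨R, hR⟩ := hgc.isCompact.isBounded.subset_closedBall x₀
    refine ⟨max R 1, by positivity, fun x hx => ?_⟩
    have := hR (subset_tsupport g hx)
    rw [mem_closedBall_iff_norm] at this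
    exact this.trans (le_max_left _ _)
  set K := Metric.closedBall x₀ (R + 1) with hK
  -- A dilation with `l ≥ 1` only moves `x` away from `x₀`, and mollification reaches no further
  -- than distance 1. Hence radius `R + 1` works for all `k`.
  have hzero (k : ℕ) (x : Eucl N) (hx : x ∉ K) :
      (mollify (ρ k) g ∘ dilate x₀ (l k) - g) x = 0 := by
    have hx' : R + 1 < ‖x - x₀‖ := by
      rw [hK, mem_closedBall_iff_norm] at hx; exact not_le.1 hx
    have hgx : g x = 0 := by
      by_contra h
      linarith [hR x h]
    have hz : ∀ y ∈ Metric.ball (dilate x₀ (l k) x) (ρ k).rOut, g y = 0 := by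
      intro y hy
      by_contra h
      have h1 := hR y h
      rw [mem_ball_iff_norm] at hy
      have h2 : dilate x₀ (l k) x - x₀ = l k • (x - x₀) := by simp [dilate]
      have h3 : ‖dilate x₀ (l k) x - x₀‖ = l k * ‖x - x₀‖ := by
        rw [h2, norm_smul, Real.norm_of_nonneg (by linarith [hl1 k])]
      have h4 : ‖dilate x₀ (l k) x - x₀‖ ≤ ‖y - dilate x₀ (l k) x‖ + ‖y - x₀‖ := by
        have : dilate x₀ (l k) x - x₀ = -(y - dilate x₀ (l k) x) + (y - x₀) := by abel
        rw [this]
        exact (norm_add_le _ _).trans (by rw [norm_neg])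
      have h5 : ‖x - x₀‖ ≤ l k * ‖x - x₀‖ := le_mul_of_one_le_left (norm_nonneg _) (hl1 k)
      linarith [hρ1 k]
    have hself := hz _ (Metric.mem_ball_self (ρ k).rOut_pos)
    have : mollify (ρ k) g (dilate x₀ (l k) x) = g (dilate x₀ (l k) x) :=
      (ρ k).normed_convolution_eq_right fun y hy => by rw [hz y hy, hself]
    rw [Pi.sub_apply, Function.comp_apply, this, hself, hgx, sub_zero]
  have hunif := hgc.uniformContinuous_of_continuous hg
  have hKfin : volume K ≠ ⊤ := (isCompact_closedBall x₀ (R + 1)).measure_lt_top.ne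
  set c : ℝ≥0∞ := volume K ^ (1 / p.toReal) with hc
  have hcfin : c ≠ ⊤ := ENNReal.rpow_ne_top_of_nonneg (by positivity) hKfin
  -- uniform estimate on `K`
  have hsup : ∀ ε > 0, ∀ᶠ k in atTop, ∀ x, ‖(mollify (ρ k) g ∘ dilate x₀ (l k) - g) x‖ ≤
      ‖K.indicator (fun _ => (ε : ℝ)) x‖ := by
    intro ε hε
    obtain ⟨δ, hδ, hδg⟩ := Metric.uniformContinuous_iff.1 hunif (ε / 2) (by positivity)
    have hl' : ∀ᶠ k in atTop, (l k - 1) * (R + 1) < δ := by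
      have : Tendsto (fun k => (l k - 1) * (R + 1)) atTop (𝓝 ((1 - 1) * (R + 1))) :=
        (hl.sub_const 1).mul_const _
      rw [sub_self, zero_mul] at this
      exact this.eventually (gt_mem_nhds hδ)
    filter_upwards [hl', hρ.eventually (gt_mem_nhds hδ)] with k hk1 hk2 x
    by_cases hx : x ∈ K
    · rw [indicator_of_mem hx, Real.norm_of_nonneg hε.le, Pi.sub_apply, Function.comp_apply,
        ← dist_eq_norm]
      have h1 : dist (mollify (ρ k) g (dilate x₀ (l k) x)) (g (dilate x₀ (l k) x)) ≤ ε / 2 :=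
        (ρ k).dist_normed_convolution_le hg.aestronglyMeasurable fun y hy =>
          (hδg (lt_trans (Metric.mem_ball.1 hy) hk2)).le
      have h2 : dist (g (dilate x₀ (l k) x)) (g x) ≤ ε / 2 := by
        refine (hδg ?_).le
        have : dilate x₀ (l k) x - x = (l k - 1) • (x - x₀) := by
          simp only [dilate]; module
        rw [dist_eq_norm, this, norm_smul, Real.norm_of_nonneg (by linarith [hl1 k])]
        refine lt_of_le_of_lt (mul_le_mul_of_nonneg_left ?_ (by linarith [hl1 k])) hk1
        exact mem_closedBall_iff_norm.1 hx
      linarith [dist_triangle (mollify (ρ k) g (dilate x₀ (l k) x)) (g (dilate x₀ (l k) x)) (g x)]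
    · rw [hzero k x hx, norm_zero]; positivity
  rw [ENNReal.tendsto_nhds_zero]
  intro η hη
  obtain ⟨ε, hε, hεη⟩ : ∃ ε : ℝ, 0 < ε ∧ ENNReal.ofReal ε * c ≤ η := by
    have ht : Tendsto (fun ε : ℝ => ENNReal.ofReal ε * c) (𝓝[>] 0) (𝓝 (ENNReal.ofReal 0 * c)) :=
      (ENNReal.Tendsto.mul_const (ENNReal.tendsto_ofReal tendsto_id) (Or.inr hcfin)).mono_left
        nhdsWithin_le_nhds
    rw [ENNReal.ofReal_zero, zero_mul] at ht
    obtain ⟨ε, h1, h2⟩ := ((ht.eventually (Iic_mem_nhds hη)).and self_mem_nhdsWithin).exists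
    exact ⟨ε, h2, h1⟩
  filter_upwards [hsup ε hε] with k hk
  refine (eLpNorm_mono hk).trans ?_
  rw [eLpNorm_indicator_const Metric.isClosed_closedBall.measurableSet hp0 hpt,
    Real.enorm_eq_ofReal hε.le]
  exact hεη

/-- Mollified dilations converge in `Lᵖ`. -/
lemma tendsto_eLpNorm_mollify [CompleteSpace V] {ρ : ℕ → ContDiffBump (0 : Eucl N)} {l : ℕ → ℝ}
    (hρ : Tendsto (fun k => (ρ k).rOut) atTop (𝓝 0)) (hl : Tendsto l atTop (𝓝 1))
    (hl1 : ∀ k, 1 ≤ l k) (hρ1 : ∀ k, (ρ k).rOut ≤ 1)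
    (x₀ : Eucl N) {f : Eucl N → V} {p : ℝ≥0∞} (hp : 1 ≤ p) (hpt : p ≠ ⊤)
    (hf : MemLp f p volume) :
    Tendsto (fun k => eLpNorm (mollify (ρ k) f ∘ dilate x₀ (l k) - f) p volume) atTop (𝓝 0) := by
  rw [ENNReal.tendsto_nhds_zero]
  intro η hη
  have hη3 : η / 3 ≠ 0 := (ENNReal.div_pos hη.ne' (by norm_num)).ne'
  obtain ⟨g, hgc, hfg, hg, hgm⟩ := hf.exists_hasCompactSupport_eLpNorm_sub_le hpt hη3
  have htend := tendsto_eLpNorm_mollify_of_continuous hρ hl hl1 hρ1 x₀ hg hgc hp hpt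
  have hfl := hf.locallyIntegrable hp
  have hgl := hgm.locallyIntegrable hp
  filter_upwards [(ENNReal.tendsto_nhds_zero.1 htend) (η / 3) (pos_iff_ne_zero.2 hη3)] with k hk
  -- Density argument in three terms: the operators are `Lᵖ` contractions, so the first and the last
  -- are controlled by the distance of `f` to `g`.
  have hsplit : mollify (ρ k) f ∘ dilate x₀ (l k) - f =
      (mollify (ρ k) (f - g) ∘ dilate x₀ (l k)) +
        ((mollify (ρ k) g ∘ dilate x₀ (l k) - g) + (g - f)) := by
    rw [mollify_sub _ hfl hgl]
    funext x
    simp only [Pi.add_apply, Pi.sub_apply, Function.comp_apply]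
    abel
  have hd := continuous_dilate x₀ (l k)
  have hcg := continuous_mollify (ρ k) hgl
  have hcfg := continuous_mollify (ρ k) (hfl.sub hgl)
  have h1 : eLpNorm (mollify (ρ k) (f - g) ∘ dilate x₀ (l k)) p volume ≤ η / 3 :=
    ((eLpNorm_comp_dilate_le x₀ (hl1 k) hcfg p).trans
      (eLpNorm_mollify_le _ (hf.1.sub hgm.1) hp hpt)).trans hfg
  have h3 : eLpNorm (g - f) p volume ≤ η / 3 := by rwa [eLpNorm_sub_comm]
  rw [hsplit]
  refine (eLpNorm_add_le (hcfg.comp hd).aestronglyMeasurable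
    (((hcg.comp hd).aestronglyMeasurable.sub hgm.1).add (hgm.1.sub hf.1)) hp).trans ?_
  refine (add_le_add h1 ((eLpNorm_add_le ((hcg.comp hd).aestronglyMeasurable.sub hgm.1)
    (hgm.1.sub hf.1) hp).trans (add_le_add hk h3))).trans ?_
  rw [← add_assoc, ENNReal.add_thirds]

end Mollify

/-! ### Approximation by smooth functions vanishing on the boundary -/

section Approximation

variable {N : ℕ} {V : Type*} [NormedAddCommGroup V] [NormedSpace ℝ V]

/-- `u` has weak gradient `g` when tested against all smooth functions with compact support in the
whole space, i.e. the extension by zero of `g` is the weak gradient of that of `u`. -/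
def HasZeroTraceGradient (Ω : Set (Eucl N)) (u : Eucl N → V) (g : Eucl N → Eucl N →L[ℝ] V) :
    Prop :=
  ∀ φ : Eucl N → ℝ, ContDiff ℝ ∞ φ → HasCompactSupport φ →
    ∀ e : Eucl N, ∫ x in Ω, fderiv ℝ φ x e • u x = - ∫ x in Ω, φ x • g x e

/-- The derivative is put on the kernel, and the reflected kernel `f (z - ·)` serves as test
function. It may reach across `∂Ω`, which is exactly why test functions on the whole space are
needed. -/
lemma HasZeroTraceGradient.hasFDerivAt_mollify [CompleteSpace V] {Ω : Set (Eucl N)} {u : Eucl N → V}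
    {g : Eucl N → Eucl N →L[ℝ] V} (h : HasZeroTraceGradient Ω u g) (hΩ : MeasurableSet Ω)
    (hu : LocallyIntegrable (Ω.indicator u) volume) (hg : LocallyIntegrable (Ω.indicator g) volume)
    (ρ : ContDiffBump (0 : Eucl N)) (z : Eucl N) :
    HasFDerivAt (mollify ρ (Ω.indicator u)) (mollify ρ (Ω.indicator g) z) z := by
  set f : Eucl N → ℝ := ρ.normed volume with hf
  have hfs : ContDiff ℝ ∞ f := ρ.contDiff_normed
  have hfc : HasCompactSupport f := ρ.hasCompactSupport_normed
  have hf1 : ContDiff ℝ 1 f := hfs.of_le (by exact_mod_cast le_top)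
  have hD := hfc.hasFDerivAt_convolution_left (ContinuousLinearMap.lsmul ℝ ℝ) hf1 hu z
  suffices hEq : (convolution (fderiv ℝ f) (Ω.indicator u)
      ((ContinuousLinearMap.lsmul ℝ ℝ).precompL (Eucl N)) volume) z
      = mollify ρ (Ω.indicator g) z by
    rw [← hEq]; exact hD
  have hc1 := ((hfc.fderiv ℝ).convolutionExists_left
    ((ContinuousLinearMap.lsmul ℝ ℝ).precompL (Eucl N)) (hf1.continuous_fderiv one_ne_zero) hu
      z).integrable_swap
  have hc2 := (hfc.convolutionExists_left (ContinuousLinearMap.lsmul ℝ ℝ) hf1.continuous hg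
      z).integrable_swap
  ext e
  set φ : Eucl N → ℝ := fun t => f (z - t) with hφ
  have hφs : ContDiff ℝ ∞ φ := hfs.comp (contDiff_const.sub contDiff_id)
  have hφc : HasCompactSupport φ :=
    hfc.comp_homeomorph (Homeomorph.subLeft z)
  have hφd (t : Eucl N) : fderiv ℝ φ t e = - fderiv ℝ f (z - t) e := by
    have h1 : HasFDerivAt φ ((fderiv ℝ f (z - t)).comp (-ContinuousLinearMap.id ℝ (Eucl N))) t :=
      ((hf1.differentiable one_ne_zero) (z - t)).hasFDerivAt.comp t
        ((hasFDerivAt_id t).const_sub z)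
    rw [h1.fderiv]; simp
  have key := h φ hφs hφc e
  rw [convolution_eq_swap, ContinuousLinearMap.integral_apply hc1, mollify,
    convolution_eq_swap, ContinuousLinearMap.integral_apply hc2]
  have e1 : ∫ t, ((ContinuousLinearMap.lsmul ℝ ℝ).precompL (Eucl N)) (fderiv ℝ f (z - t))
      (Ω.indicator u t) e = ∫ t in Ω, fderiv ℝ f (z - t) e • u t := by
    rw [← integral_indicator hΩ]
    refine integral_congr_ae (ae_of_all _ fun t => ?_)
    by_cases ht : t ∈ Ω <;> simp [ht]
  have e2 : ∫ t, (ContinuousLinearMap.lsmul ℝ ℝ) (f (z - t)) (Ω.indicator g t) e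
      = ∫ t in Ω, φ t • g t e := by
    rw [← integral_indicator hΩ]
    refine integral_congr_ae (ae_of_all _ fun t => ?_)
    by_cases ht : t ∈ Ω <;> simp [ht, hφ]
  rw [e1, e2]
  simp only [hφd, neg_smul, integral_neg, neg_inj] at key
  exact key

/-- If the dilated point minus some `t` with `‖t‖ ≤ (l - 1) r` were in `Ω`, then `x` would be a
convex combination of it and `x₀ + (l - 1)⁻¹ • t`, a point of the ball, and so would lie in `Ω`. -/
lemma mollify_dilate_eq_zero {Ω : Set (Eucl N)} (hΩ : Convex ℝ Ω) {x₀ : Eucl N} {r : ℝ}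
    (hball : Metric.closedBall x₀ r ⊆ Ω) (ρ : ContDiffBump (0 : Eucl N)) {l : ℝ} (hl : 1 < l)
    (hρ : ρ.rOut ≤ (l - 1) * r) (u : Eucl N → V) {x : Eucl N} (hx : x ∉ Ω) :
    mollify ρ (Ω.indicator u) (dilate x₀ l x) = 0 := by
  rw [mollify_apply]
  refine integral_eq_zero_of_ae (ae_of_all _ fun t => ?_)
  by_cases ht : t ∈ Function.support (ρ.normed volume)
  · rw [ρ.support_normed_eq, mem_ball_zero_iff] at ht
    have hy : dilate x₀ l x - t ∉ Ω := by
      intro hy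
      apply hx
      have hl1 : 0 < l - 1 := by linarith
      have hl0 : 0 < l := by linarith
      have hw : x₀ + (l - 1)⁻¹ • t ∈ Ω := by
        apply hball
        rw [mem_closedBall_iff_norm, add_sub_cancel_left, norm_smul, norm_inv,
          Real.norm_of_nonneg hl1.le, inv_mul_le_iff₀ hl1]
        exact ht.le.trans hρ
      have := hΩ hy hw (inv_nonneg.2 hl0.le) (b := 1 - l⁻¹)
        (sub_nonneg.2 (inv_le_one_of_one_le₀ hl.le)) (by ring)
      have hxe : l⁻¹ • (dilate x₀ l x - t) + (1 - l⁻¹) • (x₀ + (l - 1)⁻¹ • t) = x := by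
        have h1 : l⁻¹ * l = 1 := inv_mul_cancel₀ hl0.ne'
        have h2 : (1 - l⁻¹) * (l - 1)⁻¹ = l⁻¹ := by field_simp
        calc l⁻¹ • (dilate x₀ l x - t) + (1 - l⁻¹) • (x₀ + (l - 1)⁻¹ • t)
            = (l⁻¹ * l) • (x - x₀) + x₀ + ((1 - l⁻¹) * (l - 1)⁻¹ - l⁻¹) • t := by
              simp only [dilate]; module
          _ = x := by rw [h1, h2]; module
      rwa [hxe] at this
    simp [hy]
  · rw [Function.notMem_support] at ht
    simp [ht]

lemma contDiff_mollify_dilate (ρ : ContDiffBump (0 : Eucl N)) {u : Eucl N → V}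
    (hu : LocallyIntegrable u volume) (x₀ : Eucl N) (l : ℝ) :
    ContDiff ℝ 1 (mollify ρ u ∘ dilate x₀ l) := by
  have h1 : ContDiff ℝ 1 (mollify ρ u) :=
    ρ.hasCompactSupport_normed.contDiff_convolution_left _ (n := 1) ρ.contDiff_normed hu
  have h2 : ContDiff ℝ 1 (dilate x₀ l) := by unfold dilate; fun_prop
  exact h1.comp h2

lemma HasZeroTraceGradient.fderiv_mollify_dilate [CompleteSpace V] {Ω : Set (Eucl N)}
    {u : Eucl N → V} {g : Eucl N → Eucl N →L[ℝ] V} (h : HasZeroTraceGradient Ω u g)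
    (hΩ : MeasurableSet Ω) (hu : LocallyIntegrable (Ω.indicator u) volume)
    (hg : LocallyIntegrable (Ω.indicator g) volume) (ρ : ContDiffBump (0 : Eucl N))
    (x₀ : Eucl N) (l : ℝ) (x : Eucl N) :
    fderiv ℝ (mollify ρ (Ω.indicator u) ∘ dilate x₀ l) x =
      l • mollify ρ (Ω.indicator g) (dilate x₀ l x) := by
  have h1 := h.hasFDerivAt_mollify hΩ hu hg ρ (dilate x₀ l x)
  have h2 : HasFDerivAt (dilate x₀ l) (l • ContinuousLinearMap.id ℝ (Eucl N)) x :=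
    (((hasFDerivAt_id x).sub_const x₀).const_smul l).const_add x₀
  rw [(h1.comp x h2).fderiv, ContinuousLinearMap.comp_smul, ContinuousLinearMap.comp_id]

/-- The chain rule produces the factor `1 + a`, and `(1 + a) S - g = (1 + a)(S - g) + a g` separates
the error of approximation from the error of scaling. -/
lemma HasZeroTraceGradient.eLpNorm_fderiv_sub_le [CompleteSpace V] {Ω : Set (Eucl N)}
    {u : Eucl N → V} {g : Eucl N → Eucl N →L[ℝ] V} (h : HasZeroTraceGradient Ω u g)
    (hΩ : MeasurableSet Ω) (hu : LocallyIntegrable (Ω.indicator u) volume) {p : ℝ≥0∞} (hp : 1 ≤ p)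
    (hg : MemLp (Ω.indicator g) p volume) (ρ : ContDiffBump (0 : Eucl N)) (x₀ : Eucl N)
    {a : ℝ} (ha0 : 0 ≤ a) (ha1 : a ≤ 1) :
    eLpNorm (fderiv ℝ (mollify ρ (Ω.indicator u) ∘ dilate x₀ (1 + a)) - g) p (volume.restrict Ω) ≤
      2 * eLpNorm (mollify ρ (Ω.indicator g) ∘ dilate x₀ (1 + a) - Ω.indicator g) p volume
        + ‖a‖ₑ * eLpNorm (Ω.indicator g) p volume := by
  have hgl := hg.locallyIntegrable hp
  have hSm : AEStronglyMeasurable (mollify ρ (Ω.indicator g) ∘ dilate x₀ (1 + a)) volume :=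
    ((continuous_mollify ρ hgl).comp (continuous_dilate x₀ (1 + a))).aestronglyMeasurable
  have e1 : fderiv ℝ (mollify ρ (Ω.indicator u) ∘ dilate x₀ (1 + a)) - g
      =ᵐ[volume.restrict Ω]
      (1 + a) • (mollify ρ (Ω.indicator g) ∘ dilate x₀ (1 + a) - Ω.indicator g)
        + a • Ω.indicator g := by
    filter_upwards [ae_restrict_mem hΩ] with x hx
    simp only [Pi.sub_apply, Pi.add_apply, Pi.smul_apply, h.fderiv_mollify_dilate hΩ hu hgl,
      indicator_of_mem hx, Function.comp_apply]
    module
  rw [eLpNorm_congr_ae e1]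
  refine (eLpNorm_restrict_le _ _ _ Ω).trans ((eLpNorm_add_le
    ((hSm.sub hg.1).const_smul _) (hg.1.const_smul _) hp).trans ?_)
  rw [eLpNorm_const_smul (1 + a) (mollify ρ (Ω.indicator g) ∘ dilate x₀ (1 + a) - Ω.indicator g),
    eLpNorm_const_smul a (Ω.indicator g)]
  gcongr
  rw [Real.enorm_eq_ofReal (by linarith)]
  exact (ENNReal.ofReal_le_ofReal (show 1 + a ≤ 2 by linarith)).trans (by simp)

lemma memLp_indicator_of_restrict {α G : Type*} [MeasurableSpace α] [NormedAddCommGroup G]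
    {μ : Measure α} {s : Set α} (hs : MeasurableSet s) {f : α → G} {p : ℝ≥0∞}
    (hf : MemLp f p (μ.restrict s)) : MemLp (s.indicator f) p μ :=
  (memLp_indicator_iff_restrict hs).2 hf

/-- A sequence of radii and dilation factors. -/
lemma exists_bump_sequence {r : ℝ} (hr : 0 < r) :
    ∃ (ρ : ℕ → ContDiffBump (0 : Eucl N)) (a : ℕ → ℝ),
      (∀ k, 0 < a k) ∧ (∀ k, a k ≤ 1) ∧ Tendsto a atTop (𝓝 0) ∧ (∀ k, (ρ k).rOut ≤ a k * r) ∧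
      (∀ k, (ρ k).rOut ≤ 1) ∧ Tendsto (fun k => (ρ k).rOut) atTop (𝓝 0) := by
  have ha0 (k : ℕ) : 0 < 1 / ((k : ℝ) + 1) := by positivity
  have ha1 (k : ℕ) : 1 / ((k : ℝ) + 1) ≤ 1 := by
    rw [div_le_one (by positivity)]
    linarith [(Nat.cast_nonneg k : (0 : ℝ) ≤ k)]
  have hat : Tendsto (fun k : ℕ => 1 / ((k : ℝ) + 1)) atTop (𝓝 0) :=
    tendsto_one_div_add_atTop_nhds_zero_nat
  have hm : 0 < min r 1 := by positivity
  refine ⟨fun k => ⟨1 / ((k : ℝ) + 1) * min r 1 / 2, 1 / ((k : ℝ) + 1) * min r 1,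
    half_pos (mul_pos (ha0 k) hm), half_lt_self (mul_pos (ha0 k) hm)⟩, fun k => 1 / ((k : ℝ) + 1),
    ha0, ha1, hat, fun k => ?_, fun k => ?_, ?_⟩
  · exact mul_le_mul_of_nonneg_left (min_le_left _ _) (ha0 k).le
  · exact mul_le_one₀ (ha1 k) hm.le (min_le_right _ _)
  · simpa using hat.mul_const (min r 1)

theorem HasZeroTraceGradient.exists_approx [CompleteSpace V] {Ω : Set (Eucl N)} {u : Eucl N → V}
    {g : Eucl N → Eucl N →L[ℝ] V} (h : HasZeroTraceGradient Ω u g) (hΩo : IsOpen Ω)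
    (hΩc : Convex ℝ Ω) {x₀ : Eucl N} {r : ℝ} (hr : 0 < r) (hball : Metric.closedBall x₀ r ⊆ Ω)
    {p : ℝ≥0∞} (hp : 1 ≤ p) (hpt : p ≠ ⊤)
    (hu : MemLp u p (volume.restrict Ω)) (hg : MemLp g p (volume.restrict Ω)) :
    ∃ ψ : ℕ → Eucl N → V, (∀ k, ContDiff ℝ 1 (ψ k)) ∧ (∀ k, ∀ x ∈ frontier Ω, ψ k x = 0) ∧
      Tendsto (fun k => eLpNorm (ψ k - u) p (volume.restrict Ω)) atTop (𝓝 0) ∧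
      Tendsto (fun k => eLpNorm (fderiv ℝ (ψ k) - g) p (volume.restrict Ω)) atTop (𝓝 0) := by
  have hΩm := hΩo.measurableSet
  have hum := memLp_indicator_of_restrict hΩm hu
  have hgm := memLp_indicator_of_restrict hΩm hg
  have hul := hum.locallyIntegrable hp
  obtain ⟨ρ, a, ha0, ha1, hat, hρr, hρ1, hρt⟩ := exists_bump_sequence (N := N) hr
  have hlt : Tendsto (fun k => 1 + a k) atTop (𝓝 1) := by
    simpa using hat.const_add 1
  have hl1 (k : ℕ) : 1 ≤ 1 + a k := by linarith [ha0 k]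
  have hT1 := tendsto_eLpNorm_mollify hρt hlt hl1 hρ1 x₀ hp hpt hum
  have hT2 := tendsto_eLpNorm_mollify hρt hlt hl1 hρ1 x₀ hp hpt hgm
  refine ⟨fun k => mollify (ρ k) (Ω.indicator u) ∘ dilate x₀ (1 + a k),
    fun k => contDiff_mollify_dilate (ρ k) hul x₀ _, fun k x hx => ?_, ?_, ?_⟩
  · refine mollify_dilate_eq_zero hΩc hball (ρ k) (by linarith [ha0 k]) ?_ u ?_
    · rw [add_sub_cancel_left]
      exact hρr k
    · rw [hΩo.frontier_eq] at hx; exact hx.2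
  · refine tendsto_of_tendsto_of_tendsto_of_le_of_le tendsto_const_nhds hT1 (fun _ => zero_le)
      fun k => ?_
    refine le_trans (le_of_eq (eLpNorm_congr_ae ?_)) (eLpNorm_restrict_le _ _ _ Ω)
    filter_upwards [ae_restrict_mem hΩm] with x hx
    simp only [Pi.sub_apply, indicator_of_mem hx]
  · have t1 := ENNReal.Tendsto.const_mul (a := 2) hT2 (Or.inr (by norm_num))
    have t2 : Tendsto (fun k => ‖a k‖ₑ) atTop (𝓝 0) := by
      have := (continuous_enorm.tendsto (0 : ℝ)).comp hat
      rwa [enorm_zero] at this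
    have t3 := ENNReal.Tendsto.mul_const (b := eLpNorm (Ω.indicator g) p volume) t2
      (Or.inr hgm.eLpNorm_lt_top.ne)
    have t4 := t1.add t3
    rw [mul_zero, zero_mul, add_zero] at t4
    exact tendsto_of_tendsto_of_tendsto_of_le_of_le tendsto_const_nhds t4 (fun _ => zero_le)
      fun k => h.eLpNorm_fderiv_sub_le hΩm hul hp hgm (ρ k) x₀ (ha0 k).le (ha1 k)

end Approximation

/-! ### Consequences of weak convergence -/

section Weak

lemma integrable_clm_apply {α X Y : Type*} [MeasurableSpace α] {μ : Measure α}
    [NormedAddCommGroup X] [NormedSpace ℝ X] [NormedAddCommGroup Y] [NormedSpace ℝ Y]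
    {Λ : α → X →L[ℝ] Y} (hΛ : AEStronglyMeasurable Λ μ) {B : ℝ} (hB : ∀ᵐ z ∂μ, ‖Λ z‖ ≤ B)
    {f : α → X} (hf : Integrable f μ) : Integrable (fun z => Λ z (f z)) μ := by
  refine (hf.norm.const_mul B).mono'
    ((ContinuousLinearMap.id ℝ (X →L[ℝ] Y)).aestronglyMeasurable_comp₂ hΛ hf.1) ?_
  filter_upwards [hB] with z hz
  exact (Λ z).le_of_opNorm_le hz _

/-- On a finite measure space the bounded functional `Λ`, cut off to `A`, lies in the dual Lebesgue
space and defines a continuous functional on `Lᵖ`. -/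
theorem WeaklyConvergesLp.tendsto_setIntegral {α V : Type} [MeasurableSpace α]
    [NormedAddCommGroup V] [NormedSpace ℝ V] {p : ℝ≥0∞} [Fact (1 ≤ p)] {μ : Measure α}
    [IsFiniteMeasure μ] {f : ℕ → α → V} {g : α → V} (h : WeaklyConvergesLp p μ f g)
    {Λ : α → V →L[ℝ] ℝ} (hΛ : AEStronglyMeasurable Λ μ) {B : ℝ} (hB : ∀ z, ‖Λ z‖ ≤ B)
    {A : Set α} (hA : MeasurableSet A) :
    Tendsto (fun n => ∫ z in A, Λ z (f n z) ∂μ) atTop (𝓝 (∫ z in A, Λ z (g z) ∂μ)) := by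
  obtain ⟨hf, hg, hlim⟩ := h
  set q := p.conjExponent
  have hpq : p.HolderConjugate q := ENNReal.HolderConjugate.conjExponent Fact.out
  have hq : Fact (1 ≤ q) := ⟨ENNReal.HolderConjugate.one_le q p⟩
  have hΛm : MemLp (A.indicator Λ) q μ := by
    refine MemLp.of_bound (hΛ.indicator hA) B (ae_of_all _ fun z => ?_)
    by_cases hz : z ∈ A
    · rw [indicator_of_mem hz]; exact hB z
    · rw [indicator_of_notMem hz, norm_zero]; exact (norm_nonneg _).trans (hB z)
  let ℓ : Lp V p μ →L[ℝ] ℝ := (ContinuousLinearMap.lpPairing μ p q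
    (ContinuousLinearMap.id ℝ (V →L[ℝ] ℝ)).flip).flip (hΛm.toLp _)
  have key (k : α → V) (hk : MemLp k p μ) : ℓ (hk.toLp k) = ∫ z in A, Λ z (k z) ∂μ := by
    simp only [ℓ, ContinuousLinearMap.flip_apply, ContinuousLinearMap.lpPairing_eq_integral]
    rw [← integral_indicator hA]
    refine integral_congr_ae ?_
    filter_upwards [hk.coeFn_toLp, hΛm.coeFn_toLp] with z h1 h2
    rw [h1, h2]
    by_cases hz : z ∈ A <;> simp [hz]
  simpa only [key] using hlim ℓ

/-- Over `S ×ˢ univ`, for measurable `S`, weak convergence gives the limit of the integrals, and the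
`L¹` bound in time shows that this limit is zero. A function of `t` with zero integral over every
`S` vanishes a.e. -/
theorem ae_integral_eq_zero_of_weaklyConvergesLp {T α V G : Type} [MeasurableSpace T]
    [MeasurableSpace α] [NormedAddCommGroup V] [NormedSpace ℝ V] [NormedAddCommGroup G]
    [NormedSpace ℝ G] {p : ℝ≥0∞} [hp : Fact (1 ≤ p)] {μ : Measure T} {ν : Measure α}
    [IsFiniteMeasure μ] [IsFiniteMeasure ν]
    {f : ℕ → T × α → V} {f' : T × α → V} (hf : WeaklyConvergesLp p (μ.prod ν) f f')
    {g : ℕ → T × α → G} {g' : T × α → G} (hg : WeaklyConvergesLp p (μ.prod ν) g g')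
    {a : α → V} (ha : Integrable a ν) {b : α → G} (hb : Integrable b ν)
    {Λ₁ : α → V →L[ℝ] ℝ} (hΛ₁ : AEStronglyMeasurable Λ₁ ν) {B₁ : ℝ} (hB₁ : ∀ x, ‖Λ₁ x‖ ≤ B₁)
    {Λ₂ : α → G →L[ℝ] ℝ} (hΛ₂ : AEStronglyMeasurable Λ₂ ν) {B₂ : ℝ} (hB₂ : ∀ x, ‖Λ₂ x‖ ≤ B₂)
    (hlim : Tendsto (fun n => ∫⁻ t, ‖∫ x, (Λ₁ x (f n (t, x) - a x) + Λ₂ x (g n (t, x) - b x)) ∂ν‖ₑ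
      ∂μ) atTop (𝓝 0)) :
    ∀ᵐ t ∂μ, ∫ x, (Λ₁ x (f' (t, x) - a x) + Λ₂ x (g' (t, x) - b x)) ∂ν = 0 := by
  have hm₁ : AEStronglyMeasurable (fun z : T × α => Λ₁ z.2) (μ.prod ν) := hΛ₁.comp_snd
  have hm₂ : AEStronglyMeasurable (fun z : T × α => Λ₂ z.2) (μ.prod ν) := hΛ₂.comp_snd
  have ha' : Integrable (fun z : T × α => a z.2) (μ.prod ν) := ha.comp_snd μ
  have hb' : Integrable (fun z : T × α => b z.2) (μ.prod ν) := hb.comp_snd μ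
  have hi₁ {k : T × α → V} (hk : Integrable k (μ.prod ν)) :
      Integrable (fun z : T × α => Λ₁ z.2 (k z)) (μ.prod ν) :=
    integrable_clm_apply hm₁ (ae_of_all _ fun z => hB₁ z.2) hk
  have hi₂ {k : T × α → G} (hk : Integrable k (μ.prod ν)) :
      Integrable (fun z : T × α => Λ₂ z.2 (k z)) (μ.prod ν) :=
    integrable_clm_apply hm₂ (ae_of_all _ fun z => hB₂ z.2) hk
  let H (k : T × α → V) (l : T × α → G) (z : T × α) : ℝ :=
    Λ₁ z.2 (k z - a z.2) + Λ₂ z.2 (l z - b z.2)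
  have hfi (n) : Integrable (f n) (μ.prod ν) := (hf.1 n).integrable hp.out
  have hgi (n) : Integrable (g n) (μ.prod ν) := (hg.1 n).integrable hp.out
  have hfi' : Integrable f' (μ.prod ν) := hf.2.1.integrable hp.out
  have hgi' : Integrable g' (μ.prod ν) := hg.2.1.integrable hp.out
  have hH {k : T × α → V} {l : T × α → G} (hk : Integrable k (μ.prod ν))
      (hl : Integrable l (μ.prod ν)) : Integrable (H k l) (μ.prod ν) :=
    (hi₁ (hk.sub ha')).add (hi₂ (hl.sub hb'))
  have hsplit {k : T × α → V} {l : T × α → G} (hk : Integrable k (μ.prod ν))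
      (hl : Integrable l (μ.prod ν)) (A : Set (T × α)) :
      ∫ z in A, H k l z ∂(μ.prod ν) =
        ∫ z in A, Λ₁ z.2 (k z) ∂(μ.prod ν) + ∫ z in A, Λ₂ z.2 (l z) ∂(μ.prod ν) -
        (∫ z in A, Λ₁ z.2 (a z.2) ∂(μ.prod ν) + ∫ z in A, Λ₂ z.2 (b z.2) ∂(μ.prod ν)) := by
    rw [← integral_add (hi₁ hk).integrableOn (hi₂ hl).integrableOn,
      ← integral_add (hi₁ ha').integrableOn (hi₂ hb').integrableOn]
    refine Eq.trans ?_ (integral_sub ((hi₁ hk).add (hi₂ hl)).integrableOn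
      ((hi₁ ha').add (hi₂ hb')).integrableOn)
    refine integral_congr_ae (ae_of_all _ fun z => ?_)
    simp only [H, map_sub]
    ring
  have hprod {k : T × α → V} {l : T × α → G} (hk : Integrable k (μ.prod ν))
      (hl : Integrable l (μ.prod ν)) (S : Set T) :
      ∫ z in S ×ˢ univ, H k l z ∂(μ.prod ν) = ∫ t in S, ∫ x, H k l (t, x) ∂ν ∂μ := by
    rw [setIntegral_prod _ (hH hk hl).integrableOn]
    simp only [Measure.restrict_univ]
  refine Integrable.ae_eq_zero_of_forall_setIntegral_eq_zero (hH hfi' hgi').integral_prod_left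
    fun S hS _ => ?_
  change ∫ t in S, ∫ x, H f' g' (t, x) ∂ν ∂μ = 0
  have hA : MeasurableSet (S ×ˢ (univ : Set α)) := hS.prod .univ
  have t1 := hf.tendsto_setIntegral hm₁ (fun z => hB₁ z.2) hA
  have t2 := hg.tendsto_setIntegral hm₂ (fun z => hB₂ z.2) hA
  have t3 := (t1.add t2).sub_const (∫ z in S ×ˢ univ, Λ₁ z.2 (a z.2) ∂(μ.prod ν) +
    ∫ z in S ×ˢ univ, Λ₂ z.2 (b z.2) ∂(μ.prod ν))
  simp only [← hsplit (hfi _) (hgi _), ← hsplit hfi' hgi', hprod (hfi _) (hgi _),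
    hprod hfi' hgi'] at t3
  refine tendsto_nhds_unique t3 ?_
  rw [tendsto_iff_enorm_sub_tendsto_zero]
  refine tendsto_of_tendsto_of_tendsto_of_le_of_le tendsto_const_nhds hlim (fun _ => zero_le)
    fun n => ?_
  simp only [sub_zero]
  exact (enorm_integral_le_lintegral_enorm _).trans (setLIntegral_le_lintegral _ _)

/-- A family of almost everywhere statements that depend continuously on a parameter in a second
countable space holds almost everywhere for all parameters. -/
lemma ae_forall_eq_zero_of_continuous {T X ι : Type*} [MeasurableSpace T] {μ : Measure T}
    [TopologicalSpace X] [SecondCountableTopology X] {P : T → X → ℝ}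
    (hc : ∀ᵐ t ∂μ, Continuous (P t)) (F : ι → X) (h : ∀ i, ∀ᵐ t ∂μ, P t (F i) = 0) :
    ∀ᵐ t ∂μ, ∀ i, P t (F i) = 0 := by
  -- The dense set is taken inside the range of `F`, since the vanishing is known only there.
  obtain ⟨Q, hQc, hQd⟩ := TopologicalSpace.exists_countable_dense (range F)
  have hQ : ∀ᵐ t ∂μ, ∀ x ∈ Q, P t x = 0 := by
    rw [ae_ball_iff hQc]
    rintro ⟨x, i, rfl⟩ _
    exact h i
  filter_upwards [hc, hQ] with t ht h0 i
  have hcl : IsClosed {x : range F | P t x = 0} :=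
    isClosed_singleton.preimage (ht.comp continuous_subtype_val)
  have := hcl.closure_subset_iff.2 (fun x hx => h0 x hx) (hQd ⟨F i, i, rfl⟩)
  exact this

/-- The pairing of continuous functions with an integrable function on a bounded set is
continuous for the compact-open topology. -/
lemma continuous_setIntegral_pairing {N : ℕ} {X : Type*} [NormedAddCommGroup X] [NormedSpace ℝ X]
    {Ω : Set (Eucl N)} (hΩm : MeasurableSet Ω) (hΩ : IsCompact (closure Ω)) {w : Eucl N → X}
    (hw : IntegrableOn w Ω volume) :
    Continuous fun f : C(Eucl N, X →L[ℝ] ℝ) => ∫ x in Ω, f x (w x) := by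
  have hint (f : C(Eucl N, X →L[ℝ] ℝ)) : IntegrableOn (fun x => f x (w x)) Ω volume := by
    obtain ⟨B, hB⟩ := hΩ.exists_bound_of_continuousOn f.continuous.continuousOn
    refine integrable_clm_apply f.continuous.aestronglyMeasurable (B := B) ?_ hw
    filter_upwards [ae_restrict_mem hΩm] with x hx
    exact hB x (subset_closure hx)
  rw [continuous_iff_continuousAt]
  intro f
  set A := ∫ x in Ω, ‖w x‖ with hA
  have hA0 : 0 ≤ A := integral_nonneg fun _ => norm_nonneg _
  rw [ContinuousAt, Metric.tendsto_nhds]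
  intro ε hε
  have hunif := (ContinuousMap.tendsto_iff_forall_isCompact_tendstoUniformlyOn.1
    (tendsto_id (x := 𝓝 f))) (closure Ω) hΩ
  filter_upwards [Metric.tendstoUniformlyOn_iff.1 hunif (ε / (A + 1)) (by positivity)] with f' hf'
  rw [dist_eq_norm, ← integral_sub (hint f') (hint f)]
  refine lt_of_le_of_lt (norm_integral_le_of_norm_le
    (g := fun x => ε / (A + 1) * ‖w x‖) (hw.norm.const_mul _) ?_) ?_
  · filter_upwards [ae_restrict_mem hΩm] with x hx
    rw [← sub_apply]
    refine (f' x - f x).le_of_opNorm_le ?_ _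
    have := (hf' x (subset_closure hx)).le
    rwa [dist_comm, dist_eq_norm] at this
  · rw [integral_const_mul, ← hA, div_mul_eq_mul_div, div_lt_iff₀ (by positivity)]
    nlinarith

end Weak

/-! ### The limit of the lifted gradients -/

section Limit

lemma DG0.integrable_toFun {N : ℕ} {Ω : Set (Eucl N)} {M : Mesh Ω} {V : Type}
    [NormedAddCommGroup V] (v : DG0 M V) {μ : Measure (Eucl N)} [IsFiniteMeasure μ] :
    Integrable v.toFun μ := by
  have h : v.toFun = ∑ T : M.Cell,
      (interior (convexHull ℝ (T.1 : Set (Eucl N)))).indicator (fun _ => v T) := by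
    funext x
    simp only [DG0.toFun, Finset.sum_apply]
  rw [h]
  exact integrable_finsetSum' _ fun T _ =>
    (integrable_const (v T)).indicator isOpen_interior.measurableSet

variable {N : ℕ}

/-- The functional by which a function is tested, in the direction `e` and the component `c`. -/
def testFunctional (φ : Eucl N → ℝ) (e c : Eucl N) (x : Eucl N) : Eucl N →L[ℝ] ℝ :=
  fderiv ℝ φ x e • innerSL ℝ c

/-- The functional by which a gradient is tested, in the direction `e` and the component `c`. -/
def testFunctionalGrad (φ : Eucl N → ℝ) (e c : Eucl N) (x : Eucl N) :
    (Eucl N →L[ℝ] Eucl N) →L[ℝ] ℝ :=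
  φ x • (innerSL ℝ c).comp (ContinuousLinearMap.apply ℝ (Eucl N) e)

variable {φ : Eucl N → ℝ}

lemma continuous_testFunctional (hφ : ContDiff ℝ 1 φ) (e c : Eucl N) : Continuous (testFunctional φ e c) :=
  ((hφ.continuous_fderiv one_ne_zero).clm_apply continuous_const).smul continuous_const

lemma continuous_testFunctionalGrad (hφ : ContDiff ℝ 1 φ) (e c : Eucl N) : Continuous (testFunctionalGrad φ e c) :=
  hφ.continuous.smul continuous_const

lemma exists_bound_testFunctional (hφ : ContDiff ℝ 1 φ) (hφc : HasCompactSupport φ) (e c : Eucl N) : ∃ B, ∀ x, ‖testFunctional φ e c x‖ ≤ B :=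
  (continuous_testFunctional hφ e c).bounded_above_of_compact_support
    (((hφc.fderiv_apply ℝ e)).smul_right)

lemma exists_bound_testFunctionalGrad (hφ : ContDiff ℝ 1 φ) (hφc : HasCompactSupport φ) (e c : Eucl N) :
    ∃ B, ∀ x, ‖testFunctionalGrad φ e c x‖ ≤ B := by
  obtain ⟨B, hB⟩ := hφ.continuous.bounded_above_of_compact_support hφc
  have hB0 : 0 ≤ B := (norm_nonneg _).trans (hB 0)
  refine ⟨B * (‖c‖ * ‖e‖), fun x => ContinuousLinearMap.opNorm_le_bound _ (by positivity)
    fun G => ?_⟩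
  change ‖φ x * inner ℝ c (G e)‖ ≤ _
  rw [norm_mul, mul_assoc]
  refine mul_le_mul (hB x) ((norm_inner_le_norm c (G e)).trans ?_) (norm_nonneg _) hB0
  rw [mul_assoc, mul_comm ‖e‖]
  exact mul_le_mul_of_nonneg_left (G.le_opNorm e) (norm_nonneg _)

lemma integrable_smul_test (hφ : ContDiff ℝ 1 φ) (hφc : HasCompactSupport φ) {μ : Measure (Eucl N)} {g : Eucl N → Eucl N →L[ℝ] Eucl N}
    (hg : Integrable g μ) (e : Eucl N) : Integrable (fun x => φ x • g x e) μ := by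
  obtain ⟨B, hB⟩ := hφ.continuous.bounded_above_of_compact_support hφc
  exact (hg.apply_continuousLinearMap e).bdd_smul B hφ.continuous.aestronglyMeasurable
    (ae_of_all _ hB)

lemma integrable_fderiv_smul_test (hφ : ContDiff ℝ 1 φ) (hφc : HasCompactSupport φ) {μ : Measure (Eucl N)} {u : Eucl N → Eucl N}
    (hu : Integrable u μ) (e : Eucl N) : Integrable (fun x => fderiv ℝ φ x e • u x) μ := by
  have hc : Continuous fun x => fderiv ℝ φ x e :=
    (hφ.continuous_fderiv one_ne_zero).clm_apply continuous_const
  obtain ⟨B, hB⟩ := hc.bounded_above_of_compact_support (hφc.fderiv_apply ℝ e)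
  exact hu.bdd_smul B hc.aestronglyMeasurable (ae_of_all _ hB)

lemma integral_test (hφ : ContDiff ℝ 1 φ) (hφc : HasCompactSupport φ) {μ : Measure (Eucl N)} {u : Eucl N → Eucl N}
    {g : Eucl N → Eucl N →L[ℝ] Eucl N} (hu : Integrable u μ) (hg : Integrable g μ)
    (e c : Eucl N) :
    ∫ x, (testFunctional φ e c x (u x) + testFunctionalGrad φ e c x (g x)) ∂μ =
      inner ℝ c (∫ x, fderiv ℝ φ x e • u x ∂μ + ∫ x, φ x • g x e ∂μ) := by
  have h1 := integrable_fderiv_smul_test hφ hφc hu e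
  have h2 := integrable_smul_test hφ hφc hg e
  rw [← integral_add h1 h2, ← innerSL_apply_apply ℝ]
  refine Eq.trans ?_ (ContinuousLinearMap.integral_comp_comm (innerSL ℝ c) (h1.add h2))
  refine integral_congr_ae (ae_of_all _ fun x => ?_)
  simp [testFunctional, testFunctionalGrad, inner_add_right, inner_smul_right]

/-- Brings the residual into the form expected by `ae_integral_eq_zero_of_weaklyConvergesLp`. -/
lemma inner_residual {Ω : Set (Eucl N)} {M : Mesh Ω} (v d : DG0 M (Eucl N))
    (hφ : ContDiff ℝ 1 φ) (hφc : HasCompactSupport φ) {d₀ : Eucl N → Eucl N}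
    {D : Eucl N → Eucl N →L[ℝ] Eucl N} (hΩ : volume Ω ≠ ⊤)
    (hd₀ : IntegrableOn d₀ Ω volume) (hD : IntegrableOn D Ω volume) (e c : Eucl N) :
    ∫ x in Ω, (testFunctional φ e c x (v.toFun x - d₀ x) +
      testFunctionalGrad φ e c x ((v.liftedGradient d).toFun x - D x)) =
      inner ℝ c (residual v d φ d₀ D e) := by
  have : IsFiniteMeasure (volume.restrict Ω) := isFiniteMeasure_restrict.2 hΩ
  have hv : Integrable v.toFun (volume.restrict Ω) := v.integrable_toFun
  have hG : Integrable (v.liftedGradient d).toFun (volume.restrict Ω) :=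
    DG0.integrable_toFun _
  refine (integral_test hφ hφc (hv.sub hd₀) (hG.sub hD) e c).trans ?_
  congr 1
  have h1 := integrable_fderiv_smul_test hφ hφc hv e
  have h2 := integrable_fderiv_smul_test hφ hφc hd₀ e
  have h3 := integrable_smul_test hφ hφc hG e
  have h4 := integrable_smul_test hφ hφc hD e
  simp only [Pi.sub_apply, smul_sub, sub_apply]
  rw [integral_sub h1 h2, integral_sub h3 h4, residual, integral_add h4 h2]
  abel

end Limit

/-! ### Vanishing of the residuals and passage to the limit -/

section Limit

/-- A function that converges to zero times a function with bounded integral. -/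
lemma tendsto_lintegral_of_le_mul {T : Type*} [MeasurableSpace T] {μ : Measure T}
    [IsFiniteMeasure μ] {J : T → ℝ≥0∞} (hJ : ∫⁻ t, J t ∂μ < ⊤) {ε : ℕ → ℝ}
    (hε : Tendsto ε atTop (𝓝 0)) {a b : ℝ≥0∞} (ha : a ≠ ⊤) (hb : b ≠ ⊤) {f : ℕ → T → ℝ≥0∞}
    (hf : ∀ n t, f n t ≤ ENNReal.ofReal (ε n) * (a * J t + b)) :
    Tendsto (fun n => ∫⁻ t, f n t ∂μ) atTop (𝓝 0) := by
  have hfin : ∫⁻ t, (a * J t + b) ∂μ ≠ ⊤ := by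
    rw [lintegral_add_right _ measurable_const, lintegral_const_mul' _ _ ha, lintegral_const]
    exact ENNReal.add_ne_top.2 ⟨ENNReal.mul_ne_top ha hJ.ne,
      ENNReal.mul_ne_top hb (measure_ne_top μ _)⟩
  have h1 : Tendsto (fun n => ENNReal.ofReal (ε n) * ∫⁻ t, (a * J t + b) ∂μ) atTop (𝓝 0) := by
    have := ENNReal.Tendsto.mul_const (ENNReal.tendsto_ofReal hε) (Or.inr hfin)
    rwa [ENNReal.ofReal_zero, zero_mul] at this
  refine tendsto_of_tendsto_of_tendsto_of_le_of_le tendsto_const_nhds h1 (fun _ => zero_le)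
    fun n => ?_
  rw [← lintegral_const_mul' _ _ ENNReal.ofReal_ne_top]
  exact lintegral_mono (hf n)

variable {m : ℕ} {Ω : Set (Eucl (m + 1))} {τ : ℝ} {M : ℕ → Mesh Ω} {h : ℕ → ℝ}
  {d₀ : Eucl (m + 1) → Eucl (m + 1)} {D : Eucl (m + 1) → Eucl (m + 1) →L[ℝ] Eucl (m + 1)}
  {d : ∀ n, DG0 (M n) (Eucl (m + 1))} {C : ℝ} {v : ∀ n, ℝ → DG0 (M n) (Eucl (m + 1))}

lemma tendsto_lintegral_inner_residual (hΩo : IsOpen Ω) (hΩc : Convex ℝ Ω)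
    (hK : IsCompact (closure Ω)) (hne : Ω.Nonempty)
    (hh : Tendsto h atTop (𝓝 0))
    (hM : ∀ n, ∀ T ∈ (M n).cells, Metric.diam (convexHull ℝ (T : Set (Eucl (m + 1)))) ≤ h n)
    (hd₀ : ContinuousOn d₀ (closure Ω)) (hD : ContinuousOn D (closure Ω))
    (hd₀D : ∀ x ∈ Ω, HasFDerivAt d₀ (D x) x)
    (hd : ∀ n, ∀ F ∈ (M n).facets, Mesh.IsBoundary Ω F → ∀ T ∈ (M n).cellsAt F,
      ∀ x ∈ convexHull ℝ (F : Set (Eucl (m + 1))), ‖d n T - d₀ x‖ ≤ C * h n)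
    (hJ : ∫⁻ t in Ioo 0 τ, ⨆ n, ENNReal.ofReal (v n t).jumpSeminorm < ⊤)
    {φ : Eucl (m + 1) → ℝ} (hφ : ContDiff ℝ 1 φ) (hφc : HasCompactSupport φ)
    (e c : Eucl (m + 1)) :
    Tendsto (fun n => ∫⁻ t in Ioo 0 τ, ‖inner ℝ c (residual (v n t) (d n) φ d₀ D e)‖ₑ) atTop
      (𝓝 0) := by
  obtain ⟨x₀, hx₀⟩ := hne
  obtain ⟨r, hr, hball⟩ := Metric.nhds_basis_closedBall.mem_iff.1 (hΩo.mem_nhds hx₀)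
  obtain ⟨L, hL⟩ := hφ.lipschitzWith_of_hasCompactSupport hφc one_ne_zero
  obtain ⟨B, hB⟩ := hφ.continuous.bounded_above_of_compact_support hφc
  have hB0 : 0 ≤ B := (norm_nonneg _).trans (hB 0)
  obtain ⟨D₀, hD₀⟩ := hK.exists_bound_of_continuousOn hd₀
  have hD₀0 : 0 ≤ D₀ := (norm_nonneg _).trans (hD₀ x₀ (subset_closure hx₀))
  obtain ⟨H, hH⟩ := hh.abs.bddAbove_range
  have hH' (n : ℕ) : |h n| ≤ H := hH ⟨n, rfl⟩
  have hL' : ∀ x ∈ closure Ω, ∀ y ∈ closure Ω, |φ x - φ y| ≤ L * ‖x - y‖ := fun x _ y _ => by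
    rw [← Real.norm_eq_abs, ← dist_eq_norm, ← dist_eq_norm]
    exact hL.dist_le_mul x y
  -- Bounds the jump-free part of the residual estimate uniformly in `n`, using that the convergent
  -- sequence `h` is bounded by `H`. Absolute values avoid assumptions on the signs of `C` and `h
  -- n`.
  set K : ℝ := (L * (D₀ + |C| * H) + B * |C|) * ((m + 1) * volume.real Ω / r) with hKdef
  have hε : Tendsto (fun n => ‖c‖ * ‖e‖ * |h n|) atTop (𝓝 0) := by
    simpa using hh.abs.const_mul (‖c‖ * ‖e‖)
  refine tendsto_lintegral_of_le_mul hJ hε (a := ENNReal.ofReal L) (b := ENNReal.ofReal K)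
    ENNReal.ofReal_ne_top ENNReal.ofReal_ne_top fun n t => ?_
  have hCh : C * h n ≤ |C| * |h n| := by rw [← abs_mul]; exact le_abs_self _
  have hres := norm_residual_le (v n t) (d n) hΩo hΩc hr hball hφ hd₀ hD hd₀D hL' L.2
    (fun x _ => hB x) hB0 hD₀ hD₀0 (abs_nonneg (h n)) (abs_nonneg C)
    (fun T => (hM n T.1 T.2).trans (le_abs_self _))
    (fun F hF hFb T hT x hx => (hd n F hF hFb T hT x hx).trans hCh) e
  have hJ0 : 0 ≤ (v n t).jumpSeminorm :=
    Finset.sum_nonneg fun F _ => mul_nonneg (facetArea_nonneg F) (norm_nonneg _)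
  have hKle : (L * (D₀ + |C| * |h n|) + B * |C|) * ((m + 1) * volume.real Ω / r) ≤ K := by
    rw [hKdef]
    have := hH' n
    gcongr
  have hfin : ‖inner ℝ c (residual (v n t) (d n) φ d₀ D e)‖ ≤
      ‖c‖ * ‖e‖ * |h n| * (L * (v n t).jumpSeminorm + K) := by
    refine (norm_inner_le_norm c _).trans ?_
    rw [show ‖c‖ * ‖e‖ * |h n| * (L * (v n t).jumpSeminorm + K) =
      ‖c‖ * (‖e‖ * |h n| * (L * (v n t).jumpSeminorm + K)) by ring]
    refine mul_le_mul_of_nonneg_left (hres.trans ?_) (norm_nonneg _)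
    exact mul_le_mul_of_nonneg_left (add_le_add_right hKle _) (by positivity)
  have hK0 : 0 ≤ K := le_trans (by positivity) hKle
  rw [← ofReal_norm]
  refine (ENNReal.ofReal_le_ofReal hfin).trans ?_
  rw [ENNReal.ofReal_mul (by positivity), ENNReal.ofReal_add (mul_nonneg L.coe_nonneg hJ0) hK0,
    ENNReal.ofReal_mul L.coe_nonneg]
  gcongr
  exact le_iSup (fun n => ENNReal.ofReal (v n t).jumpSeminorm) n

/-- The functional by which pairs of a function and its gradient are tested. -/
def testPair {N : ℕ} (φ : Eucl N → ℝ) (e c x : Eucl N) :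
    Eucl N × (Eucl N →L[ℝ] Eucl N) →L[ℝ] ℝ :=
  (testFunctional φ e c x).coprod (testFunctionalGrad φ e c x)

lemma continuous_testPair {N : ℕ} {φ : Eucl N → ℝ} (hφ : ContDiff ℝ 1 φ) (e c : Eucl N) :
    Continuous (testPair φ e c) :=
  (ContinuousLinearMap.coprodEquivL (𝕜 := ℝ) (E := Eucl N) (F := Eucl N →L[ℝ] Eucl N) (G := ℝ)
    ℝ).continuous.comp
    ((continuous_testFunctional hφ e c).prodMk (continuous_testFunctionalGrad hφ e c))

/-- For one choice of `φ`, `e` and `c` the identity holds outside a null set that depends on the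
choice. Viewed as continuous functionals with the compact-open topology, the tests lie in a second
countable space, and the pairing is continuous for a.e. `t`, so one null set suffices. -/
theorem ae_hasZeroTraceGradient (hΩo : IsOpen Ω) (hΩc : Convex ℝ Ω)
    (hK : IsCompact (closure Ω)) (hne : Ω.Nonempty)
    (hh : Tendsto h atTop (𝓝 0))
    (hM : ∀ n, ∀ T ∈ (M n).cells, Metric.diam (convexHull ℝ (T : Set (Eucl (m + 1)))) ≤ h n)
    (hd₀ : ContinuousOn d₀ (closure Ω)) (hD : ContinuousOn D (closure Ω))
    (hd₀D : ∀ x ∈ Ω, HasFDerivAt d₀ (D x) x)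
    (hd : ∀ n, ∀ F ∈ (M n).facets, Mesh.IsBoundary Ω F → ∀ T ∈ (M n).cellsAt F,
      ∀ x ∈ convexHull ℝ (F : Set (Eucl (m + 1))), ‖d n T - d₀ x‖ ≤ C * h n)
    (hJ : ∫⁻ t in Ioo 0 τ, ⨆ n, ENNReal.ofReal (v n t).jumpSeminorm < ⊤)
    {p : ℝ≥0∞} [hp : Fact (1 ≤ p)] {v' : ℝ × Eucl (m + 1) → Eucl (m + 1)}
    {W : ℝ × Eucl (m + 1) → Eucl (m + 1) →L[ℝ] Eucl (m + 1)}
    (hv : WeaklyConvergesLp p (cylinder τ Ω) (fun n z => (v n z.1).toFun z.2) v')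
    (hW : WeaklyConvergesLp p (cylinder τ Ω)
      (fun n z => ((v n z.1).liftedGradient (d n)).toFun z.2) W) :
    ∀ᵐ t ∂(volume.restrict (Ioo 0 τ)),
      HasZeroTraceGradient Ω (fun x => v' (t, x) - d₀ x) (fun x => W (t, x) - D x) := by
  have hΩfin : volume Ω ≠ ⊤ := ((measure_mono subset_closure).trans_lt hK.measure_lt_top).ne
  have hfΩ : IsFiniteMeasure (volume.restrict Ω) := isFiniteMeasure_restrict.2 hΩfin
  have hfτ : IsFiniteMeasure (volume.restrict (Ioo 0 τ)) :=
    isFiniteMeasure_restrict.2 measure_Ioo_lt_top.ne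
  have hd₀i : IntegrableOn d₀ Ω volume := (hd₀.integrableOn_compact hK).mono_set subset_closure
  have hDi : IntegrableOn D Ω volume := (hD.integrableOn_compact hK).mono_set subset_closure
  have : IsFiniteMeasure (cylinder τ Ω) := by unfold cylinder; infer_instance
  have hvi : ∀ᵐ t ∂(volume.restrict (Ioo 0 τ)), IntegrableOn (fun x => v' (t, x)) Ω volume :=
    Integrable.prod_right_ae (hv.2.1.integrable hp.out)
  have hWi : ∀ᵐ t ∂(volume.restrict (Ioo 0 τ)), IntegrableOn (fun x => W (t, x)) Ω volume :=
    Integrable.prod_right_ae (hW.2.1.integrable hp.out)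
  let X := Eucl (m + 1) × (Eucl (m + 1) →L[ℝ] Eucl (m + 1))
  let ι := {φ : Eucl (m + 1) → ℝ // ContDiff ℝ ∞ φ ∧ HasCompactSupport φ} ×
    Eucl (m + 1) × Eucl (m + 1)
  have hι (i : ι) : ContDiff ℝ 1 i.1.1 := i.1.2.1.of_le (by exact_mod_cast le_top)
  let F : ι → C(Eucl (m + 1), X →L[ℝ] ℝ) := fun i =>
    ⟨testPair i.1.1 i.2.1 i.2.2, continuous_testPair (hι i) i.2.1 i.2.2⟩
  let P : ℝ → C(Eucl (m + 1), X →L[ℝ] ℝ) → ℝ := fun t f =>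
    ∫ x in Ω, f x ((v' (t, x) - d₀ x, W (t, x) - D x) : X)
  have hF (t : ℝ) (i : ι) : P t (F i) =
      ∫ x in Ω, (testFunctional i.1.1 i.2.1 i.2.2 x (v' (t, x) - d₀ x) +
        testFunctionalGrad i.1.1 i.2.1 i.2.2 x (W (t, x) - D x)) := rfl
  have hall : ∀ᵐ t ∂(volume.restrict (Ioo 0 τ)), ∀ i, P t (F i) = 0 := by
    refine ae_forall_eq_zero_of_continuous ?_ F fun i => ?_
    · filter_upwards [hvi, hWi] with t h1 h2
      exact continuous_setIntegral_pairing hΩo.measurableSet hK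
        ((h1.sub hd₀i).prodMk (h2.sub hDi))
    · simp only [hF]
      obtain ⟨B₁, hB₁⟩ := exists_bound_testFunctional (hι i) i.1.2.2 i.2.1 i.2.2
      obtain ⟨B₂, hB₂⟩ := exists_bound_testFunctionalGrad (hι i) i.1.2.2 i.2.1 i.2.2
      refine ae_integral_eq_zero_of_weaklyConvergesLp hv hW hd₀i hDi
        (continuous_testFunctional (hι i) i.2.1 i.2.2).aestronglyMeasurable hB₁
        (continuous_testFunctionalGrad (hι i) i.2.1 i.2.2).aestronglyMeasurable hB₂ ?_
      simp only [inner_residual _ _ (hι i) i.1.2.2 hΩfin hd₀i hDi]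
      exact tendsto_lintegral_inner_residual hΩo hΩc hK hne hh hM hd₀ hD hd₀D hd hJ (hι i)
        i.1.2.2 i.2.1 i.2.2
  filter_upwards [hall, hvi, hWi] with t ht h1 h2 φ hφ hφc e
  rw [← add_eq_zero_iff_eq_neg]
  refine ext_inner_left ℝ fun c => ?_
  rw [inner_zero_right, ← ht ⟨⟨φ, hφ, hφc⟩, e, c⟩, hF]
  exact (integral_test (hφ.of_le (by exact_mod_cast le_top)) hφc (h1.sub hd₀i) (h2.sub hDi)
    e c).symm

end Limit

/-! ### Sobolev gradient and trace of the limit -/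

section Trace

lemma memLp_restrict_of_continuousOn {N : ℕ} {V : Type*} [NormedAddCommGroup V]
    [SecondCountableTopology V] {Ω : Set (Eucl N)} (hΩ : MeasurableSet Ω)
    (hK : IsCompact (closure Ω)) {f : Eucl N → V} (hf : ContinuousOn f (closure Ω)) (p : ℝ≥0∞) :
    MemLp f p (volume.restrict Ω) := by
  have : IsFiniteMeasure (volume.restrict Ω) :=
    isFiniteMeasure_restrict.2 ((measure_mono subset_closure).trans_lt hK.measure_lt_top).ne
  obtain ⟨B, hB⟩ := hK.exists_bound_of_continuousOn hf
  refine MemLp.of_bound ((hf.mono subset_closure).aestronglyMeasurable hΩ) B ?_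
  filter_upwards [ae_restrict_mem hΩ] with x hx
  exact hB x (subset_closure hx)

lemma MemLp.prod_right_ae {α β V : Type*} [MeasurableSpace α] [MeasurableSpace β]
    [NormedAddCommGroup V] {μ : Measure α} {ν : Measure β} [SFinite μ] [SFinite ν] {p : ℝ≥0∞}
    (hp : p ≠ 0) (hpt : p ≠ ⊤) {f : α × β → V} (hf : MemLp f p (μ.prod ν)) :
    ∀ᵐ t ∂μ, MemLp (fun x => f (t, x)) p ν := by
  have h1 := ((integrable_norm_rpow_iff hf.1 hp hpt).2 hf).prod_right_ae
  filter_upwards [h1, hf.1.prodMk_left] with t ht1 ht2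
  exact (integrable_norm_rpow_iff ht2 hp hpt).1 ht1

variable {N : ℕ} {Ω : Set (Eucl N)} {d₀ : Eucl N → Eucl N} {D : Eucl N → Eucl N →L[ℝ] Eucl N}

/-- Integration by parts against test functions with compact support in `Ω`. -/
lemma setIntegral_fderiv_smul_eq_neg (hd₀ : IntegrableOn d₀ Ω volume)
    (hD : IntegrableOn D Ω volume) (hd₀D : ∀ x ∈ Ω, HasFDerivAt d₀ (D x) x) {φ : Eucl N → ℝ}
    (hφ : ContDiff ℝ 1 φ) (hφc : HasCompactSupport φ) (hsupp : tsupport φ ⊆ Ω) (e : Eucl N) :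
    ∫ x in Ω, fderiv ℝ φ x e • d₀ x = - ∫ x in Ω, φ x • D x e := by
  have z1 (x : Eucl N) (hx : x ∉ Ω) : φ x = 0 := image_eq_zero_of_notMem_tsupport fun h => hx (hsupp h)
  have z2 (x : Eucl N) (hx : x ∉ Ω) : fderiv ℝ φ x = 0 :=
    image_eq_zero_of_notMem_tsupport fun h => hx (hsupp (tsupport_fderiv_subset ℝ h))
  have extend {f : Eucl N → Eucl N} (hf : IntegrableOn f Ω volume) (h0 : ∀ x ∉ Ω, f x = 0) :
      Integrable f volume :=
    (integrableOn_iff_integrable_of_support_subset fun x hx => by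
      by_contra h; exact hx (h0 x h)).1 hf
  have i1 := extend (integrable_fderiv_smul_test hφ hφc hd₀ e) fun x hx => by simp [z2 x hx]
  have i2 := extend (integrable_smul_test hφ hφc hD e) fun x hx => by simp [z1 x hx]
  obtain ⟨B, hB⟩ := hφ.continuous.bounded_above_of_compact_support hφc
  have i3 : Integrable (fun x => φ x • d₀ x) volume :=
    extend (hd₀.bdd_smul B hφ.continuous.aestronglyMeasurable (ae_of_all _ hB))
      fun x hx => by simp [z1 x hx]
  -- The integrands vanish off `Ω`, so integration by parts on the whole space applies although `d₀`
  -- is arbitrary outside.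
  rw [setIntegral_eq_integral_of_forall_compl_eq_zero fun x hx => by simp [z2 x hx],
    setIntegral_eq_integral_of_forall_compl_eq_zero fun x hx => by simp [z1 x hx],
    ← neg_eq_iff_eq_neg]
  exact (integral_bilinear_hasFDerivAt_right_eq_neg_left_of_integrable
    (B := ContinuousLinearMap.lsmul ℝ ℝ) i1 i2 i3
    (fun x _ => (hφ.differentiable one_ne_zero x).hasFDerivAt)
    (fun x hx => hd₀D x (hsupp hx))).symm

theorem HasZeroTraceGradient.hasSobolevGradient {p : ℝ≥0∞} (hp : 1 ≤ p)
    (hK : IsCompact (closure Ω)) (hd₀ : ContinuousOn d₀ (closure Ω))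
    (hD : ContinuousOn D (closure Ω)) (hd₀D : ∀ x ∈ Ω, HasFDerivAt d₀ (D x) x)
    {v : Eucl N → Eucl N} {W : Eucl N → Eucl N →L[ℝ] Eucl N}
    (h : HasZeroTraceGradient Ω (fun x => v x - d₀ x) (fun x => W x - D x))
    (hv : MemLp v p (volume.restrict Ω)) (hW : MemLp W p (volume.restrict Ω)) :
    HasSobolevGradient p Ω v W := by
  refine ⟨hv, hW, fun φ hφ hφc hsupp e => ?_⟩
  have : IsFiniteMeasure (volume.restrict Ω) :=
    isFiniteMeasure_restrict.2 ((measure_mono subset_closure).trans_lt hK.measure_lt_top).ne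
  have hφ1 : ContDiff ℝ 1 φ := hφ.of_le (by exact_mod_cast le_top)
  have hd₀i : IntegrableOn d₀ Ω volume := (hd₀.integrableOn_compact hK).mono_set subset_closure
  have hDi : IntegrableOn D Ω volume := (hD.integrableOn_compact hK).mono_set subset_closure
  have h1 := h φ hφ hφc e
  have h2 := setIntegral_fderiv_smul_eq_neg hd₀i hDi hd₀D hφ1 hφc hsupp e
  have j1 := integrable_fderiv_smul_test hφ1 hφc (hv.integrable hp) e
  have j2 := integrable_fderiv_smul_test hφ1 hφc hd₀i e
  have j3 := integrable_smul_test hφ1 hφc (hW.integrable hp) e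
  have j4 := integrable_smul_test hφ1 hφc hDi e
  simp only [smul_sub, sub_apply] at h1
  rw [integral_sub j1 j2, integral_sub j3 j4, h2] at h1
  rw [neg_sub, sub_neg_eq_add, ← eq_sub_iff_add_eq] at h1
  rw [h1]; abel

/-- The approximations are `d₀ + ψ k` with `ψ k` zero on the frontier: they coincide with `d₀`
there, so convergence of the boundary values needs no trace inequality. -/
theorem HasZeroTraceGradient.hasTrace {p : ℝ≥0∞} (hp : 1 ≤ p) (hpt : p ≠ ⊤) (hΩo : IsOpen Ω)
    (hΩc : Convex ℝ Ω) (hne : Ω.Nonempty)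
    (hK : IsCompact (closure Ω)) (hd₀ : ContDiffOn ℝ 1 d₀ (closure Ω))
    (hD : ContinuousOn D (closure Ω)) (hd₀D : ∀ x ∈ Ω, HasFDerivAt d₀ (D x) x)
    {v : Eucl N → Eucl N} {W : Eucl N → Eucl N →L[ℝ] Eucl N}
    (h : HasZeroTraceGradient Ω (fun x => v x - d₀ x) (fun x => W x - D x))
    (hv : MemLp v p (volume.restrict Ω)) (hW : MemLp W p (volume.restrict Ω)) :
    HasTrace p Ω v d₀ := by
  have hΩm := hΩo.measurableSet
  obtain ⟨x₀, hx₀⟩ := hne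
  obtain ⟨r, hr, hball⟩ := Metric.nhds_basis_closedBall.mem_iff.1 (hΩo.mem_nhds hx₀)
  have hd₀m := memLp_restrict_of_continuousOn hΩm hK hd₀.continuousOn p
  have hDm := memLp_restrict_of_continuousOn hΩm hK hD p
  obtain ⟨ψ, hψ, hψ0, hψ1, hψ2⟩ := h.exists_approx hΩo hΩc hr hball hp hpt (hv.sub hd₀m)
    (hW.sub hDm)
  refine ⟨W, fun k => d₀ + ψ k,
    h.hasSobolevGradient hp hK hd₀.continuousOn hD hd₀D hv hW,
    fun k => hd₀.add (hψ k).contDiffOn, ?_, ?_, ?_⟩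
  · refine hψ1.congr fun k => ?_
    congr 1
    funext x
    simp only [Pi.add_apply, Pi.sub_apply]
    abel
  · refine hψ2.congr fun k => eLpNorm_congr_ae ?_
    filter_upwards [ae_restrict_mem hΩm] with x hx
    have hψx := ((hψ k).differentiable one_ne_zero x).hasFDerivAt
    simp only [Pi.sub_apply, ((hd₀D x hx).add hψx).fderiv]
    abel
  · refine tendsto_const_nhds.congr fun k => ?_
    refine (eLpNorm_zero (p := p) (α := Eucl N) (ε := Eucl N)).symm.trans (eLpNorm_congr_ae ?_)
    filter_upwards [ae_restrict_mem isClosed_frontier.measurableSet] with x hx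
    simp [hψ0 k x hx]

end Trace

end DGLift

end

open DGLift in
theorem lemma2p7 {N : ℕ} (hN : N = 2 ∨ N = 3)
    (Ω : Set (Eucl N)) (hΩ : IsConvexPolyhedralDomain Ω)
    (τ : ℝ) (hτ : 0 < τ)
    (p : ℝ≥0∞) [Fact (1 ≤ p)] (hp1 : 1 < p) (hptop : p < ⊤)
    -- the meshes, with mesh sizes tending to zero
    (M : ℕ → Mesh Ω) (h : ℕ → ℝ) (hh : Tendsto h atTop (𝓝 0))
    (hM : ∀ n, ∀ T ∈ (M n).cells, Metric.diam (convexHull ℝ (T : Set (Eucl N))) ≤ h n)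
    -- the Dirichlet datum and its discretizations
    (d₀ : Eucl N → Eucl N) (hd₀ : ContDiffOn ℝ 1 d₀ (closure Ω))
    (d : ∀ n, DG0 (M n) (Eucl N)) (C : ℝ)
    (hd : ∀ n, ∀ F ∈ (M n).facets, Mesh.IsBoundary Ω F → ∀ T ∈ (M n).cellsAt F,
      ∀ x ∈ convexHull ℝ (F : Set (Eucl N)), ‖d n T - d₀ x‖ ≤ C * h n)
    -- the discrete functions and the limits
    (v : ∀ n, ℝ → DG0 (M n) (Eucl N))
    (v_lim : ℝ × Eucl N → Eucl N) (W : ℝ × Eucl N → Eucl N →L[ℝ] Eucl N)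
    (hv : WeaklyConvergesLp p (cylinder τ Ω) (fun n z => (v n z.1).toFun z.2) v_lim)
    (hJ : ∫⁻ t in Ioo 0 τ, ⨆ n, ENNReal.ofReal (v n t).jumpSeminorm < ⊤)
    (hW : WeaklyConvergesLp p (cylinder τ Ω)
      (fun n z => ((v n z.1).liftedGradient (d n)).toFun z.2) W) :
    ∀ᵐ t ∂(volume.restrict (Ioo 0 τ)),
      HasSobolevGradient p Ω (fun x => v_lim (t, x)) (fun x => W (t, x)) ∧
      HasTrace p Ω (fun x => v_lim (t, x)) d₀ := by
  obtain ⟨m, rfl⟩ : ∃ m, N = m + 1 := ⟨N - 1, by omega⟩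
  obtain ⟨hΩo, hne, hΩc, S, hS⟩ := hΩ
  have hK : IsCompact (closure Ω) := by
    rw [hS]; exact isCompact_convexHull_finset S
  have hint : (interior (closure Ω)).Nonempty :=
    hne.mono (interior_maximal subset_closure hΩo)
  -- The derivative within the closure serves as `∇d₀`. A convex set with nonempty interior has
  -- unique derivatives, so it is continuous up to the boundary, and in `Ω` it is the ordinary
  -- derivative.
  have hD : ContinuousOn (fderivWithin ℝ d₀ (closure Ω)) (closure Ω) :=
    hd₀.continuousOn_fderivWithin (uniqueDiffOn_convex hΩc.closure hint) le_rfl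
  have hd₀D : ∀ x ∈ Ω, HasFDerivAt d₀ (fderivWithin ℝ d₀ (closure Ω) x) x := fun x hx =>
    (hd₀.differentiableOn one_ne_zero x (subset_closure hx)).hasFDerivWithinAt.hasFDerivAt
      (mem_of_superset (hΩo.mem_nhds hx) subset_closure)
  have hp0 : p ≠ 0 := (one_pos.trans hp1).ne'
  filter_upwards [ae_hasZeroTraceGradient hΩo hΩc hK hne hh hM hd₀.continuousOn hD hd₀D hd hJ hv hW,
    MemLp.prod_right_ae hp0 hptop.ne hv.2.1, MemLp.prod_right_ae hp0 hptop.ne hW.2.1] with t h1 h2 h3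
  exact ⟨h1.hasSobolevGradient hp1.le hK hd₀.continuousOn hD hd₀D h2 h3,
    h1.hasTrace hp1.le hptop.ne hΩo hΩc hne hK hd₀ hD hd₀D h2 h3⟩
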